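/- Let $\mathrm{Mp}$ be the metaplectic double cover of $\mathrm{SL}(2,\mathbb Z)$, i.e. the group of pairs $(A,w)$ with $A=\begin{pmatrix}a&b\\c&d\end{pmatrix}\in\mathrm{SL}(2,\mathbb Z)$ and $w$ holomorphic on the upper half plane $\mathbb H$ with $w(\tau)^2=c\tau+d$, and composition law $(A,w)(B,v)=(AB,\,w(B\tau)v(\tau))$. Let $F$ be a symmetric positive definite half-integral $n\times n$ matrix (that is, $2F$ is integral with even diagonal), and write $F[x]=x^tFx$ and $e(x)=\exp(2\pi i x)$. Let $W(F)$ be the Weil representation of $\mathrm{Mp}$ attached to the finite quadratic module $D_F=\mathbb Z^n/2F\mathbb Z^n$, $Q(x)=\frac14F^{-1}[x]$, $B(x,y)=Q(x+y)-Q(x)-Q(y)$; i.e. the unique representation of $\mathrm{Mp}$ on $\mathbb C[D_F]=\bigoplus_{x\in D_F}\mathbb C\,\mathfrak e_x$ (it exists) such that, for $T=\begin{pmatrix}1&1\\0&1\end{pmatrix}$ and $S=\begin{pmatrix}0&-1\\1&0\end{pmatrix}$, $$(T,1)\,\mathfrak e_x=e(Q(x))\,\mathfrak e_x,\qquad (S,\sqrt\tau)\,\mathfrak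 e_x=\sigma\,|D_F|^{-1/2}\sum_{y\in D_F}e(-B(y,x))\,\mathfrak e_y,\qquad \sigma=|D_F|^{-1/2}\sum_{x\in D_F}e(-Q(x)),$$ where $\sqrt\tau$ has positive real part. For functions $\phi$ on $\mathbb H\times\mathbb C^n$ and $k\in\frac12\mathbb Z$ put $$(\phi|_{k,F}(A,w))(\tau,z)=\phi\Big(A\tau,\frac z{c\tau+d}\Big)\,w(\tau)^{-2k}\,e\Big(\frac{-cF[z]}{c\tau+d}\Big),$$ $$(\phi|_{k,F}[\lambda,\mu])(\tau,z)=\phi(\tau,z+\lambda\tau+\mu)\,e(\tau F[\lambda]+2z^tF\lambda)\qquad(\lambda,\mu\in\mathbb Z^n).$$ Let $\Gamma\subseteq\mathrm{Mp}$ be a subgroup of finite index. For a finite dimensional complex $\Gamma$-module $V$ let $J_{k,F}(\Gamma,V)$ be the space of Jacobi forms of weight $k$ and index $F$ with typus $(\Gamma,V)$: the holomorphic functions $\phi:\mathbb H\times\mathbb C^n\to V$ such that $(\phi|_{k,F}\alpha)|_{k,F}[\lambda,\mu]=\alpha\cdot\phi$ for all $\alpha\in\Gamma$ and $\lambda,\mu\in\mathbb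 Z^n$, and such that, for every $\alpha\in\mathrm{Mp}$, $\phi|_{k,F}\alpha$ has a Fourier expansion $\sum c(l,r)\,e(l\tau)\,e(z^tr)$ over $l\in\mathbb Q$, $r\in\mathbb Z^n$ with $4l-F^{-1}[r]\ge0$. Then there are $\mathbb C$-linear isomorphisms $$\Phi_V:\;J_{\frac n2,F}(\Gamma,V)\;\xrightarrow{\ \sim\ }\;\mathrm{Hom}_{\mathrm{Mp}}\big(W(F),\mathrm{Ind}_\Gamma^{\mathrm{Mp}}V\big),\qquad \mathrm{Ind}_\Gamma^{\mathrm{Mp}}V=\mathbb C[\mathrm{Mp}]\otimes_{\mathbb C[\Gamma]}V,$$ one for each finite dimensional complex $\Gamma$-module $V$ on which $\Gamma$ acts through a finite group. They are natural in $V$: for every $\Gamma$-homomorphism $f:V\to V'$ between such modules, $\Phi_{V'}(f\circ\phi)=\mathrm{Ind}(f)\circ\Phi_V(\phi)$. Moreover they are given explicitly by $$\sum_{g\Gamma\in\mathrm{Mp}/\Gamma}g\otimes(\phi|_{\frac n2,F}g^{-1})(\tau,z)=\sum_{x\in D_F}\vartheta_{F,x}(\tau,z)\,\Phi_V(\phi)(\mathfrak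 e_x),\qquad \vartheta_{F,x}(\tau,z)=\sum_{r\in\mathbb Z^n,\;r\equiv x\bmod 2F\mathbb Z^n}e\big(\tfrac14\tau F^{-1}[r]+r^tz\big).$$ -/

import Mathlib

open scoped UpperHalfPlane Matrix MatrixGroups Manifold

noncomputable section

namespace CriticalJacobi

/-- `e(x) = exp(2πix)`. -/
def e (x : ℂ) : ℂ := Complex.exp (2 * Real.pi * Complex.I * x)

/-! ### The metaplectic group -/

/-- The automorphy factor `cτ + d` of `A = [a,b;c,d]`. -/
def autFactor (A : SL(2, ℤ)) (τ : ℍ) : ℂ := (A 1 0 : ℂ) * (τ : ℂ) + (A 1 1 : ℂ)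

theorem autFactor_eq_denom (A : SL(2, ℤ)) (τ : ℍ) :
    autFactor A τ = UpperHalfPlane.denom (A : GL (Fin 2) ℝ) τ := by
  simp [autFactor, UpperHalfPlane.denom]

theorem autFactor_ne_zero (A : SL(2, ℤ)) (τ : ℍ) : autFactor A τ ≠ 0 := by
  rw [autFactor_eq_denom]; exact UpperHalfPlane.denom_ne_zero _ _

theorem autFactor_mul (A B : SL(2, ℤ)) (τ : ℍ) :
    autFactor (A * B) τ = autFactor A (B • τ) * autFactor B τ := by
  simp only [autFactor_eq_denom]
  have h := UpperHalfPlane.denom_cocycle_σ (A : GL (Fin 2) ℝ) (B : GL (Fin 2) ℝ) τ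
  have hs : UpperHalfPlane.σ (B : GL (Fin 2) ℝ) = .refl ℝ ℂ := by
    simp [UpperHalfPlane.σ]
  rw [hs] at h
  simpa using h

theorem mdifferentiable_SL_smul (A : SL(2, ℤ)) : MDiff (fun τ : ℍ => A • τ) :=
  UpperHalfPlane.mdifferentiable_smul (g := (A : GL (Fin 2) ℝ)) (by simp)

/-- The metaplectic double cover of `SL(2, ℤ)`: the pairs `(A, w)` of a matrix `A = [a,b;c,d]` and
a holomorphic function `w` on the upper half plane with `w(τ)² = cτ + d`. -/
@[ext]
structure Mp where
  mat : SL(2, ℤ)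
  w : ℍ → ℂ
  holo : MDiff w
  sq : ∀ τ, w τ ^ 2 = autFactor mat τ

namespace Mp

theorem w_ne_zero (α : Mp) (τ : ℍ) : α.w τ ≠ 0 := by
  intro h
  have := α.sq τ
  rw [h] at this
  exact autFactor_ne_zero _ _ (by rw [← this]; simp)

instance : One Mp where
  one :=
    { mat := 1
      w := fun _ => 1
      holo := mdifferentiable_const
      sq := fun τ => by simp [autFactor] }

/-- `(A, w) (B, v) = (AB, w(Bτ) v(τ))`. -/
instance : Mul Mp where
  mul α β :=
    { mat := α.mat * β.mat
      w := fun τ => α.w (β.mat • τ) * β.w τ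
      holo := (α.holo.comp (mdifferentiable_SL_smul β.mat)).mul β.holo
      sq := fun τ => by rw [mul_pow, α.sq, β.sq, autFactor_mul] }

instance : Inv Mp where
  inv α :=
    { mat := α.mat⁻¹
      w := fun τ => (α.w (α.mat⁻¹ • τ))⁻¹
      holo := by
        intro τ
        have h := (α.holo.comp (mdifferentiable_SL_smul α.mat⁻¹)) τ
        exact (DifferentiableAt.mdifferentiableAt
          (differentiableAt_inv (α.w_ne_zero (α.mat⁻¹ • τ)))).comp τ h
      sq := fun τ => by
        have h := autFactor_mul α.mat α.mat⁻¹ τ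
        have h1 : autFactor (α.mat * α.mat⁻¹) τ = 1 := by simp [autFactor]
        rw [h1] at h
        rw [inv_pow, α.sq]
        rw [eq_inv_of_mul_eq_one_left h.symm, inv_inv] }

@[simp] theorem one_mat : (1 : Mp).mat = 1 := rfl
@[simp] theorem one_w (τ : ℍ) : (1 : Mp).w τ = 1 := rfl
@[simp] theorem mul_mat (α β : Mp) : (α * β).mat = α.mat * β.mat := rfl
@[simp] theorem mul_w (α β : Mp) (τ : ℍ) : (α * β).w τ = α.w (β.mat • τ) * β.w τ := rfl
@[simp] theorem inv_mat (α : Mp) : (α⁻¹).mat = α.mat⁻¹ := rfl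
@[simp] theorem inv_w (α : Mp) (τ : ℍ) : (α⁻¹).w τ = (α.w (α.mat⁻¹ • τ))⁻¹ := rfl

instance : Group Mp where
  mul_assoc α β γ := by
    ext1
    · simp [mul_assoc]
    · funext τ; simp [mul_assoc, mul_smul]
  one_mul α := by
    ext1
    · simp
    · funext τ; simp
  mul_one α := by
    ext1
    · simp
    · funext τ; simp
  inv_mul_cancel α := by
    ext1
    · simp
    · funext τ; simp [α.w_ne_zero τ]

/-- The element `(T, w_T)`, where `T = [1,1;0,1]` and `w_T = 1`. -/
def T : Mp where
  mat := ModularGroup.T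
  w := fun _ => 1
  holo := mdifferentiable_const
  sq := fun τ => by simp [autFactor, ModularGroup.T]

/-- The element `(S, w_S)`, where `S = [0,-1;1,0]` and `w_S(τ) = √τ` is the square root in the
right half plane. -/
def S : Mp where
  mat := ModularGroup.S
  w := fun τ => (τ : ℂ) ^ (1 / 2 : ℂ)
  holo := by
    rw [UpperHalfPlane.mdifferentiable_iff]
    intro z hz
    have h : DifferentiableAt ℂ (fun z : ℂ => z ^ (1 / 2 : ℂ)) z :=
      differentiableAt_id.cpow_const (Or.inr (ne_of_gt hz))
    refine (h.congr_of_eventuallyEq ?_).differentiableWithinAt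
    filter_upwards [isOpen_lt continuous_const Complex.continuous_im |>.mem_nhds hz] with y hy
    simp [UpperHalfPlane.ofComplex_apply_of_im_pos hy]
  sq := fun τ => by
    rw [← Complex.cpow_nat_mul]
    simp [autFactor, ModularGroup.S]

end Mp

/-! ### Half-integral matrices and their discriminant modules -/

/-- A symmetric, positive definite, half-integral matrix `F` of size `n`: the matrix `2F` has
integer entries and even integers on the diagonal. -/
structure HalfIntegral (n : ℕ) where
  mat : Matrix (Fin n) (Fin n) ℝ
  symm : mat.IsSymm
  posDef : mat.PosDef
  two_mul_int : ∀ i j, ∃ m : ℤ, 2 * mat i j = m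
  two_mul_diag : ∀ i, ∃ m : ℤ, Even m ∧ 2 * mat i i = m

/-- An integral vector as a real vector. -/
def toReal {n : ℕ} (r : Fin n → ℤ) : Fin n → ℝ := fun i => (r i : ℝ)

theorem toReal_add {n : ℕ} (r s : Fin n → ℤ) : toReal (r + s) = toReal r + toReal s := by
  funext i; simp [toReal]

theorem toReal_neg {n : ℕ} (r : Fin n → ℤ) : toReal (-r) = -toReal r := by
  funext i; simp [toReal]

variable {n : ℕ}

namespace HalfIntegral

/-- The sublattice `2Fℤⁿ` of `ℤⁿ`. -/
def lattice (F : HalfIntegral n) : AddSubgroup (Fin n → ℤ) where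
  carrier := {r | ∃ m : Fin n → ℤ, toReal r = (2 • F.mat) *ᵥ toReal m}
  zero_mem' := ⟨0, by funext i; simp [toReal, Matrix.mulVec, dotProduct]⟩
  add_mem' := by
    rintro r s ⟨a, ha⟩ ⟨b, hb⟩
    exact ⟨a + b, by rw [toReal_add, toReal_add, ha, hb, Matrix.mulVec_add]⟩
  neg_mem' := by
    rintro r ⟨a, ha⟩
    exact ⟨-a, by rw [toReal_neg, toReal_neg, ha, Matrix.mulVec_neg]⟩

/-- The group `D_F = ℤⁿ / 2Fℤⁿ`. -/
abbrev D (F : HalfIntegral n) : Type := (Fin n → ℤ) ⧸ F.lattice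

/-- The matrix `2F` is integral. -/
theorem exists_int_matrix (F : HalfIntegral n) :
    ∃ G : Matrix (Fin n) (Fin n) ℤ, G.map (fun m : ℤ => (m : ℝ)) = 2 • F.mat := by
  choose g hg using F.two_mul_int
  exact ⟨Matrix.of g, by ext i j; simp [← hg]⟩

theorem isUnit_det (F : HalfIntegral n) : IsUnit F.mat.det :=
  isUnit_iff_ne_zero.mpr F.posDef.det_pos.ne'

instance finite_D (F : HalfIntegral n) : Finite F.D := by
  have hfg : Module.Finite ℤ F.D :=
    Module.Finite.of_surjective (QuotientAddGroup.mk' F.lattice).toIntLinearMap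
      (QuotientAddGroup.mk'_surjective _)
  obtain ⟨G, hG⟩ := F.exists_int_matrix
  have hdet : G.det ≠ 0 := by
    intro h
    have h1 : ((G.det : ℤ) : ℝ) = (2 • F.mat).det := by
      rw [← hG]; exact RingHom.map_det (Int.castRingHom ℝ) G
    rw [h, ← Nat.cast_smul_eq_nsmul ℝ, Matrix.det_smul] at h1
    have := F.posDef.det_pos
    have h2 : (0 : ℝ) < ((2 : ℕ) : ℝ) ^ Fintype.card (Fin n) * F.mat.det := by positivity
    exact absurd h1 (by simpa using h2.ne)
  refine Module.finite_of_fg_torsion F.D ?_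
  intro x
  induction x using QuotientAddGroup.induction_on with
  | H r =>
    refine ⟨⟨G.det, mem_nonZeroDivisors_of_ne_zero hdet⟩, ?_⟩
    change G.det • (QuotientAddGroup.mk r : F.D) = 0
    rw [← QuotientAddGroup.mk_zsmul, QuotientAddGroup.eq_zero_iff]
    refine ⟨G.adjugate *ᵥ r, ?_⟩
    have h1 : G *ᵥ (G.adjugate *ᵥ r) = G.det • r := by
      rw [Matrix.mulVec_mulVec, Matrix.mul_adjugate, Matrix.smul_mulVec, Matrix.one_mulVec]
    rw [← h1, ← hG]
    funext i
    simp [toReal, Matrix.mulVec, dotProduct]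

instance fintype_D (F : HalfIntegral n) : Fintype F.D := Fintype.ofFinite _

/-- `F⁻¹[r] = rᵗ F⁻¹ r` for an integral vector `r`. -/
def invForm (F : HalfIntegral n) (r : Fin n → ℤ) : ℝ :=
  toReal r ⬝ᵥ (F.mat⁻¹ *ᵥ toReal r)

/-- `F[m]` is an integer for every integral vector `m`. -/
theorem exists_int_form (F : HalfIntegral n) (m : Fin n → ℤ) :
    ∃ k : ℤ, toReal m ⬝ᵥ (F.mat *ᵥ toReal m) = k := by
  choose g hg using F.two_mul_int
  have hsymm : ∀ i j, g i j = g j i := fun i j => by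
    have h := F.symm.apply i j
    exact_mod_cast (by rw [← hg, ← hg, h] : (g i j : ℝ) = g j i)
  have hdiag : ∀ i, Even (g i i) := fun i => by
    obtain ⟨k, hk, hk'⟩ := F.two_mul_diag i
    rw [hg] at hk'
    rwa [show g i i = k by exact_mod_cast hk']
  have heven : Even (∑ p : Fin n × Fin n, g p.1 p.2 * (m p.1 * m p.2)) := by
    rw [even_iff_two_dvd, ← Nat.cast_two, ← ZMod.intCast_zmod_eq_zero_iff_dvd, Int.cast_sum]
    refine Finset.sum_involution (fun p _ => p.swap) ?_ ?_ (by simp) (by simp)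
    · intro p _
      simp only [Prod.fst_swap, Prod.snd_swap]
      rw [hsymm p.2 p.1, mul_comm (m p.2), CharTwo.add_self_eq_zero]
    · intro p _ hne heq
      apply hne
      have h12 : p.2 = p.1 := congrArg Prod.fst heq
      rw [ZMod.intCast_zmod_eq_zero_iff_dvd, h12]
      exact Dvd.dvd.mul_right (even_iff_two_dvd.mp (hdiag p.1)) _
  obtain ⟨k, hk⟩ := heven
  refine ⟨k, ?_⟩
  have h2 : 2 * (toReal m ⬝ᵥ (F.mat *ᵥ toReal m)) =
      ((∑ p : Fin n × Fin n, g p.1 p.2 * (m p.1 * m p.2) : ℤ) : ℝ) := by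
    rw [Fintype.sum_prod_type]
    push_cast
    simp only [dotProduct, Matrix.mulVec, Finset.mul_sum, toReal]
    refine Finset.sum_congr rfl fun i _ => Finset.sum_congr rfl fun j _ => ?_
    rw [← hg]; ring
  rw [hk] at h2
  push_cast at h2
  linarith

theorem invForm_add_mem (F : HalfIntegral n) (r s : Fin n → ℤ) (hs : s ∈ F.lattice) :
    ∃ k : ℤ, 1 / 4 * F.invForm (r + s) = 1 / 4 * F.invForm r + k := by
  obtain ⟨m, hm⟩ := hs
  obtain ⟨k, hk⟩ := F.exists_int_form m
  have hinv : F.mat⁻¹ *ᵥ toReal s = (2 : ℝ) • toReal m := by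
    rw [hm, ← Nat.cast_smul_eq_nsmul ℝ, Matrix.smul_mulVec, Matrix.mulVec_smul,
      Matrix.mulVec_mulVec, Matrix.nonsing_inv_mul _ F.isUnit_det, Matrix.one_mulVec]
    simp
  have hsymm : toReal s ⬝ᵥ (F.mat⁻¹ *ᵥ toReal r) = toReal r ⬝ᵥ (F.mat⁻¹ *ᵥ toReal s) := by
    rw [Matrix.dotProduct_mulVec, ← Matrix.mulVec_transpose, Matrix.transpose_nonsing_inv,
      F.symm, dotProduct_comm]
  have hss : toReal s ⬝ᵥ toReal m = 2 * k := by
    rw [hm, ← hk, dotProduct_comm, ← Nat.cast_smul_eq_nsmul ℝ, Matrix.smul_mulVec,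
      dotProduct_smul]
    simp
  have hrm : toReal r ⬝ᵥ toReal m = ((r ⬝ᵥ m : ℤ) : ℝ) := by
    simp [toReal, dotProduct]
  refine ⟨r ⬝ᵥ m + k, ?_⟩
  simp only [invForm, toReal_add, Matrix.mulVec_add, add_dotProduct, dotProduct_add, hsymm]
  rw [hinv, dotProduct_smul, dotProduct_smul, hss, hrm]
  push_cast
  simp only [smul_eq_mul]
  ring

/-- The quadratic form of `D_F`, induced by `x ↦ ¼ F⁻¹[x]`, with values in `ℚ/ℤ ⊆ ℝ/ℤ`. -/
def Q (F : HalfIntegral n) (x : F.D) : UnitAddCircle :=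
  Quotient.liftOn' x (fun r => ((1 / 4 * F.invForm r : ℝ) : UnitAddCircle)) (by
    intro a b hab
    rw [QuotientAddGroup.leftRel_apply] at hab
    obtain ⟨k, hk⟩ := F.invForm_add_mem a (-a + b) hab
    rw [add_neg_cancel_left] at hk
    change ((1 / 4 * F.invForm a : ℝ) : UnitAddCircle) = ((1 / 4 * F.invForm b : ℝ) : UnitAddCircle)
    rw [hk, AddCircle.coe_add]
    have h0 : ((k : ℝ) : UnitAddCircle) = 0 :=
      (AddCircle.coe_eq_zero_iff (1 : ℝ)).mpr ⟨k, by simp⟩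
    rw [h0, add_zero])

/-- The bilinear form `B(x,y) = Q(x+y) - Q(x) - Q(y)` of `D_F`. -/
def B (F : HalfIntegral n) (x y : F.D) : UnitAddCircle := F.Q (x + y) - F.Q x - F.Q y

/-- `F` as a complex matrix. -/
def cmat (F : HalfIntegral n) : Matrix (Fin n) (Fin n) ℂ := F.mat.map (fun t : ℝ => (t : ℂ))

end HalfIntegral

/-- `x ↦ e(x) = exp(2πix)` on `ℝ/ℤ`. -/
def eCircle (x : UnitAddCircle) : ℂ := (AddCircle.toCircle x : ℂ)

/-! ### The Weil representation -/

/-- `σ = |D_F|^{-1/2} ∑_x e(-Q(x))`. -/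
def gaussSigma (F : HalfIntegral n) : ℂ :=
  ((Real.sqrt (Fintype.card F.D) : ℝ) : ℂ)⁻¹ * ∑ x : F.D, eCircle (-F.Q x)

/-- A representation of `Mp` on `ℂ[D_F]` under which `(T, w_T)` and `(S, w_S)` act by the formulas
that define the Weil representation:
`(T, w_T) 𝐞ₓ = e(Q(x)) 𝐞ₓ` and `(S, w_S) 𝐞ₓ = σ |D_F|^{-1/2} ∑_y 𝐞_y e(-B(y,x))`. -/
def IsWeilAction (F : HalfIntegral n) (W : Representation ℂ Mp (F.D →₀ ℂ)) : Prop :=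
  (∀ x : F.D, W Mp.T (Finsupp.single x 1) = eCircle (F.Q x) • Finsupp.single x 1) ∧
  (∀ x : F.D, W Mp.S (Finsupp.single x 1) =
    (gaussSigma F * ((Real.sqrt (Fintype.card F.D) : ℝ) : ℂ)⁻¹) •
      ∑ y : F.D, eCircle (-F.B y x) • Finsupp.single y 1)

/-- The Weil representation `W(F)`: the extension to `Mp` of the above action of `(T, w_T)` and
`(S, w_S)` on `ℂ[D_F]`. -/
def weilRep (F : HalfIntegral n) : Representation ℂ Mp (F.D →₀ ℂ) :=
  Classical.epsilon (IsWeilAction F)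

/-! ### Jacobi forms -/

section JacobiForms

variable {V : Type*} [NormedAddCommGroup V] [NormedSpace ℂ V]
variable {V' : Type*} [NormedAddCommGroup V'] [NormedSpace ℂ V']

/-- The operator `φ ↦ φ|_{k,F}(A,w)`, with the weight given through the integer `κ = 2k`. -/
def slash (F : HalfIntegral n) (κ : ℤ) (φ : ℍ → (Fin n → ℂ) → V) (α : Mp) :
    ℍ → (Fin n → ℂ) → V := fun τ z =>
  (α.w τ ^ (-κ) *
    e (-(α.mat 1 0 : ℂ) * (z ⬝ᵥ (F.cmat *ᵥ z)) / autFactor α.mat τ)) •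
    φ (α.mat • τ) (fun i => z i / autFactor α.mat τ)

/-- The operator `φ ↦ φ|_{k,F}[l,m]` (it does not depend on the weight). -/
def heisSlash (F : HalfIntegral n) (φ : ℍ → (Fin n → ℂ) → V) (l m : Fin n → ℤ) :
    ℍ → (Fin n → ℂ) → V := fun τ z =>
  e ((τ : ℂ) * ((fun i => (l i : ℂ)) ⬝ᵥ (F.cmat *ᵥ fun i => (l i : ℂ)))
      + 2 * (z ⬝ᵥ (F.cmat *ᵥ fun i => (l i : ℂ)))) •
    φ τ (fun i => z i + (l i : ℂ) * (τ : ℂ) + (m i : ℂ))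

/-- Holomorphic functions `ℍ × ℂⁿ → V`. -/
def IsHolomorphic (φ : ℍ → (Fin n → ℂ) → V) : Prop :=
  DifferentiableOn ℂ (fun p : ℂ × (Fin n → ℂ) => φ (UpperHalfPlane.ofComplex p.1) p.2)
    {p | 0 < p.1.im}

/-- `ψ` has a Fourier expansion `∑ c(l,r) q^l e(zᵗr)`, where `l ∈ ℚ`, `r ∈ ℤⁿ` and
`4l - F⁻¹[r] ≥ 0`. -/
def HasJacobiExpansion (F : HalfIntegral n) (ψ : ℍ → (Fin n → ℂ) → V) : Prop :=
  ∃ c : ℚ → (Fin n → ℤ) → V,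
    (∀ l r, c l r ≠ 0 → 0 ≤ 4 * (l : ℝ) - F.invForm r) ∧
    ∀ (τ : ℍ) (z : Fin n → ℂ),
      HasSum (fun p : ℚ × (Fin n → ℤ) =>
        (e ((p.1 : ℂ) * (τ : ℂ)) * e (z ⬝ᵥ fun i => (p.2 i : ℂ))) • c p.1 p.2) (ψ τ z)

variable {Γ : Subgroup Mp}

/-- `φ` is a Jacobi form of weight `k = κ/2` and index `F` with typus `(Γ, V)`. An element of the
Jacobi group of `Γ` is uniquely of the form `α[l,m]`, with `α ∈ Γ` and `l, m ∈ ℤⁿ`, and acts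
on `V` through `α`. -/
structure IsJacobiForm (F : HalfIntegral n) (κ : ℤ) (ρ : Representation ℂ Γ V)
    (φ : ℍ → (Fin n → ℂ) → V) : Prop where
  holo : IsHolomorphic φ
  transform : ∀ (α : Γ) (l m : Fin n → ℤ) (τ : ℍ) (z : Fin n → ℂ),
    heisSlash F (slash F κ φ (α : Mp)) l m τ z = ρ α (φ τ z)
  expansion : ∀ α : Mp, HasJacobiExpansion F (slash F κ φ α)

theorem slash_add (F : HalfIntegral n) (κ : ℤ) (φ ψ : ℍ → (Fin n → ℂ) → V) (α : Mp) :
    slash F κ (φ + ψ) α = slash F κ φ α + slash F κ ψ α := by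
  funext τ z; simp [slash]

theorem slash_map (F : HalfIntegral n) (κ : ℤ) (f : V →ₗ[ℂ] V') (φ : ℍ → (Fin n → ℂ) → V)
    (α : Mp) :
    slash F κ (fun τ z => f (φ τ z)) α = fun τ z => f (slash F κ φ α τ z) := by
  funext τ z; simp [slash]

theorem heisSlash_add (F : HalfIntegral n) (φ ψ : ℍ → (Fin n → ℂ) → V) (l m : Fin n → ℤ) :
    heisSlash F (φ + ψ) l m = heisSlash F φ l m + heisSlash F ψ l m := by
  funext τ z; simp [heisSlash]

theorem heisSlash_map (F : HalfIntegral n) (f : V →ₗ[ℂ] V') (φ : ℍ → (Fin n → ℂ) → V)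
    (l m : Fin n → ℤ) :
    heisSlash F (fun τ z => f (φ τ z)) l m = fun τ z => f (heisSlash F φ l m τ z) := by
  funext τ z; simp [heisSlash]

theorem IsJacobiForm.map {F : HalfIntegral n} {κ : ℤ} {ρ : Representation ℂ Γ V}
    {ρ' : Representation ℂ Γ V'} [FiniteDimensional ℂ V] (f : V →ₗ[ℂ] V')
    (hf : ∀ g v, f (ρ g v) = ρ' g (f v))
    {φ : ℍ → (Fin n → ℂ) → V} (h : IsJacobiForm F κ ρ φ) :
    IsJacobiForm F κ ρ' (fun τ z => f (φ τ z)) where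
  holo := (LinearMap.toContinuousLinearMap f).differentiable.comp_differentiableOn h.holo
  transform α l m τ z := by
    rw [slash_map, heisSlash_map, ← hf, ← h.transform]
  expansion α := by
    obtain ⟨c, hc, hs⟩ := h.expansion α
    refine ⟨fun l r => f (c l r), fun l r hne => hc l r fun h0 => hne (by simp [h0]), ?_⟩
    intro τ z
    rw [slash_map]
    simpa [Function.comp_def] using (LinearMap.toContinuousLinearMap f).hasSum (hs τ z)

/-- The space `J_{k,F}(Γ,V)` of Jacobi forms of weight `k = κ/2`. -/
def J (F : HalfIntegral n) (κ : ℤ) [FiniteDimensional ℂ V] (ρ : Representation ℂ Γ V) :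
    Submodule ℂ (ℍ → (Fin n → ℂ) → V) where
  carrier := {φ | IsJacobiForm F κ ρ φ}
  zero_mem' :=
    { holo := differentiableOn_const 0
      transform := fun α l m τ z => by simp [heisSlash, slash]
      expansion := fun α => ⟨0, by simp, fun τ z => by simp [slash]⟩ }
  add_mem' {φ ψ} hφ hψ :=
    { holo := DifferentiableOn.add hφ.holo hψ.holo
      transform := fun α l m τ z => by
        rw [slash_add, heisSlash_add]
        simp [hφ.transform, hψ.transform]
      expansion := fun α => by
        obtain ⟨c, hc, hcs⟩ := hφ.expansion α
        obtain ⟨d, hd, hds⟩ := hψ.expansion α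
        refine ⟨c + d, fun l r hne => ?_, fun τ z => ?_⟩
        · by_cases h : c l r = 0
          · exact hd l r fun h' => hne (by simp [h, h'])
          · exact hc l r h
        · rw [slash_add]
          simpa [smul_add] using (hcs τ z).add (hds τ z) }
  smul_mem' a φ hφ := show IsJacobiForm F κ ρ (a • φ) from
    IsJacobiForm.map (ρ' := ρ) (a • LinearMap.id) (by simp) hφ

/-- The map `J_{k,F}(Γ,V) → J_{k,F}(Γ,V')`, `φ ↦ f ∘ φ`, of a `Γ`-homomorphism `f : V → V'`. -/
def J.map (F : HalfIntegral n) (κ : ℤ) [FiniteDimensional ℂ V] [FiniteDimensional ℂ V']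
    {ρ : Representation ℂ Γ V} {ρ' : Representation ℂ Γ V'}
    (f : Representation.IntertwiningMap ρ ρ') (φ : J F κ ρ) : J F κ ρ' :=
  ⟨fun τ z => f (φ.1 τ z),
    IsJacobiForm.map f.toLinearMap
      (fun g v => LinearMap.congr_fun (f.isIntertwining' g) v) φ.2⟩

/-- The induced `Mp`-module `Ind_Γ^Mp V`. In Mathlib's model the class
`Representation.IndV.mk Γ.subtype ρ g⁻¹ v` is the element `g ⊗ v` of `ℂ[Mp] ⊗_{ℂ[Γ]} V`. -/
abbrev Ind (ρ : Representation ℂ Γ V) :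
    Representation ℂ Mp (Representation.IndV Γ.subtype ρ) :=
  Representation.ind Γ.subtype ρ

/-- The element `g ⊗ v` of `Ind_Γ^Mp V`. -/
abbrev indTmul (ρ : Representation ℂ Γ V) (g : Mp) (v : V) :
    Representation.IndV Γ.subtype ρ :=
  Representation.IndV.mk Γ.subtype ρ g⁻¹ v

theorem Ind_indTmul (ρ : Representation ℂ Γ V) (h g : Mp) (v : V) :
    Ind ρ h (indTmul ρ g v) = indTmul ρ (h * g) v := by
  rw [Ind, indTmul, Representation.ind_mk, indTmul, mul_inv_rev]

theorem indTmul_mul (ρ : Representation ℂ Γ V) (g : Mp) (γ : Γ) (v : V) :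
    indTmul ρ (g * γ) v = indTmul ρ g (ρ γ v) := by
  rw [indTmul, indTmul, mul_inv_rev]
  have h := Representation.Coinvariants.mk_inv_tmul
    ((Representation.leftRegular ℂ Mp).comp Γ.subtype) ρ (.single g⁻¹ 1) v γ
  simpa using h

/-- The map `Ind_Γ^Mp V → Ind_Γ^Mp V'`, `g ⊗ v ↦ g ⊗ f(v)`, of a `Γ`-homomorphism `f`. -/
def indMap {ρ : Representation ℂ Γ V} {ρ' : Representation ℂ Γ V'}
    (f : Representation.IntertwiningMap ρ ρ') :
    Representation.IndV Γ.subtype ρ →ₗ[ℂ] Representation.IndV Γ.subtype ρ' :=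
  Representation.Coinvariants.map _ _ ⟨f.toLinearMap.lTensor _, by
    simp [LinearMap.lTensor_comp_map, f.2, LinearMap.map_comp_lTensor]⟩

theorem indMap_indTmul {ρ : Representation ℂ Γ V} {ρ' : Representation ℂ Γ V'}
    (f : Representation.IntertwiningMap ρ ρ') (g : Mp) (v : V) :
    indMap f (indTmul ρ g v) = indTmul ρ' g (f v) := by
  simp [indMap, indTmul]

/-- The function `∑_{gΓ ∈ Mp/Γ} g ⊗ φ|_{k,F} g⁻¹` with values in `Ind_Γ^Mp V`. -/
def inducedForm (F : HalfIntegral n) (κ : ℤ) (ρ : Representation ℂ Γ V)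
    (φ : ℍ → (Fin n → ℂ) → V) (τ : ℍ) (z : Fin n → ℂ) : Representation.IndV Γ.subtype ρ :=
  ∑ᶠ q : Mp ⧸ Γ, indTmul ρ q.out (slash F κ φ (q.out)⁻¹ τ z)

end JacobiForms

/-- The theta series `ϑ_{F,x}(τ,z) = ∑_{r ≡ x mod 2Fℤⁿ} e(τ ¼F⁻¹[r] + rᵗz)`. -/
def theta (F : HalfIntegral n) (x : F.D) (τ : ℍ) (z : Fin n → ℂ) : ℂ :=
  ∑' r : {r : Fin n → ℤ // (QuotientAddGroup.mk r : F.D) = x},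
    e ((τ : ℂ) * ((1 / 4 * F.invForm r.1 : ℝ) : ℂ) + (fun i => (r.1 i : ℂ)) ⬝ᵥ z)

end CriticalJacobi

end

open CriticalJacobi

universe u

/-!
The theta series `ϑ_{F,x}`, `x ∈ D_F`, carry the Weil representation, and every Jacobi form of the
critical weight `n/2` is a combination of them with constant coefficients; the rest is Frobenius
reciprocity.

*The Weil representation.* The series `ϑ_{F,x}(τ,·)` have disjoint sets of Fourier exponents, so
they are linearly independent for each fixed `τ` (`theta_linearIndependent`). The generator `T`
multiplies `ϑ_{F,x}` by `e(Q(x))`, and Poisson summation expresses `ϑ_{F,x}|S` through the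
`ϑ_{F,y}`, up to a constant (`exists_slash_S_theta`). The constant is found without evaluating a
Gauss sum beforehand: the relation `TSTST = S` in `Mp` (`Mp.T_S_T_S_T`) determines it.
Since `T` and `S` generate `Mp` (`Mp.closure_T_S`), every `α ∈ Mp` acts on the span of the theta
series by a unique matrix, which is unitary. The resulting homomorphism `weilMatrix` is the Weil
representation.

*Constancy of the coefficients.* A function with a Fourier expansion that is invariant under the
Heisenberg group has a decomposition `∑ₓ ϑ_{F,x}(τ,z) hₓ(τ)`, and the condition `4l - F⁻¹[r] ≥ 0`
says that the `hₓ` are bounded at the cusp (`HasJacobiExpansion.exists_theta_decomposition`). For a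
Jacobi form `φ` of weight `n/2` the theta series absorb the whole weight, so the coefficients of
the functions `φ|g` have weight zero. Because `Γ` has finite index and acts through a finite group,
only finitely many functions occur, and they form a vector-valued modular form of weight
zero with respect to a unitary representation of `Mp`. Its norm is `SL(2,ℤ)`-invariant, hence
attains all its values on `Im τ ≥ 1/2`, and the maximum principle makes the form constant
(`eq_const_of_norm_invariant`, `exists_slash_eq_sum_theta`).

*The isomorphism.* It follows that `J_{n/2,F}(Γ,V)` is the space of `Γ`-homomorphisms `W(F) → V`
(`isJacobiForm_sum_theta`, `IsJacobiForm.exists_hom`), which Frobenius reciprocity identifies with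
the `Mp`-homomorphisms `W(F) → Ind V` (`exists_intertwiningMap`). The explicit formula for `Φ_V`
expresses that `u = ∑ g ⊗ (g⁻¹u)(1)` for `u ∈ Ind V` (`sum_indTmul_indEval`), and naturality is a
consequence of the formula and of the independence of the theta series.
-/

open scoped UpperHalfPlane Matrix MatrixGroups Manifold

noncomputable section

namespace CriticalJacobi

/-! ### The exponential function and the quadratic form -/

theorem e_add (x y : ℂ) : e (x + y) = e x * e y := by
  rw [e, e, e, ← Complex.exp_add]; ring_nf

@[simp] theorem e_zero : e 0 = 1 := by simp [e]

theorem e_ne_zero (x : ℂ) : e x ≠ 0 := Complex.exp_ne_zero _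

@[simp] theorem e_intCast (k : ℤ) : e k = 1 := by
  rw [e, Complex.exp_eq_one_iff]; exact ⟨k, by ring⟩

theorem norm_e (x : ℂ) : ‖e x‖ = Real.exp (-(2 * Real.pi * x.im)) := by
  rw [e, Complex.norm_exp]
  congr 1
  simp [Complex.mul_re, Complex.mul_im]

theorem e_eq_of_sub_int {x y : ℂ} {k : ℤ} (h : x = y + k) : e x = e y := by
  rw [h, e_add, e_intCast, mul_one]

theorem e_eq_one_iff {x : ℝ} : e x = 1 ↔ ∃ k : ℤ, x = k := by
  rw [e, Complex.exp_eq_one_iff]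
  refine exists_congr fun k => ?_
  have h : (2 * Real.pi * Complex.I : ℂ) ≠ 0 := Complex.two_pi_I_ne_zero
  rw [mul_comm (k : ℂ), mul_right_inj' h]
  norm_cast

theorem e_sum {ι : Type*} (s : Finset ι) (f : ι → ℂ) : e (∑ i ∈ s, f i) = ∏ i ∈ s, e (f i) := by
  simp only [e, Finset.mul_sum, Complex.exp_sum]

theorem eCircle_coe (t : ℝ) : eCircle (t : UnitAddCircle) = e t := by
  rw [eCircle, AddCircle.toCircle_apply_mk, Circle.coe_exp, e]
  congr 1; push_cast; ring

theorem eCircle_add (x y : UnitAddCircle) : eCircle (x + y) = eCircle x * eCircle y := by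
  simp [eCircle, AddCircle.toCircle_add]

@[simp] theorem eCircle_zero : eCircle 0 = 1 := by simp [eCircle]

theorem eCircle_neg (x : UnitAddCircle) : eCircle (-x) = (eCircle x)⁻¹ := by
  simp [eCircle, AddCircle.toCircle_neg]

theorem norm_eCircle (x : UnitAddCircle) : ‖eCircle x‖ = 1 := Circle.norm_coe _

theorem star_eCircle (x : UnitAddCircle) : star (eCircle x) = eCircle (-x) := by
  rw [eCircle_neg, Complex.inv_eq_conj (norm_eCircle x)]; rfl

variable {n : ℕ}

theorem toReal_dotProduct (r s : Fin n → ℤ) : toReal r ⬝ᵥ toReal s = ((r ⬝ᵥ s : ℤ) : ℝ) := by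
  simp [toReal, dotProduct]

theorem toReal_injective : Function.Injective (toReal : (Fin n → ℤ) → Fin n → ℝ) :=
  fun r s h => funext fun i => by simpa [toReal] using congrFun h i

namespace HalfIntegral

variable (F : HalfIntegral n)

/-- The integral matrix `2F`. -/
def gram : Matrix (Fin n) (Fin n) ℤ := F.exists_int_matrix.choose

theorem gram_map : F.gram.map (fun m : ℤ => (m : ℝ)) = 2 • F.mat := F.exists_int_matrix.choose_spec

theorem toReal_gram_mulVec (m : Fin n → ℤ) :
    toReal (F.gram *ᵥ m) = (2 • F.mat) *ᵥ toReal m := by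
  rw [← gram_map]; funext i; simp [toReal, Matrix.mulVec, dotProduct]

theorem mem_lattice_iff {r : Fin n → ℤ} : r ∈ F.lattice ↔ ∃ m, r = F.gram *ᵥ m := by
  refine exists_congr fun m => ?_
  rw [← toReal_gram_mulVec, toReal_injective.eq_iff]

theorem inv_mulVec_gram (m : Fin n → ℤ) :
    F.mat⁻¹ *ᵥ toReal (F.gram *ᵥ m) = (2 : ℝ) • toReal m := by
  rw [toReal_gram_mulVec, ← Nat.cast_smul_eq_nsmul ℝ, Matrix.smul_mulVec, Matrix.mulVec_smul,
    Matrix.mulVec_mulVec, Matrix.nonsing_inv_mul _ F.isUnit_det, Matrix.one_mulVec]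
  simp

theorem gram_mulVec_injective : Function.Injective (fun m : Fin n → ℤ => F.gram *ᵥ m) := by
  intro a b h
  have h1 := congrArg (fun r => F.mat⁻¹ *ᵥ toReal r) h
  simp only [inv_mulVec_gram] at h1
  exact toReal_injective (smul_right_injective _ (two_ne_zero' ℝ) h1)

/-- The value `¼ F⁻¹[r]`, which represents `Q(r)` in `ℝ`. -/
def qf (r : Fin n → ℤ) : ℝ := 1 / 4 * F.invForm r

/-- The value `½ rᵗF⁻¹s`, which represents `B(r,s)` in `ℝ`. -/
def bil (r s : Fin n → ℤ) : ℝ := 1 / 2 * (toReal r ⬝ᵥ (F.mat⁻¹ *ᵥ toReal s))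

/-- The value `F[m]` at an integral vector. -/
def form (m : Fin n → ℤ) : ℝ := toReal m ⬝ᵥ (F.mat *ᵥ toReal m)

theorem inv_symm (u v : Fin n → ℝ) : u ⬝ᵥ (F.mat⁻¹ *ᵥ v) = v ⬝ᵥ (F.mat⁻¹ *ᵥ u) := by
  rw [Matrix.dotProduct_mulVec, ← Matrix.mulVec_transpose, Matrix.transpose_nonsing_inv,
      F.symm, dotProduct_comm]

theorem bil_symm (r s : Fin n → ℤ) : F.bil r s = F.bil s r := by
  rw [bil, bil, inv_symm]

theorem qf_add (r s : Fin n → ℤ) : F.qf (r + s) = F.qf r + F.qf s + F.bil r s := by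
  simp only [qf, bil, invForm, toReal_add, Matrix.mulVec_add, add_dotProduct, dotProduct_add,
    F.inv_symm (toReal s) (toReal r)]
  ring

theorem bil_gram (r m : Fin n → ℤ) : F.bil r (F.gram *ᵥ m) = ((r ⬝ᵥ m : ℤ) : ℝ) := by
  rw [bil, inv_mulVec_gram, dotProduct_smul, toReal_dotProduct, smul_eq_mul]; ring

theorem qf_gram (m : Fin n → ℤ) : F.qf (F.gram *ᵥ m) = F.form m := by
  rw [qf, invForm, inv_mulVec_gram, dotProduct_smul, toReal_gram_mulVec, dotProduct_comm,
    ← Nat.cast_smul_eq_nsmul ℝ, Matrix.smul_mulVec, dotProduct_smul, form]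
  simp only [smul_eq_mul]; push_cast; ring

theorem qf_add_gram (r m : Fin n → ℤ) :
    F.qf (r + F.gram *ᵥ m) = F.qf r + ((r ⬝ᵥ m : ℤ) : ℝ) + F.form m := by
  rw [qf_add, bil_gram, qf_gram]; ring

theorem Q_mk (r : Fin n → ℤ) : F.Q (QuotientAddGroup.mk r) = (F.qf r : UnitAddCircle) := rfl

theorem B_mk (r s : Fin n → ℤ) :
    F.B (QuotientAddGroup.mk r) (QuotientAddGroup.mk s) = (F.bil r s : UnitAddCircle) := by
  rw [B, ← QuotientAddGroup.mk_add, Q_mk, Q_mk, Q_mk, qf_add]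
  rw [AddCircle.coe_add, AddCircle.coe_add]
  abel

theorem eCircle_Q_mk (r : Fin n → ℤ) : eCircle (F.Q (QuotientAddGroup.mk r)) = e (F.qf r) := by
  rw [Q_mk, eCircle_coe]

theorem eCircle_B_mk (r s : Fin n → ℤ) :
    eCircle (F.B (QuotientAddGroup.mk r) (QuotientAddGroup.mk s)) = e (F.bil r s) := by
  rw [B_mk, eCircle_coe]

open scoped MatrixOrder in
/-- `F` is a Gram matrix over `ℝ`. -/
theorem exists_root : ∃ P : Matrix (Fin n) (Fin n) ℝ, IsUnit P.det ∧ F.mat = Pᵀ * P := by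
  have h0 : 0 ≤ F.mat := Matrix.nonneg_iff_posSemidef.mpr F.posDef.posSemidef
  obtain ⟨P, hP⟩ := CStarAlgebra.nonneg_iff_eq_star_mul_self.mp h0
  have hP' : F.mat = Pᵀ * P := by
    rw [hP, Matrix.star_eq_conjTranspose, Matrix.conjTranspose_eq_transpose_of_trivial]
  refine ⟨P, ?_, hP'⟩
  have h1 := F.isUnit_det
  rw [hP', Matrix.det_mul, Matrix.det_transpose] at h1
  exact isUnit_of_mul_isUnit_left h1

/-- The form `¼F⁻¹` is bounded below by a multiple of the standard one. -/
theorem exists_le_qf : ∃ c > 0, ∀ r : Fin n → ℤ, c * ∑ i, (r i : ℝ) ^ 2 ≤ F.qf r := by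
  obtain ⟨P, hP, hF⟩ := F.exists_root
  set K : ℝ := ∑ i, ∑ j, (Pᵀ i j) ^ 2 with hK
  have hK0 : 0 ≤ K := Finset.sum_nonneg fun i _ => Finset.sum_nonneg fun j _ => sq_nonneg _
  refine ⟨(4 * (K + 1))⁻¹, by positivity, fun r => ?_⟩
  set w : Fin n → ℝ := Pᵀ⁻¹ *ᵥ toReal r with hw
  have hPt : IsUnit Pᵀ.det := by rwa [Matrix.det_transpose]
  have hr : toReal r = Pᵀ *ᵥ w := by
    rw [hw, Matrix.mulVec_mulVec, Matrix.mul_nonsing_inv _ hPt, Matrix.one_mulVec]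
  -- `F⁻¹[r]` is the squared length of `w = P⁻ᵗ r`.
  have hinv : F.invForm r = ∑ j, w j ^ 2 := by
    rw [invForm, hF, Matrix.mul_inv_rev, ← Matrix.mulVec_mulVec, ← hw, Matrix.dotProduct_mulVec,
      ← Matrix.mulVec_transpose, Matrix.transpose_nonsing_inv, ← hw]
    simp [dotProduct, sq]
  have h1 : ∑ i, (r i : ℝ) ^ 2 ≤ K * ∑ j, w j ^ 2 := by
    rw [hK, Finset.sum_mul]
    refine Finset.sum_le_sum fun i _ => ?_
    have : (r i : ℝ) = ∑ j, Pᵀ i j * w j := congrFun hr i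
    rw [this]
    exact Finset.sum_mul_sq_le_sq_mul_sq _ _ _
  have h2 : 0 ≤ ∑ j, w j ^ 2 := Finset.sum_nonneg fun j _ => sq_nonneg _
  rw [qf, hinv, inv_mul_le_iff₀ (by positivity)]
  nlinarith

/-- The values `¼F⁻¹[r]` have a common denominator. -/
theorem exists_denominator : ∃ N : ℕ, 0 < N ∧ ∀ r : Fin n → ℤ, ∃ k : ℤ, N * F.qf r = k := by
  have hdet : F.gram.det ≠ 0 := by
    intro h
    obtain ⟨v, hv, h0⟩ := Matrix.exists_mulVec_eq_zero_iff.mpr h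
    exact hv (F.gram_mulVec_injective (by simpa using h0))
  -- `r ∈ ℤⁿ` has `det(2F) r = 2F s` with the integral vector `s = adj(2F) r`.
  refine ⟨2 * F.gram.det.natAbs, by positivity, fun r => ?_⟩
  set s := F.gram.adjugate *ᵥ r with hs
  have h1 : F.gram *ᵥ s = F.gram.det • r := by
    rw [hs, Matrix.mulVec_mulVec, Matrix.mul_adjugate, Matrix.smul_mulVec, Matrix.one_mulVec]
  have h2 : (F.gram.det : ℝ) * F.bil r r = ((r ⬝ᵥ s : ℤ) : ℝ) := by
    rw [← bil_gram, h1]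
    have : toReal (F.gram.det • r) = (F.gram.det : ℝ) • toReal r := by
      funext i; simp [toReal]
    rw [bil, bil, this, Matrix.mulVec_smul, dotProduct_smul, smul_eq_mul]; ring
  have h3 : F.bil r r = 2 * F.qf r := by rw [bil, qf, invForm]; ring
  rw [h3] at h2
  rcases abs_choice F.gram.det with h | h
  · refine ⟨r ⬝ᵥ s, ?_⟩
    rw [← h2, Nat.cast_mul, Nat.cast_natAbs, h, Nat.cast_two]; ring
  · refine ⟨-(r ⬝ᵥ s), ?_⟩
    rw [Int.cast_neg, ← h2, Nat.cast_mul, Nat.cast_natAbs, h, Nat.cast_two, Int.cast_neg]; ring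

theorem qf_nonneg (r : Fin n → ℤ) : 0 ≤ F.qf r := by
  obtain ⟨c, hc, h⟩ := F.exists_le_qf
  exact le_trans (mul_nonneg hc.le (Finset.sum_nonneg fun i _ => sq_nonneg _)) (h r)

end HalfIntegral

/-! ### Gaussian sums over `ℤⁿ` -/

theorem summable_prod_pi {f : ℤ → ℝ} (h0 : ∀ k, 0 ≤ f k) (hf : Summable f) (n : ℕ) :
    Summable fun r : Fin n → ℤ => ∏ i, f (r i) := by
  induction n with
  | zero => exact (hasSum_fintype _).summable
  | succ n ih =>
    rw [← (Fin.consEquiv fun _ : Fin (n + 1) => ℤ).summable_iff]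
    have := hf.mul_of_nonneg ih h0 (fun r => Finset.prod_nonneg fun i _ => h0 _)
    refine this.congr fun p => ?_
    simp [Fin.consEquiv, Fin.prod_univ_succ]

/-- Linear exponential growth does not affect the convergence of a Gaussian sum. -/
theorem summable_gaussian {a : ℝ} (ha : 0 < a) (b : ℝ) (n : ℕ) :
    Summable fun r : Fin n → ℤ => Real.exp (-(a * ∑ i, (r i : ℝ) ^ 2) + b * ∑ i, |(r i : ℝ)|) := by
  -- The one-dimensional case is the bound for the terms of Jacobi's theta function.
  have h1 := summable_pow_mul_jacobiTheta₂_term_bound (b / (2 * Real.pi))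
    (T := a / Real.pi) (by positivity) 0
  refine (summable_prod_pi (fun k => by positivity) h1 n).congr fun r => ?_
  simp only [pow_zero, one_mul]
  rw [← Real.exp_sum]
  congr 1
  rw [Finset.mul_sum, Finset.mul_sum, ← Finset.sum_neg_distrib, ← Finset.sum_add_distrib]
  refine Finset.sum_congr rfl fun i _ => ?_
  push_cast
  field_simp
  ring

/-! ### Fourier series on `ℝⁿ/ℤⁿ` and Poisson summation -/

/-- An integral vector as a complex vector. -/
def toComplex (r : Fin n → ℤ) : Fin n → ℂ := fun i => (r i : ℂ)

/-- A real vector as a complex vector. -/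
def realToComplex (x : Fin n → ℝ) : Fin n → ℂ := fun i => (x i : ℂ)

/-- Mathlib's Fourier monomials on the torus, in terms of `e`. -/
theorem mFourier_coe (r : Fin n → ℤ) (x : Fin n → ℝ) :
    UnitAddTorus.mFourier r (fun i => (x i : UnitAddCircle)) =
      e (toComplex r ⬝ᵥ realToComplex x) := by
  rw [dotProduct, e_sum]
  simp only [UnitAddTorus.mFourier, ContinuousMap.coe_mk]
  refine Finset.prod_congr rfl fun i _ => ?_
  rw [fourier_coe_apply, e, toComplex, realToComplex]
  congr 1; push_cast; ring

/-- The coefficients of an absolutely convergent Fourier series are determined by its sum. -/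
theorem fourier_coeff_eq_zero {a : (Fin n → ℤ) → ℂ} (ha : Summable a)
    (h : ∀ x : Fin n → ℝ, HasSum (fun r => a r * e (toComplex r ⬝ᵥ realToComplex x)) 0)
    (r : Fin n → ℤ) : a r = 0 := by
  have h1 : Summable fun r => a r • UnitAddTorus.mFourier (d := Fin n) r := by
    refine Summable.of_norm ?_
    simpa only [norm_smul, UnitAddTorus.mFourier_norm, mul_one] using ha.norm
  have h2 : ∑' r, a r • UnitAddTorus.mFourier (d := Fin n) r = 0 := by
    ext t
    have ht : t = fun i => ((t i).out : UnitAddCircle) := by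
      funext i; exact (Quotient.out_eq (t i)).symm
    have h3 := (ContinuousMap.evalCLM ℂ t).hasSum h1.hasSum
    refine h3.unique ?_
    have h4 := h fun i => (t i).out
    simp only [← mFourier_coe, ← ht] at h4
    simpa [Function.comp_def] using h4
  have h5 := h1.hasSum
  rw [h2] at h5
  -- The normalised measure on the circle that the Fourier series on the torus refer to.
  let : MeasureTheory.MeasureSpace UnitAddCircle := ⟨AddCircle.haarAddCircle⟩
  have : MeasureTheory.IsProbabilityMeasure
      (MeasureTheory.volume : MeasureTheory.Measure UnitAddCircle) :=
    inferInstanceAs (MeasureTheory.IsProbabilityMeasure AddCircle.haarAddCircle)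
  have h6 : HasSum (fun s => a s • UnitAddTorus.mFourierLp (d := Fin n) 2 s) 0 := by
    have h := (ContinuousMap.toLp (E := ℂ) 2 (MeasureTheory.volume :
      MeasureTheory.Measure (UnitAddTorus (Fin n))) ℂ).hasSum h5
    simp only [map_smul, map_zero] at h
    exact h
  have h7 := h6.mapL (innerSL ℂ (UnitAddTorus.mFourierLp (d := Fin n) 2 r))
  have h8 : (fun s => innerSL ℂ (UnitAddTorus.mFourierLp (d := Fin n) 2 r)
      (a s • UnitAddTorus.mFourierLp (d := Fin n) 2 s)) = fun s => if s = r then a r else 0 := by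
    funext s
    have ho := orthonormal_iff_ite.mp (UnitAddTorus.orthonormal_mFourier (d := Fin n)) r s
    rw [map_smul, innerSL_apply_apply, ho]
    by_cases hs : s = r
    · simp [hs]
    · simp [hs, Ne.symm hs]
  rw [h8, map_zero] at h7
  exact (hasSum_ite_eq r (a r)).unique h7

/-- The half-open unit cube with lower corner `m`. -/
def unitCube (m : Fin n → ℤ) : Set (Fin n → ℝ) :=
  {x | ∀ i, x i ∈ Set.Ioc (m i : ℝ) (m i + 1)}

theorem measurableSet_unitCube (m : Fin n → ℤ) : MeasurableSet (unitCube m) :=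
  MeasurableSet.univ_pi' fun _ => measurableSet_Ioc

theorem volume_unitCube_lt_top : MeasureTheory.volume (unitCube (0 : Fin n → ℤ)) < ⊤ := by
  refine lt_of_le_of_lt (MeasureTheory.measure_mono ?_)
    (isCompact_univ_pi (fun _ : Fin n => isCompact_Icc (a := (0 : ℝ)) (b := 1))).measure_lt_top
  intro x hx i _
  have := hx i
  simp only [Pi.zero_apply, Int.cast_zero, zero_add] at this
  exact ⟨this.1.le, this.2⟩

open MeasureTheory in
/-- Unfolding an integral over `ℝⁿ` along `ℤⁿ`. -/
theorem integral_eq_tsum_unitCube {k : (Fin n → ℝ) → ℂ} (hk : Integrable k) :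
    ∫ x, k x = ∑' m : Fin n → ℤ, ∫ x in unitCube 0, k (x + toReal m) := by
  have hU : (⋃ m : Fin n → ℤ, unitCube m) = Set.univ := by
    refine Set.eq_univ_of_forall fun x => Set.mem_iUnion.mpr ⟨fun i => ⌈x i⌉ - 1, fun i => ?_⟩
    have h1 := Int.ceil_lt_add_one (x i)
    have h2 := Int.le_ceil (x i)
    push_cast
    constructor <;> linarith
  have hd : Pairwise (Function.onFun Disjoint (unitCube (n := n))) := by
    intro a b hab
    refine Set.disjoint_left.mpr fun x ha hb => hab (funext fun i => ?_)
    have h1 := ha i; have h2 := hb i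
    have h3 : (a i : ℝ) < b i + 1 := by linarith [h1.1, h2.2]
    have h4 : (b i : ℝ) < a i + 1 := by linarith [h2.1, h1.2]
    have h3' : a i < b i + 1 := by exact_mod_cast h3
    have h4' : b i < a i + 1 := by exact_mod_cast h4
    omega
  rw [← setIntegral_univ, ← hU, integral_iUnion measurableSet_unitCube hd hk.integrableOn]
  refine tsum_congr fun m => ?_
  have hp : (fun x => x + toReal m) ⁻¹' unitCube m = unitCube 0 := by
    ext x
    simp only [unitCube, Set.mem_preimage, Set.mem_ofPred_eq, Pi.add_apply, toReal, Pi.zero_apply,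
      Int.cast_zero, zero_add, Set.mem_Ioc]
    refine forall_congr' fun i => ?_
    constructor <;> rintro ⟨h1, h2⟩ <;> constructor <;> linarith
  rw [← hp]
  exact ((measurePreserving_add_right volume (toReal m)).setIntegral_preimage_emb
    (measurableEmbedding_addRight _) k (unitCube m)).symm

open MeasureTheory in
/-- Poisson summation on `ℝⁿ`, for a continuous integrable function `g`. The summable bound `u` for
the translates on a ball that contains the unit cube makes the periodization of `g` continuous. -/
theorem poisson_summation {g : (Fin n → ℝ) → ℂ} (hg : Continuous g) (hint : Integrable g)
    {u : (Fin n → ℤ) → ℝ} (hu : Summable u)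
    (hb : ∀ m x, ‖x‖ < 2 → ‖g (x + toReal m)‖ ≤ u m)
    (hs : Summable fun s : Fin n → ℤ =>
      ∫ x, e (toComplex (-s) ⬝ᵥ realToComplex x) * g x) :
    HasSum (fun s : Fin n → ℤ => ∫ x, e (toComplex (-s) ⬝ᵥ realToComplex x) * g x)
      (∑' m : Fin n → ℤ, g (toReal m)) := by
  set G : (Fin n → ℝ) → ℂ := fun x => ∑' m : Fin n → ℤ, g (x + toReal m) with hG
  have hper : ∀ x (l : Fin n → ℤ), G (x + toReal l) = G x := by
    intro x l
    rw [hG]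
    simp only [add_assoc, ← toReal_add]
    exact (Equiv.addLeft l).tsum_eq fun m => g (x + toReal m)
  have hcont0 : ContinuousOn G (Metric.ball 0 2) := by
    refine continuousOn_tsum (u := u) (fun m => ?_) hu fun m x hx => hb m x (by simpa using hx)
    exact (hg.comp (continuous_id.add continuous_const)).continuousOn
  have hcont : Continuous G := by
    refine continuous_iff_continuousAt.mpr fun x => ?_
    -- Translate `x` into the ball on which `G` is known to be continuous.
    set l : Fin n → ℤ := fun i => -⌊x i⌋ with hl
    have hx : x + toReal l ∈ Metric.ball (0 : Fin n → ℝ) 2 := by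
      rw [mem_ball_zero_iff, pi_norm_lt_iff two_pos]
      intro i
      have h1 := Int.floor_le (x i)
      have h2 := Int.lt_floor_add_one (x i)
      simp only [Pi.add_apply, toReal, hl, Real.norm_eq_abs, abs_lt]
      push_cast
      constructor <;> linarith
    have h1 : ContinuousAt G (x + toReal l) := hcont0.continuousAt (Metric.isOpen_ball.mem_nhds hx)
    have h2 : G = G ∘ fun y => y + toReal l := by
      funext y; exact (hper y l).symm
    rw [h2]
    exact ContinuousAt.comp h1 (continuous_id.add continuous_const).continuousAt
  -- `G` descends to the torus.
  set f : UnitAddTorus (Fin n) → ℂ := fun t => G fun i => (t i).out with hf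
  have hfG : ∀ x : Fin n → ℝ, f (fun i => (x i : UnitAddCircle)) = G x := by
    intro x
    have h1 : ∀ i, ∃ k : ℤ, ((x i : UnitAddCircle)).out = x i + k := by
      intro i
      have h2 : (((x i : UnitAddCircle)).out : UnitAddCircle) = (x i : UnitAddCircle) :=
        Quotient.out_eq _
      rw [← sub_eq_zero, ← AddCircle.coe_sub, AddCircle.coe_eq_zero_iff] at h2
      obtain ⟨k, hk⟩ := h2
      refine ⟨k, ?_⟩
      simp only [zsmul_eq_mul, mul_one] at hk
      linarith
    choose l hl using h1
    rw [hf, ← hper x l]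
    simp only
    congr 1
    funext i
    simp [hl, toReal]
  have hfc : Continuous f := by
    have hq : IsOpenQuotientMap (Pi.map fun (_ : Fin n) (y : ℝ) => (y : UnitAddCircle)) :=
      IsOpenQuotientMap.piMap fun _ => QuotientAddGroup.isOpenQuotientMap_mk
    rw [hq.isQuotientMap.continuous_iff]
    have : (f ∘ Pi.map fun (_ : Fin n) (y : ℝ) => (y : UnitAddCircle)) = G := by
      funext x; exact hfG x
    rwa [this]
  have hcoeff : ∀ s, UnitAddTorus.mFourierCoeff f s =
      ∫ x, e (toComplex (-s) ⬝ᵥ realToComplex x) * g x := by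
    intro s
    have hec : Continuous fun x : Fin n → ℝ => e (toComplex (-s) ⬝ᵥ realToComplex x) := by
      unfold e dotProduct realToComplex; fun_prop
    have hnorm : ∀ x : Fin n → ℝ, ‖e (toComplex (-s) ⬝ᵥ realToComplex x)‖ = 1 := by
      intro x
      have : toComplex (-s) ⬝ᵥ realToComplex x = ((toReal (-s) ⬝ᵥ x : ℝ) : ℂ) := by
        simp [toComplex, realToComplex, toReal, dotProduct]
      rw [this, norm_e]; simp
    have hkint : Integrable fun x => e (toComplex (-s) ⬝ᵥ realToComplex x) * g x := by
      refine (integrable_norm_iff (hec.mul hg).aestronglyMeasurable).mp ?_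
      simpa [hnorm] using hint.norm
    have hshift : ∀ (x : Fin n → ℝ) (m : Fin n → ℤ),
        e (toComplex (-s) ⬝ᵥ realToComplex (x + toReal m)) =
          e (toComplex (-s) ⬝ᵥ realToComplex x) := by
      intro x m
      refine e_eq_of_sub_int (k := (-s) ⬝ᵥ m) ?_
      simp only [toComplex, realToComplex, toReal, dotProduct, Pi.add_apply, Complex.ofReal_add,
        mul_add, Finset.sum_add_distrib]
      push_cast; rfl
    have hcube : {x : Fin n → ℝ | ∀ i, x i ∈ Set.Ioc ((0 : Fin n → ℝ) i)
        ((0 : Fin n → ℝ) i + 1)} = unitCube 0 := by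
      simp [unitCube]
    have hcube2 : ∀ x ∈ unitCube (0 : Fin n → ℤ), ‖x‖ < 2 := by
      intro x hx
      rw [pi_norm_lt_iff two_pos]
      intro i
      have := hx i
      simp only [Pi.zero_apply, Int.cast_zero, zero_add] at this
      rw [Real.norm_eq_abs, abs_lt]
      constructor <;> linarith [this.1, this.2]
    rw [UnitAddTorus.mFourierCoeff_eq_integral f s 0, hcube, integral_eq_tsum_unitCube hkint]
    have hFint : ∀ m : Fin n → ℤ, Integrable (fun x : Fin n → ℝ =>
        e (toComplex (-s) ⬝ᵥ realToComplex (x + toReal m)) * g (x + toReal m))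
        (volume.restrict (unitCube 0)) := fun m =>
      (hkint.comp_add_right (toReal m)).integrableOn
    rw [integral_tsum_of_summable_integral_norm hFint]
    · refine setIntegral_congr_fun (measurableSet_unitCube 0) fun x _ => ?_
      simp only [hfG, mFourier_coe, smul_eq_mul, hshift, tsum_mul_left, hG]
    · refine Summable.of_nonneg_of_le (fun m => integral_nonneg fun x => norm_nonneg _)
        (fun m => ?_) (hu.mul_right (volume.real (unitCube (0 : Fin n → ℤ))))
      have h1 := norm_setIntegral_le_of_norm_le_const (μ := volume) (C := u m)
        (f := fun x : Fin n → ℝ =>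
          ‖e (toComplex (-s) ⬝ᵥ realToComplex (x + toReal m)) * g (x + toReal m)‖)
        (volume_unitCube_lt_top (n := n)) (fun x hx => by
          rw [norm_norm, norm_mul, hnorm, one_mul]; exact hb m x (hcube2 x hx))
      exact (Real.le_norm_self _).trans h1
  have hsum : Summable (UnitAddTorus.mFourierCoeff (⟨f, hfc⟩ : C(UnitAddTorus (Fin n), ℂ))) := by
    refine hs.congr fun s => (hcoeff s).symm
  have h := UnitAddTorus.hasSum_mFourier_series_apply_of_summable hsum
    (fun i => ((0 : ℝ) : UnitAddCircle))
  have h0 : f (fun i => ((0 : ℝ) : UnitAddCircle)) = ∑' m : Fin n → ℤ, g (toReal m) := by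
    have := hfG 0
    simp only [Pi.zero_apply] at this
    rw [this, hG]; simp
  have h' : HasSum (fun s : Fin n → ℤ => UnitAddTorus.mFourierCoeff f s •
      UnitAddTorus.mFourier s (fun i => ((0 : ℝ) : UnitAddCircle)))
      (f fun i => ((0 : ℝ) : UnitAddCircle)) := h
  rw [h0] at h'
  convert h' using 1
  funext s
  have h1 := mFourier_coe s (0 : Fin n → ℝ)
  have h2 : realToComplex (0 : Fin n → ℝ) = 0 := by funext i; simp [realToComplex]
  simp only [Pi.zero_apply, h2, dotProduct_zero, e_zero] at h1
  rw [h1, hcoeff, smul_eq_mul, mul_one]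

/-! ### The Gaussian integral -/

namespace HalfIntegral

/-- The quadratic form `F[z]` on `ℂⁿ`. -/
def cform (F : HalfIntegral n) (z : Fin n → ℂ) : ℂ := z ⬝ᵥ (F.cmat *ᵥ z)

theorem cform_eq_of_root {F : HalfIntegral n} {P : Matrix (Fin n) (Fin n) ℝ}
    (hP : F.mat = Pᵀ * P) (z : Fin n → ℂ) :
    F.cform z = ∑ i, ((P.map fun t : ℝ => (t : ℂ)) *ᵥ z) i ^ 2 := by
  have h : F.cmat = (P.map fun t : ℝ => (t : ℂ))ᵀ * (P.map fun t : ℝ => (t : ℂ)) := by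
    ext i j
    simp [cmat, hP, Matrix.mul_apply]
  rw [cform, h, ← Matrix.mulVec_mulVec, Matrix.dotProduct_mulVec, Matrix.vecMul_transpose]
  simp [dotProduct, sq]

end HalfIntegral

open MeasureTheory in
theorem integral_comp_mulVec {P : Matrix (Fin n) (Fin n) ℝ} (hP : IsUnit P.det)
    {h : (Fin n → ℝ) → ℂ} (hh : Continuous h) :
    ∫ x, h (P *ᵥ x) = (|P.det|⁻¹ : ℝ) * ∫ x, h x := by
  have hmap := Real.map_matrix_volume_pi_eq_smul_volume_pi hP.ne_zero
  have hm : Measurable (Matrix.toLin' P) := (LinearMap.continuous_of_finiteDimensional _).measurable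
  have h1 := integral_map (μ := volume) hm.aemeasurable (f := h) hh.aestronglyMeasurable
  rw [hmap, integral_smul_measure] at h1
  simp only [Matrix.toLin'_apply] at h1
  rw [← h1, ENNReal.toReal_ofReal (abs_nonneg _), abs_inv, Complex.real_smul]

/-- The principal square root is multiplicative on `-i/2` and `τ`, because the arguments of these
two numbers add up to a number in `(-π, π]`. -/
theorem cpow_half_div_two_I (τ : ℍ) :
    (Real.pi / (2 * Real.pi * Complex.I / τ) : ℂ) ^ (1 / 2 : ℂ) =
      (-Complex.I / 2) ^ (1 / 2 : ℂ) * (τ : ℂ) ^ (1 / 2 : ℂ) := by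
  have hτ : (τ : ℂ) ≠ 0 := τ.ne_zero
  have hI : (-Complex.I / 2 : ℂ) ≠ 0 := by simp
  have h1 : (Real.pi / (2 * Real.pi * Complex.I / τ) : ℂ) = (-Complex.I / 2) * τ := by
    have : (Real.pi : ℂ) ≠ 0 := by exact_mod_cast Real.pi_ne_zero
    field_simp
    rw [Complex.I_sq]; ring
  have hargI : Complex.arg (-Complex.I / 2) = -(Real.pi / 2) := by
    have : (-Complex.I / 2 : ℂ) = ((1 / 2 : ℝ) : ℂ) * (-Complex.I) := by push_cast; ring
    rw [this, Complex.arg_real_mul _ (by norm_num), Complex.arg_neg_I]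
  have h2 : 0 ≤ Complex.arg τ := Complex.arg_nonneg_iff.mpr τ.im_pos.le
  have h3 := Complex.arg_le_pi τ
  rw [h1, Complex.cpow_def_of_ne_zero (mul_ne_zero hI hτ), Complex.cpow_def_of_ne_zero hI,
    Complex.cpow_def_of_ne_zero hτ, ← Complex.exp_add, Complex.log_mul hI hτ, add_mul]
  rw [hargI]
  constructor <;> linarith [Real.pi_pos]

/-- The Fourier transform of a shifted complex Gaussian attached to `F`. A root `P` of `F`, as in
`F = PᵗP`, reduces it to the standard Gaussian integral. The constant is left unspecified, but it
does not depend on `τ`, `b` or `s`. -/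
theorem exists_integral_gaussian (F : HalfIntegral n) : ∃ C : ℂ, C ≠ 0 ∧
    ∀ (τ : ℍ) (b : Fin n → ℂ) (s : Fin n → ℤ),
      ∫ x : Fin n → ℝ, e (toComplex (-s) ⬝ᵥ realToComplex x) *
          e (-F.cform (realToComplex x + b) / τ) =
        C * ((τ : ℂ) ^ (1 / 2 : ℂ)) ^ n * (e (τ * F.qf s) * e (toComplex s ⬝ᵥ b)) := by
  obtain ⟨P, hP, hF⟩ := F.exists_root
  set Pc : Matrix (Fin n) (Fin n) ℂ := P.map fun t : ℝ => (t : ℂ) with hPc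
  refine ⟨(|P.det|⁻¹ : ℝ) * ((-Complex.I / 2) ^ (1 / 2 : ℂ)) ^ n, ?_, fun τ b s => ?_⟩
  · refine mul_ne_zero ?_ (pow_ne_zero _ ?_)
    · simpa using hP.ne_zero
    · simp [Complex.cpow_eq_zero_iff]
  have hτ : (τ : ℂ) ≠ 0 := τ.ne_zero
  have hpi : (Real.pi : ℂ) ≠ 0 := by exact_mod_cast Real.pi_ne_zero
  set β : ℂ := 2 * Real.pi * Complex.I / τ with hβ
  have hβ0 : β ≠ 0 := div_ne_zero Complex.two_pi_I_ne_zero hτ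
  have hβre : 0 < β.re := by
    have h1 : β.re = 2 * Real.pi * (τ.im / Complex.normSq τ) := by
      simp [hβ, Complex.div_re]; ring
    rw [h1]
    have := Complex.normSq_pos.mpr hτ
    have := τ.im_pos
    positivity
  have hPt : IsUnit Pᵀ.det := by rwa [Matrix.det_transpose]
  set b' : Fin n → ℂ := Pc *ᵥ b with hb'
  set t : Fin n → ℝ := Pᵀ⁻¹ *ᵥ toReal s with ht
  have hs : toReal s = Pᵀ *ᵥ t := by
    rw [ht, Matrix.mulVec_mulVec, Matrix.mul_nonsing_inv _ hPt, Matrix.one_mulVec]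
  have hsC : toComplex s = Pcᵀ *ᵥ realToComplex t := by
    funext i
    have := congrArg (fun x : ℝ => (x : ℂ)) (congrFun hs i)
    simpa [toComplex, realToComplex, toReal, Matrix.mulVec, dotProduct, hPc] using this
  have hinv : F.invForm s = ∑ j, t j ^ 2 := by
    rw [HalfIntegral.invForm, hF, Matrix.mul_inv_rev, ← Matrix.mulVec_mulVec, ← ht,
      Matrix.dotProduct_mulVec, ← Matrix.mulVec_transpose, Matrix.transpose_nonsing_inv, ← ht]
    simp [dotProduct, sq]
  have hsb : toComplex s ⬝ᵥ b = ∑ i, (t i : ℂ) * b' i := by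
    rw [hsC, Matrix.mulVec_transpose, ← Matrix.dotProduct_mulVec]
    rfl
  have hsx : ∀ x : Fin n → ℝ, toComplex (-s) ⬝ᵥ realToComplex x =
      -∑ i, (t i : ℂ) * ((P *ᵥ x) i : ℝ) := by
    intro x
    have h1 : toComplex (-s) = -toComplex s := by funext i; simp [toComplex]
    have h2 : Pc *ᵥ realToComplex x = realToComplex (P *ᵥ x) := by
      funext i; simp [Matrix.mulVec, dotProduct, hPc, realToComplex]
    rw [h1, neg_dotProduct, hsC, Matrix.mulVec_transpose, ← Matrix.dotProduct_mulVec, h2]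
    rfl
  have hform : ∀ x : Fin n → ℝ, F.cform (realToComplex x + b) =
      ∑ i, (((P *ᵥ x) i : ℝ) + b' i) ^ 2 := by
    intro x
    have h2 : Pc *ᵥ realToComplex x = realToComplex (P *ᵥ x) := by
      funext i; simp [Matrix.mulVec, dotProduct, hPc, realToComplex]
    rw [HalfIntegral.cform_eq_of_root hF, ← hPc, Matrix.mulVec_add, h2]
    rfl
  set c : Fin n → ℂ := fun i => -2 * β * b' i - 2 * Real.pi * Complex.I * t i with hc
  set h : (Fin n → ℝ) → ℂ := fun v =>
    Complex.exp (-β * ∑ i, b' i ^ 2) * Complex.exp (-β * ∑ i, (v i : ℂ) ^ 2 + ∑ i, c i * v i)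
    with hh
  have hint : ∀ x : Fin n → ℝ, e (toComplex (-s) ⬝ᵥ realToComplex x) *
      e (-F.cform (realToComplex x + b) / τ) = h (P *ᵥ x) := by
    intro x
    simp only [hsx, hform, hh, e, ← Complex.exp_add]
    congr 1
    have h1 : ∑ i, (((P *ᵥ x) i : ℝ) + b' i) ^ 2 = ∑ i, (((P *ᵥ x) i : ℝ) : ℂ) ^ 2 +
        2 * ∑ i, b' i * ((P *ᵥ x) i : ℝ) + ∑ i, b' i ^ 2 := by
      rw [Finset.mul_sum, ← Finset.sum_add_distrib, ← Finset.sum_add_distrib]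
      exact Finset.sum_congr rfl fun i _ => by ring
    have h2 : ∑ i, c i * ((P *ᵥ x) i : ℝ) = -2 * β * ∑ i, b' i * ((P *ᵥ x) i : ℝ) -
        2 * Real.pi * Complex.I * ∑ i, (t i : ℂ) * ((P *ᵥ x) i : ℝ) := by
      rw [Finset.mul_sum, Finset.mul_sum, ← Finset.sum_sub_distrib]
      exact Finset.sum_congr rfl fun i _ => by rw [hc]; ring
    rw [h1, h2, hβ]
    field_simp
    ring
  have hhc : Continuous h := by rw [hh]; fun_prop
  simp only [hint]
  rw [integral_comp_mulVec hP hhc, hh, MeasureTheory.integral_const_mul,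
    GaussianFourier.integral_cexp_neg_mul_sum_add hβre c]
  have hpow : (Real.pi / β : ℂ) ^ (Fintype.card (Fin n) / 2 : ℂ) =
      ((-Complex.I / 2) ^ (1 / 2 : ℂ)) ^ n * ((τ : ℂ) ^ (1 / 2 : ℂ)) ^ n := by
    rw [← mul_pow, ← cpow_half_div_two_I, ← hβ, ← Complex.cpow_nat_mul, Fintype.card_fin]
    congr 1; ring
  have hexp : Complex.exp (-β * ∑ i, b' i ^ 2) * Complex.exp ((∑ i, c i ^ 2) / (4 * β)) =
      e (τ * F.qf s) * e (toComplex s ⬝ᵥ b) := by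
    have h1 : ∑ i, c i ^ 2 = 4 * β ^ 2 * ∑ i, b' i ^ 2 +
        8 * Real.pi * Complex.I * β * ∑ i, (t i : ℂ) * b' i +
        (2 * Real.pi * Complex.I) ^ 2 * ∑ i, (t i : ℂ) ^ 2 := by
      rw [Finset.mul_sum, Finset.mul_sum, Finset.mul_sum, ← Finset.sum_add_distrib,
        ← Finset.sum_add_distrib]
      exact Finset.sum_congr rfl fun i _ => by rw [hc]; ring
    have h2 : ((F.qf s : ℝ) : ℂ) = 1 / 4 * ∑ i, (t i : ℂ) ^ 2 := by
      rw [HalfIntegral.qf, hinv]; push_cast; rfl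
    rw [h1, h2, hsb, e, e, ← Complex.exp_add, ← Complex.exp_add]
    congr 1
    have h3 : (2 * Real.pi * Complex.I) ^ 2 * (∑ i, (t i : ℂ) ^ 2) / (4 * β) =
        2 * Real.pi * Complex.I * (τ * (1 / 4 * ∑ i, (t i : ℂ) ^ 2)) := by
      rw [hβ]; field_simp
    rw [add_div, add_div, h3]
    field_simp
    ring
  rw [hpow]
  linear_combination (((|P.det|⁻¹ : ℝ) : ℂ) * (((-Complex.I / 2) ^ (1 / 2 : ℂ)) ^ n *
    ((τ : ℂ) ^ (1 / 2 : ℂ)) ^ n)) * hexp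

/-! ### Theta series -/

/-- Replace the terms of a series by equal ones. -/
theorem hasSum_of_eq {ι E : Type*} [AddCommMonoid E] [TopologicalSpace E] {f g : ι → E} {a : E}
    (hf : HasSum f a) (h : ∀ i, g i = f i) : HasSum g a := by
  rwa [funext h]

namespace HalfIntegral

theorem cmat_symm (F : HalfIntegral n) (x y : Fin n → ℂ) :
    x ⬝ᵥ (F.cmat *ᵥ y) = y ⬝ᵥ (F.cmat *ᵥ x) := by
  have h : F.cmatᵀ = F.cmat := by
    ext i j
    simp [cmat, F.symm.apply i j]
  rw [Matrix.dotProduct_mulVec, ← Matrix.mulVec_transpose, h, dotProduct_comm]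

theorem cform_add (F : HalfIntegral n) (x y : Fin n → ℂ) :
    F.cform (x + y) = F.cform x + 2 * (x ⬝ᵥ (F.cmat *ᵥ y)) + F.cform y := by
  simp only [cform, Matrix.mulVec_add, add_dotProduct, dotProduct_add, F.cmat_symm y x]
  ring

theorem cform_smul (F : HalfIntegral n) (a : ℂ) (x : Fin n → ℂ) :
    F.cform (a • x) = a ^ 2 * F.cform x := by
  simp only [cform, Matrix.mulVec_smul, smul_dotProduct, dotProduct_smul, smul_eq_mul]
  ring

theorem cmat_mulVec_real (F : HalfIntegral n) (x : Fin n → ℝ) :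
    F.cmat *ᵥ realToComplex x = realToComplex (F.mat *ᵥ x) := by
  funext i; simp [Matrix.mulVec, dotProduct, cmat, realToComplex]

theorem realToComplex_dotProduct (x y : Fin n → ℝ) :
    realToComplex x ⬝ᵥ realToComplex y = ((x ⬝ᵥ y : ℝ) : ℂ) := by
  simp [dotProduct, realToComplex]

theorem toComplex_eq (r : Fin n → ℤ) : toComplex r = realToComplex (toReal r) := by
  funext i; simp [toComplex, realToComplex, toReal]

theorem cform_toComplex (F : HalfIntegral n) (m : Fin n → ℤ) :
    F.cform (toComplex m) = (F.form m : ℝ) := by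
  rw [cform, toComplex_eq, cmat_mulVec_real, realToComplex_dotProduct, form]

theorem toComplex_gram (F : HalfIntegral n) (m : Fin n → ℤ) :
    toComplex (F.gram *ᵥ m) = (2 : ℂ) • (F.cmat *ᵥ toComplex m) := by
  rw [toComplex_eq, toReal_gram_mulVec, toComplex_eq, cmat_mulVec_real]
  funext i
  rw [← Nat.cast_smul_eq_nsmul ℝ, Matrix.smul_mulVec]
  simp [realToComplex]

theorem toComplex_gram_dotProduct (F : HalfIntegral n) (m : Fin n → ℤ) (z : Fin n → ℂ) :
    toComplex (F.gram *ᵥ m) ⬝ᵥ z = 2 * (z ⬝ᵥ (F.cmat *ᵥ toComplex m)) := by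
  rw [toComplex_gram, smul_dotProduct, dotProduct_comm, smul_eq_mul]

end HalfIntegral

theorem toComplex_add (r s : Fin n → ℤ) : toComplex (r + s) = toComplex r + toComplex s := by
  funext i; simp [toComplex]

theorem toComplex_neg (r : Fin n → ℤ) : toComplex (-r) = -toComplex r := by
  funext i; simp [toComplex]

theorem toComplex_dotProduct (r s : Fin n → ℤ) :
    toComplex r ⬝ᵥ toComplex s = ((r ⬝ᵥ s : ℤ) : ℂ) := by
  simp [toComplex, dotProduct]

/-- The summand of the theta series that belongs to `r`, for an arbitrary complex `τ`. -/
def thetaTerm (F : HalfIntegral n) (r : Fin n → ℤ) (τ : ℂ) (z : Fin n → ℂ) : ℂ :=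
  e (τ * F.qf r + toComplex r ⬝ᵥ z)

theorem norm_thetaTerm_le {F : HalfIntegral n} {δ M : ℝ} {τ : ℂ}
    {z : Fin n → ℂ} (hτ : δ ≤ τ.im) (hz : ‖z‖ ≤ M) (r : Fin n → ℤ) :
    ‖thetaTerm F r τ z‖ ≤
      Real.exp (-(2 * Real.pi * δ * F.qf r) + 2 * Real.pi * M * ∑ i, |(r i : ℝ)|) := by
  rw [thetaTerm, norm_e, Real.exp_le_exp]
  have h1 : (τ * F.qf r + toComplex r ⬝ᵥ z).im = τ.im * F.qf r + ∑ i, (r i : ℝ) * (z i).im := by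
    simp [dotProduct, toComplex, Complex.im_sum]
  have h2 : -(∑ i, (r i : ℝ) * (z i).im) ≤ M * ∑ i, |(r i : ℝ)| := by
    rw [Finset.mul_sum, ← Finset.sum_neg_distrib]
    refine Finset.sum_le_sum fun i _ => ?_
    have h3 : |(z i).im| ≤ M := (Complex.abs_im_le_norm _).trans ((norm_le_pi_norm z i).trans hz)
    calc -((r i : ℝ) * (z i).im) ≤ |(r i : ℝ) * (z i).im| := neg_le_abs _
      _ = |(r i : ℝ)| * |(z i).im| := abs_mul _ _
      _ ≤ |(r i : ℝ)| * M := by gcongr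
      _ = M * |(r i : ℝ)| := mul_comm _ _
  have h4 : δ * F.qf r ≤ τ.im * F.qf r := mul_le_mul_of_nonneg_right hτ (F.qf_nonneg r)
  rw [h1]
  nlinarith [Real.pi_pos]

theorem summable_exp_qf (F : HalfIntegral n) {a : ℝ} (ha : 0 < a) (b : ℝ) :
    Summable fun r : Fin n → ℤ => Real.exp (-(a * F.qf r) + b * ∑ i, |(r i : ℝ)|) := by
  obtain ⟨c, hc, h⟩ := F.exists_le_qf
  refine Summable.of_nonneg_of_le (fun r => (Real.exp_pos _).le) (fun r => ?_)
    (summable_gaussian (mul_pos ha hc) b n)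
  rw [Real.exp_le_exp]
  nlinarith [mul_le_mul_of_nonneg_left (h r) ha.le]

theorem summable_thetaTerm (F : HalfIntegral n) {τ : ℂ} (hτ : 0 < τ.im) (z : Fin n → ℂ) :
    Summable fun r : Fin n → ℤ => thetaTerm F r τ z := by
  exact Summable.of_norm_bounded (summable_exp_qf F (by positivity) _)
    fun r => norm_thetaTerm_le le_rfl le_rfl r

open Classical in
theorem hasSum_theta (F : HalfIntegral n) (x : F.D) (τ : ℍ) (z : Fin n → ℂ) :
    HasSum (fun r : Fin n → ℤ => if (QuotientAddGroup.mk r : F.D) = x then thetaTerm F r τ z else 0)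
      (theta F x τ z) := by
  have h1 : Summable fun r : {r : Fin n → ℤ // (QuotientAddGroup.mk r : F.D) = x} =>
      thetaTerm F r.1 τ z := (summable_thetaTerm F τ.im_pos z).subtype _
  have h2 : HasSum (fun r : {r : Fin n → ℤ // (QuotientAddGroup.mk r : F.D) = x} =>
      thetaTerm F r.1 τ z) (theta F x τ z) := h1.hasSum
  have h3 := (hasSum_subtype_iff_indicator (f := fun r => thetaTerm F r τ z)
    (s := {r | (QuotientAddGroup.mk r : F.D) = x})).mp h2
  refine hasSum_of_eq h3 fun r => ?_
  simp [Set.indicator_apply]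

/-- A combination of theta series, written as one series over `ℤⁿ`. -/
theorem hasSum_theta_smul (F : HalfIntegral n) {E : Type*} [NormedAddCommGroup E]
    [NormedSpace ℂ E] (h : F.D → E) (τ : ℍ) (z : Fin n → ℂ) :
    HasSum (fun r : Fin n → ℤ => thetaTerm F r τ z • h (QuotientAddGroup.mk r))
      (∑ x, theta F x τ z • h x) := by
  classical
  convert hasSum_sum fun x (_ : x ∈ Finset.univ) => (hasSum_theta F x τ z).smul_const (h x)
    using 1
  funext r
  simp [ite_smul]

/-- The theta series are linearly independent, already as functions of `z`. -/
theorem theta_linearIndependent (F : HalfIntegral n) {E : Type*} [AddCommGroup E] [Module ℂ E]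
    (τ : ℍ) {a b : F.D → E} (h : ∀ z, ∑ x, theta F x τ z • a x = ∑ x, theta F x τ z • b x) :
    a = b := by
  funext x
  rw [← sub_eq_zero, ← Module.forall_dual_apply_eq_zero_iff ℂ]
  intro f
  induction x using QuotientAddGroup.induction_on with
  | H r =>
  have h1 : ∀ z, ∑ x, theta F x τ z • f (a x - b x) = 0 := by
    intro z
    have := congrArg f (sub_eq_zero.mpr (h z))
    simpa [← Finset.sum_sub_distrib, ← smul_sub] using this
  have h2 : ∀ x : Fin n → ℝ, HasSum (fun r : Fin n → ℤ =>
      (e (τ * F.qf r) * f (a (QuotientAddGroup.mk r) - b (QuotientAddGroup.mk r))) *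
        e (toComplex r ⬝ᵥ realToComplex x)) 0 := by
    intro x
    have h3 := hasSum_theta_smul F (fun x => f (a x - b x)) τ (realToComplex x)
    rw [h1] at h3
    refine hasSum_of_eq h3 fun r => ?_
    rw [thetaTerm, e_add, smul_eq_mul]; ring
  have h3 := (h2 0).summable
  have h4 : realToComplex (0 : Fin n → ℝ) = 0 := by funext i; simp [realToComplex]
  simp only [h4, dotProduct_zero, e_zero, mul_one] at h3
  have h5 := fourier_coeff_eq_zero h3 h2 r
  exact (mul_eq_zero.mp h5).resolve_left (e_ne_zero _)

/-! ### Holomorphy of the theta series -/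

theorem isOpen_im_pos : IsOpen {p : ℂ × (Fin n → ℂ) | 0 < p.1.im} :=
  isOpen_lt continuous_const (Complex.continuous_im.comp continuous_fst)

open Classical in
/-- The theta series are holomorphic: near a given point the derivatives of the summands are
dominated by a summable Gaussian. -/
theorem isHolomorphic_theta (F : HalfIntegral n) (x : F.D) : IsHolomorphic (theta F x) := by
  intro p hp
  set δ : ℝ := p.1.im / 2 with hδ
  have hp' : 0 < p.1.im := hp
  have hδ0 : 0 < δ := by positivity
  set M : ℝ := ‖p.2‖ + 1 with hM
  set s : Set (ℂ × (Fin n → ℂ)) := {τ : ℂ | δ < τ.im} ×ˢ Metric.ball (0 : Fin n → ℂ) M with hs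
  have hso : IsOpen s :=
    (isOpen_lt continuous_const Complex.continuous_im).prod Metric.isOpen_ball
  have hsc : IsPreconnected s :=
    ((convex_halfSpace_im_gt δ).prod (convex_ball (0 : Fin n → ℂ) M)).isPreconnected
  have hps : p ∈ s := by
    refine ⟨?_, ?_⟩
    · change δ < p.1.im; rw [hδ]; linarith
    · rw [mem_ball_zero_iff, hM]; linarith
  -- The logarithmic derivative of the summand at `r`.
  set L : (Fin n → ℤ) → (ℂ × (Fin n → ℂ)) →L[ℂ] ℂ := fun r =>
    (2 * Real.pi * Complex.I : ℂ) • ((F.qf r : ℂ) • ContinuousLinearMap.fst ℂ ℂ (Fin n → ℂ) +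
      ∑ i, (r i : ℂ) • (ContinuousLinearMap.proj i).comp
        (ContinuousLinearMap.snd ℂ ℂ (Fin n → ℂ))) with hL
  have hderiv : ∀ r q, HasFDerivAt (fun q : ℂ × (Fin n → ℂ) => thetaTerm F r q.1 q.2)
      (thetaTerm F r q.1 q.2 • L r) q := by
    intro r q
    have h1 : (fun q : ℂ × (Fin n → ℂ) => thetaTerm F r q.1 q.2) =
        fun q => Complex.exp (L r q) := by
      funext q
      rw [thetaTerm, e]
      congr 1
      simp [hL, dotProduct, toComplex, mul_comm]
      ring
    have h2 : thetaTerm F r q.1 q.2 = Complex.exp (L r q) := congrFun h1 q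
    rw [h1, h2]
    exact (L r).hasFDerivAt.cexp
  have hLnorm : ∀ r, ‖L r‖ ≤ 2 * Real.pi * (F.qf r + ∑ i, |(r i : ℝ)|) := by
    intro r
    have hpi := Real.pi_pos
    refine ContinuousLinearMap.opNorm_le_bound _ (mul_nonneg (by positivity)
      (add_nonneg (F.qf_nonneg r) (Finset.sum_nonneg fun i _ => abs_nonneg _))) fun q => ?_
    have h1 : L r q = (2 * Real.pi * Complex.I : ℂ) * (F.qf r * q.1 + ∑ i, (r i : ℂ) * q.2 i) := by
      simp [hL]
      ring
    rw [h1, norm_mul]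
    have h2 : ‖(2 * Real.pi * Complex.I : ℂ)‖ = 2 * Real.pi := by
      simp [abs_of_pos hpi]
    rw [h2, mul_assoc (2 * Real.pi) (_ + _)]
    refine mul_le_mul_of_nonneg_left ?_ (by positivity)
    refine (norm_add_le _ _).trans ?_
    rw [add_mul]
    refine add_le_add ?_ ?_
    · rw [norm_mul, Complex.norm_real, Real.norm_eq_abs, abs_of_nonneg (F.qf_nonneg r)]
      exact mul_le_mul_of_nonneg_left (_root_.norm_fst_le q) (F.qf_nonneg r)
    · rw [Finset.sum_mul]
      refine (norm_sum_le _ _).trans (Finset.sum_le_sum fun i _ => ?_)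
      rw [norm_mul, Complex.norm_intCast]
      exact mul_le_mul_of_nonneg_left ((norm_le_pi_norm q.2 i).trans (norm_snd_le q)) (abs_nonneg _)
  set u : (Fin n → ℤ) → ℝ := fun r => 2 * Real.pi * ((Real.pi * δ)⁻¹ + 1) *
    Real.exp (-(Real.pi * δ * F.qf r) + (2 * Real.pi * M + 1) * ∑ i, |(r i : ℝ)|) with hu
  have husum : Summable u := (summable_exp_qf F (by positivity) _).mul_left _
  have hbound : ∀ r, ∀ q ∈ s, ‖thetaTerm F r q.1 q.2 • L r‖ ≤ u r := by
    intro r q hq'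
    rw [norm_smul]
    have h1 := norm_thetaTerm_le (F := F) (le_of_lt hq'.1) (mem_ball_zero_iff.mp hq'.2).le r
    set S : ℝ := ∑ i, |(r i : ℝ)| with hS
    have hS0 : 0 ≤ S := Finset.sum_nonneg fun i _ => abs_nonneg _
    have hq0 := F.qf_nonneg r
    have hpd : 0 < Real.pi * δ := by positivity
    -- Both `qf r` and `∑ |r i|` are absorbed by exponentials.
    have h2 : F.qf r + S ≤ ((Real.pi * δ)⁻¹ + 1) * Real.exp (Real.pi * δ * F.qf r + S) := by
      have h3 : Real.pi * δ * F.qf r + S ≤ Real.exp (Real.pi * δ * F.qf r + S) := by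
        linarith [Real.add_one_le_exp (Real.pi * δ * F.qf r + S)]
      have h4 : F.qf r ≤ (Real.pi * δ)⁻¹ * Real.exp (Real.pi * δ * F.qf r + S) := by
        rw [inv_mul_eq_div, le_div_iff₀ hpd]; linarith
      have h5 : S ≤ Real.exp (Real.pi * δ * F.qf r + S) := by
        have : 0 ≤ Real.pi * δ * F.qf r := by positivity
        linarith
      linarith
    calc ‖thetaTerm F r q.1 q.2‖ * ‖L r‖
        ≤ Real.exp (-(2 * Real.pi * δ * F.qf r) + 2 * Real.pi * M * S) *
          (2 * Real.pi * (((Real.pi * δ)⁻¹ + 1) * Real.exp (Real.pi * δ * F.qf r + S))) := by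
          refine mul_le_mul h1 ((hLnorm r).trans ?_) (norm_nonneg _) (Real.exp_pos _).le
          exact mul_le_mul_of_nonneg_left h2 (by positivity)
      _ = u r := by
          rw [hu]
          simp only
          have : -(Real.pi * δ * F.qf r) + (2 * Real.pi * M + 1) * S =
            (-(2 * Real.pi * δ * F.qf r) + 2 * Real.pi * M * S) +
              (Real.pi * δ * F.qf r + S) := by ring
          rw [← hS, this, Real.exp_add (-(2 * Real.pi * δ * F.qf r) + 2 * Real.pi * M * S)]; ring
  have hfd : ∀ r q, q ∈ s → HasFDerivAt (fun q : ℂ × (Fin n → ℂ) =>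
      if (QuotientAddGroup.mk r : F.D) = x then thetaTerm F r q.1 q.2 else 0)
      (if (QuotientAddGroup.mk r : F.D) = x then thetaTerm F r q.1 q.2 • L r else 0) q := by
    intro r q _
    split_ifs
    · exact hderiv r q
    · exact hasFDerivAt_const _ _
  have hmain := hasFDerivAt_tsum_of_isPreconnected husum hso hsc hfd (fun r q hq' => by
    split_ifs
    · exact hbound r q hq'
    · simpa using (norm_nonneg _).trans (hbound r q hq')) hps
    (hasSum_theta F x ⟨p.1, hp⟩ p.2).summable hps
  refine (hmain.differentiableAt.congr_of_eventuallyEq ?_).differentiableWithinAt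
  filter_upwards [isOpen_im_pos.mem_nhds hp] with q hq'
  rw [UpperHalfPlane.ofComplex_apply_of_im_pos hq']
  exact (hasSum_theta F x ⟨q.1, hq'⟩ q.2).tsum_eq.symm

/-! ### Transformation laws of the theta series -/

/-- The Heisenberg element `[l,m]` carries the summand at `r` to the summand at `r + 2Fl`. -/
theorem thetaTerm_heis (F : HalfIntegral n) (r l m : Fin n → ℤ) (τ : ℂ) (z : Fin n → ℂ) :
    e (τ * F.cform (toComplex l) + 2 * (z ⬝ᵥ (F.cmat *ᵥ toComplex l))) *
      thetaTerm F r τ (fun i => z i + (l i : ℂ) * τ + (m i : ℂ)) =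
      thetaTerm F (r + F.gram *ᵥ l) τ z := by
  have h1 : (fun i => z i + (l i : ℂ) * τ + (m i : ℂ)) = z + τ • toComplex l + toComplex m := by
    funext i; simp [toComplex]; ring
  rw [thetaTerm, thetaTerm, ← e_add, h1]
  refine e_eq_of_sub_int (k := r ⬝ᵥ m) ?_
  rw [dotProduct_add, dotProduct_add, dotProduct_smul, toComplex_dotProduct, toComplex_dotProduct,
    toComplex_add, add_dotProduct, F.toComplex_gram_dotProduct, F.cform_toComplex, F.qf_add_gram]
  push_cast
  simp only [smul_eq_mul]
  ring

theorem heisSlash_theta (F : HalfIntegral n) (x : F.D) (l m : Fin n → ℤ) :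
    heisSlash F (theta F x) l m = theta F x := by
  classical
  funext τ z
  have h1 := (hasSum_theta F x τ (fun i => z i + (l i : ℂ) * (τ : ℂ) + (m i : ℂ))).mul_left
    (e (τ * F.cform (toComplex l) + 2 * (z ⬝ᵥ (F.cmat *ᵥ toComplex l))))
  have h2 := ((Equiv.addRight (F.gram *ᵥ l)).hasSum_iff).mpr (hasSum_theta F x τ z)
  refine h1.unique (hasSum_of_eq h2 fun r => ?_)
  have h3 : (QuotientAddGroup.mk (r + F.gram *ᵥ l) : F.D) = QuotientAddGroup.mk r := by
    rw [QuotientAddGroup.mk_add, (QuotientAddGroup.eq_zero_iff _).mpr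
      (F.mem_lattice_iff.mpr ⟨l, rfl⟩), add_zero]
  simp only [Function.comp_apply, Equiv.coe_addRight, h3, mul_ite, mul_zero, thetaTerm_heis]

theorem slash_T_theta (F : HalfIntegral n) (x : F.D) (τ : ℍ) (z : Fin n → ℂ) :
    slash F (n : ℤ) (theta F x) Mp.T τ z = eCircle (F.Q x) * theta F x τ z := by
  classical
  have hT : ((Mp.T.mat • τ : ℍ) : ℂ) = τ + 1 := by
    change ((ModularGroup.T • τ : ℍ) : ℂ) = τ + 1
    rw [UpperHalfPlane.modular_T_smul]; simp [add_comm]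
  have h1 : slash F (n : ℤ) (theta F x) Mp.T τ z = theta F x (Mp.T.mat • τ) z := by
    simp [slash, Mp.T, ModularGroup.T, autFactor]
  rw [h1]
  refine ((hasSum_theta F x τ z).mul_left (eCircle (F.Q x))).unique
    (hasSum_of_eq (hasSum_theta F x _ z) fun r => ?_) |>.symm
  by_cases hr : (QuotientAddGroup.mk r : F.D) = x
  · rw [if_pos hr, if_pos hr, ← hr, F.eCircle_Q_mk, thetaTerm, thetaTerm, ← e_add, hT]
    congr 1; ring
  · rw [if_neg hr, if_neg hr, mul_zero]

/-- The summand of `θ|S` that belongs to `r₀ + 2Fm` is the value at `m` of a shifted Gaussian. -/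
theorem thetaTerm_S (F : HalfIntegral n) (r₀ m : Fin n → ℤ) {τ : ℂ} (hτ : τ ≠ 0)
    (z : Fin n → ℂ) :
    e (-F.cform z / τ) * thetaTerm F (r₀ + F.gram *ᵥ m) (-τ)⁻¹ (fun i => z i / τ) =
      e (-F.cform (toComplex m + ((1 / 2 : ℂ) • realToComplex (F.mat⁻¹ *ᵥ toReal r₀) - z)) / τ) := by
  set a : Fin n → ℂ := (1 / 2 : ℂ) • realToComplex (F.mat⁻¹ *ᵥ toReal r₀) with ha
  have hFa : F.cmat *ᵥ a = (1 / 2 : ℂ) • toComplex r₀ := by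
    rw [ha, Matrix.mulVec_smul, F.cmat_mulVec_real, Matrix.mulVec_mulVec,
      Matrix.mul_nonsing_inv _ F.isUnit_det, Matrix.one_mulVec, HalfIntegral.toComplex_eq]
  have hr : toComplex (r₀ + F.gram *ᵥ m) = (2 : ℂ) • (F.cmat *ᵥ (toComplex m + a)) := by
    rw [toComplex_add, F.toComplex_gram, Matrix.mulVec_add, hFa, smul_add, smul_smul]
    norm_num [add_comm]
  have hqa : F.cform a = F.qf r₀ := by
    rw [HalfIntegral.cform, hFa, ha, smul_dotProduct, dotProduct_smul, HalfIntegral.toComplex_eq,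
      HalfIntegral.realToComplex_dotProduct, HalfIntegral.qf, HalfIntegral.invForm,
      dotProduct_comm]
    push_cast
    simp only [smul_eq_mul]
    ring
  have hq : (F.qf (r₀ + F.gram *ᵥ m) : ℂ) = F.cform (toComplex m + a) := by
    rw [F.cform_add, hqa, hFa, dotProduct_smul, toComplex_dotProduct, F.cform_toComplex,
      F.qf_add_gram, dotProduct_comm]
    push_cast
    simp only [smul_eq_mul]
    ring
  have hz : (fun i => z i / τ) = τ⁻¹ • z := by
    funext i; simp [div_eq_inv_mul]
  have h1 : toComplex m + (a - z) = (toComplex m + a) + (-1 : ℂ) • z := by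
    rw [neg_one_smul]; abel
  rw [thetaTerm, ← e_add, hq, hr, hz, h1, F.cform_add (toComplex m + a), F.cform_smul,
    Matrix.mulVec_smul, dotProduct_smul, dotProduct_smul, smul_dotProduct, dotProduct_comm _ z,
    F.cmat_symm z]
  congr 1
  simp only [smul_eq_mul]
  field_simp
  ring

/-- Uniform bounds for the translates of the shifted Gaussian. -/
theorem exists_summable_gaussian_bound (F : HalfIntegral n) (τ : ℍ) (b : Fin n → ℂ) :
    ∃ u : (Fin n → ℤ) → ℝ, Summable u ∧ ∀ (m : Fin n → ℤ) (x : Fin n → ℝ), ‖x‖ < 2 →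
      ‖e (-F.cform (realToComplex (x + toReal m) + b) / τ)‖ ≤ u m := by
  have hτ : (τ : ℂ) ≠ 0 := τ.ne_zero
  set τ' : ℂ := (-(τ : ℂ))⁻¹ with hτ'
  have him : 0 < τ'.im := τ.im_inv_neg_coe_pos
  have hc1 : Continuous fun x : Fin n → ℝ => e (τ' * F.cform (realToComplex x + b)) := by
    unfold e HalfIntegral.cform dotProduct Matrix.mulVec realToComplex dotProduct
    simp only [Pi.add_apply]
    fun_prop
  have hc2 : Continuous fun x : Fin n → ℝ => τ' • (realToComplex x + b) := by
    unfold realToComplex; fun_prop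
  have hK := isCompact_closedBall (0 : Fin n → ℝ) 2
  obtain ⟨K, hK1⟩ := hK.exists_bound_of_continuousOn hc1.continuousOn
  obtain ⟨M, hM⟩ := hK.exists_bound_of_continuousOn hc2.continuousOn
  refine ⟨fun m => K * Real.exp (-(2 * Real.pi * τ'.im * F.qf (F.gram *ᵥ m)) +
    2 * Real.pi * M * ∑ i, |((F.gram *ᵥ m) i : ℝ)|), ?_, fun m x hx => ?_⟩
  · exact ((summable_exp_qf F (by positivity) _).comp_injective F.gram_mulVec_injective).mul_left K
  · have hx' : x ∈ Metric.closedBall (0 : Fin n → ℝ) 2 := by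
      rw [mem_closedBall_zero_iff]; exact hx.le
    have h1 : e (-F.cform (realToComplex (x + toReal m) + b) / τ) =
        e (τ' * F.cform (realToComplex x + b)) *
          thetaTerm F (F.gram *ᵥ m) τ' (τ' • (realToComplex x + b)) := by
      have h2 : realToComplex (x + toReal m) + b = toComplex m + (realToComplex x + b) := by
        funext i; simp [realToComplex, toReal, toComplex]; ring
      rw [h2, thetaTerm, ← e_add, F.cform_add, dotProduct_smul, F.toComplex_gram_dotProduct,
        F.cform_toComplex, F.qf_gram, F.cmat_symm (toComplex m)]
      congr 1
      rw [hτ']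
      simp only [smul_eq_mul]
      field_simp
      ring
    rw [h1, norm_mul]
    have h3 := hK1 x hx'
    exact mul_le_mul h3 (norm_thetaTerm_le le_rfl (hM x hx') _) (norm_nonneg _)
      ((norm_nonneg _).trans h3)

/-- The inversion formula for the theta series, up to the value of a constant. -/
theorem exists_slash_S_theta (F : HalfIntegral n) : ∃ C : ℂ, C ≠ 0 ∧
    ∀ (x : F.D) (τ : ℍ) (z : Fin n → ℂ), slash F (n : ℤ) (theta F x) Mp.S τ z =
      C * ∑ y, theta F y τ z * eCircle (-F.B y x) := by
  obtain ⟨C, hC, hint⟩ := exists_integral_gaussian F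
  refine ⟨C, hC, fun x τ z => ?_⟩
  induction x using QuotientAddGroup.induction_on with
  | H r₀ =>
  have hτ : (τ : ℂ) ≠ 0 := τ.ne_zero
  set w : ℂ := (τ : ℂ) ^ (1 / 2 : ℂ) with hw
  have hw0 : w ≠ 0 := by
    rw [hw]; simp [Complex.cpow_eq_zero_iff, hτ]
  set b : Fin n → ℂ := (1 / 2 : ℂ) • realToComplex (F.mat⁻¹ *ᵥ toReal r₀) - z with hb
  set g : (Fin n → ℝ) → ℂ := fun x => e (-F.cform (realToComplex x + b) / τ) with hg
  have hgc : Continuous g := by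
    rw [hg]
    unfold e HalfIntegral.cform dotProduct Matrix.mulVec realToComplex dotProduct
    simp only [Pi.add_apply]
    fun_prop
  -- The integral of a function that is not integrable is zero, by convention, whereas the formula
  -- `hint` gives a nonzero value.
  have hgi : MeasureTheory.Integrable g := by
    by_contra hne
    have h1 := hint τ b 0
    have h0 : toComplex (0 : Fin n → ℤ) = 0 := by funext i; simp [toComplex]
    simp only [neg_zero, h0, zero_dotProduct, e_zero, one_mul, mul_one] at h1
    rw [MeasureTheory.integral_undef hne] at h1
    exact mul_ne_zero (mul_ne_zero hC (pow_ne_zero _ hw0)) (e_ne_zero _) h1.symm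
  obtain ⟨u, hu, hub⟩ := exists_summable_gaussian_bound F τ b
  have hint' : ∀ s : Fin n → ℤ, ∫ x, e (toComplex (-s) ⬝ᵥ realToComplex x) * g x =
      C * w ^ n * thetaTerm F s τ b := by
    intro s
    rw [hg, hint τ b s, thetaTerm, e_add]
  have hpois := poisson_summation hgc hgi hu hub (by
    simp only [hint']
    exact (summable_thetaTerm F τ.im_pos b).mul_left _)
  simp only [hint'] at hpois
  -- The sum over the lattice in the Poisson formula is `θ|S`.
  have hleft : e (-F.cform z / τ) *
      theta F (QuotientAddGroup.mk r₀) (Mp.S.mat • τ) (fun i => z i / τ) =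
      ∑' m : Fin n → ℤ, g (toReal m) := by
    have hS : ((Mp.S.mat • τ : ℍ) : ℂ) = (-(τ : ℂ))⁻¹ := by
      change ((ModularGroup.S • τ : ℍ) : ℂ) = _
      rw [UpperHalfPlane.modular_S_smul]
    have hinj : Function.Injective fun m : Fin n → ℤ => r₀ + F.gram *ᵥ m :=
      fun a b h => F.gram_mulVec_injective (add_left_cancel h)
    classical
    have h1 := (hasSum_theta F (QuotientAddGroup.mk r₀) (Mp.S.mat • τ) (fun i => z i / τ)).mul_left
      (e (-F.cform z / τ))
    rw [← hinj.hasSum_iff] at h1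
    · refine (h1.tsum_eq.symm).trans (tsum_congr fun m => ?_)
      have h2 : (QuotientAddGroup.mk (r₀ + F.gram *ᵥ m) : F.D) = QuotientAddGroup.mk r₀ := by
        rw [QuotientAddGroup.mk_add, (QuotientAddGroup.eq_zero_iff _).mpr
          (F.mem_lattice_iff.mpr ⟨m, rfl⟩), add_zero]
      simp only [Function.comp_apply, h2, if_true]
      rw [hS, thetaTerm_S F r₀ m hτ z, hg, HalfIntegral.toComplex_eq]
    · intro r hr
      rw [if_neg, mul_zero]
      intro h2
      refine hr ?_
      have h3 := QuotientAddGroup.eq.mp h2.symm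
      obtain ⟨m, hm⟩ := F.mem_lattice_iff.mp h3
      exact ⟨m, by simp only [← hm]; abel⟩
  have hright : HasSum (fun s : Fin n → ℤ => C * w ^ n * thetaTerm F (-s) τ b)
      (C * w ^ n * ∑ y, theta F y τ z * eCircle (-F.B y (QuotientAddGroup.mk r₀))) := by
    refine HasSum.mul_left _ ?_
    refine hasSum_of_eq (hasSum_theta_smul F
      (fun y => eCircle (-F.B y (QuotientAddGroup.mk r₀))) τ z) fun s => ?_
    have h1 : toComplex (-s) ⬝ᵥ b = toComplex s ⬝ᵥ z + ((-F.bil s r₀ : ℝ) : ℂ) := by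
      rw [hb, dotProduct_sub, dotProduct_smul, toComplex_neg, neg_dotProduct, neg_dotProduct,
        HalfIntegral.toComplex_eq, HalfIntegral.realToComplex_dotProduct, HalfIntegral.bil]
      push_cast
      simp only [smul_eq_mul]
      ring
    have h2 : F.qf (-s) = F.qf s := by
      simp [HalfIntegral.qf, HalfIntegral.invForm, toReal_neg, Matrix.mulVec_neg]
    rw [F.B_mk, ← AddCircle.coe_neg, eCircle_coe, thetaTerm, thetaTerm, h1, h2, smul_eq_mul,
      ← e_add, add_assoc]
  have hfin := ((Equiv.neg (Fin n → ℤ)).hasSum_iff.mpr hpois).unique hright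
  rw [← hleft] at hfin
  have h4 : slash F (n : ℤ) (theta F (QuotientAddGroup.mk r₀)) Mp.S τ z =
      (w ^ n)⁻¹ * (e (-F.cform z / τ) *
        theta F (QuotientAddGroup.mk r₀) (Mp.S.mat • τ) (fun i => z i / τ)) := by
    have h5 : autFactor Mp.S.mat τ = τ := by simp [autFactor, Mp.S, ModularGroup.S]
    have h6 : ((Mp.S.mat 1 0 : ℤ) : ℂ) = 1 := by simp [Mp.S, ModularGroup.S]
    rw [slash, h5, h6, zpow_neg, zpow_natCast, smul_eq_mul, mul_assoc, HalfIntegral.cform,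
      neg_one_mul]
    rfl
  rw [h4, hfin]
  field_simp

/-! ### The metaplectic group is generated by `T` and `S` -/

/-- The square roots of `1` on the upper half plane are constant, because `ℍ` is connected. -/
theorem eq_or_eq_neg_of_sq {f : ℍ → ℂ} (hf : MDiff f) (hsq : ∀ τ, f τ ^ 2 = 1) :
    (∀ τ, f τ = 1) ∨ ∀ τ, f τ = -1 := by
  have h := (isPreconnected_univ (α := ℍ)).eq_one_or_eq_neg_one_of_sq_eq
    hf.continuous.continuousOn (fun τ _ => hsq τ)
  exact h.imp (fun h τ => h (Set.mem_univ τ)) (fun h τ => h (Set.mem_univ τ))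

namespace Mp

/-- The projection `Mp → SL(2, ℤ)`. -/
def matHom : Mp →* SL(2, ℤ) where
  toFun α := α.mat
  map_one' := rfl
  map_mul' _ _ := rfl

theorem S_sq_mat : (S * S).mat = -1 := by
  change ModularGroup.S * ModularGroup.S = -1
  decide

theorem S_pow_four_mat : (S * S * (S * S)).mat = 1 := by
  rw [mul_mat, S_sq_mat]; simp

theorem S_pow_four_w (τ : ℍ) : (S * S * (S * S)).w τ = -1 := by
  have h1 : (S * S).mat • τ = τ := by
    rw [S_sq_mat]
    exact (ModularGroup.SL_neg_smul 1 τ).trans (one_smul _ τ)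
  rw [mul_w, h1, ← pow_two, (S * S).sq, S_sq_mat]
  simp [autFactor]

/-- `Mp` is generated by `T` and `S`: a subgroup containing them maps onto `SL(2, ℤ)`, and the
kernel of the projection is generated by `S⁴`. -/
theorem closure_T_S : Subgroup.closure ({T, S} : Set Mp) = ⊤ := by
  refine eq_top_iff.mpr fun α _ => ?_
  set H := Subgroup.closure ({T, S} : Set Mp) with hH
  have hT : T ∈ H := Subgroup.subset_closure (by simp)
  have hS : S ∈ H := Subgroup.subset_closure (by simp)
  have hmap : H.map matHom = ⊤ := by
    rw [eq_top_iff, ← SpecialLinearGroup.SL2Z_generators, Subgroup.closure_le]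
    rintro _ (rfl | rfl)
    · exact ⟨S, hS, rfl⟩
    · exact ⟨T, hT, rfl⟩
  obtain ⟨β, hβ, hβα⟩ : α.mat ∈ H.map matHom := hmap ▸ Subgroup.mem_top _
  have hβα' : β.mat = α.mat := hβα
  suffices h : α * β⁻¹ ∈ H by simpa using H.mul_mem h hβ
  have hm : (α * β⁻¹).mat = 1 := by simp [hβα']
  have hsq : ∀ τ, (α * β⁻¹).w τ ^ 2 = 1 := fun τ => by
    rw [(α * β⁻¹).sq, hm]; simp [autFactor]
  rcases eq_or_eq_neg_of_sq (α * β⁻¹).holo hsq with h | h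
  · have : α * β⁻¹ = 1 := Mp.ext hm (funext h)
    rw [this]; exact H.one_mem
  · have : α * β⁻¹ = S * S * (S * S) :=
      Mp.ext (hm.trans S_pow_four_mat.symm) (funext fun τ => (h τ).trans (S_pow_four_w τ).symm)
    rw [this]
    exact H.mul_mem (H.mul_mem hS hS) (H.mul_mem hS hS)

/-- The principal square root maps the upper half plane into the open first quadrant. -/
theorem sqrt_re_im_pos (τ : ℍ) :
    0 < ((τ : ℂ) ^ (1 / 2 : ℂ)).re ∧ 0 < ((τ : ℂ) ^ (1 / 2 : ℂ)).im := by
  have hpi := Real.pi_pos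
  have h0 : 0 < Complex.arg τ :=
    lt_of_le_of_ne (Complex.arg_nonneg_iff.mpr τ.im_pos.le) fun h => by
      have := (Complex.arg_eq_zero_iff.mp h.symm).2
      exact τ.im_pos.ne' this
  have h1 : Complex.arg τ < Real.pi :=
    lt_of_le_of_ne (Complex.arg_le_pi _) fun h => by
      have := (Complex.arg_eq_pi_iff.mp h).2
      exact τ.im_pos.ne' this
  have h2 : (Complex.log τ * (1 / 2 : ℂ)).im = Complex.arg τ / 2 := by
    have : (1 / 2 : ℂ) = ((1 / 2 : ℝ) : ℂ) := by norm_num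
    rw [this, Complex.im_mul_ofReal, Complex.log_im]; ring
  rw [Complex.cpow_def_of_ne_zero τ.ne_zero, Complex.exp_re, Complex.exp_im, h2]
  exact ⟨mul_pos (Real.exp_pos _) (Real.cos_pos_of_mem_Ioo ⟨by linarith, by linarith⟩),
    mul_pos (Real.exp_pos _) (Real.sin_pos_of_pos_of_lt_pi (by linarith) (by linarith))⟩

/-- The braid relation of `Mp`. On the level of matrices it is a computation; the two sides can
then differ by a sign only. -/
theorem T_S_T_S_T : T * S * T * S * T = S := by
  have hm : (T * S * T * S * T).mat = S.mat := by
    change ModularGroup.T * ModularGroup.S * ModularGroup.T * ModularGroup.S * ModularGroup.T =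
      ModularGroup.S
    decide
  refine Mp.ext hm (funext fun τ => ?_)
  have hsq : (T * S * T * S * T).w τ ^ 2 = S.w τ ^ 2 := by rw [Mp.sq, Mp.sq, hm]
  refine (sq_eq_sq_iff_eq_or_eq_neg.mp hsq).resolve_right fun h => ?_
  -- The imaginary part of a product of two numbers in the open first quadrant is positive.
  have h1 : ∃ u v : ℍ, (T * S * T * S * T).w τ = (u : ℂ) ^ (1 / 2 : ℂ) * (v : ℂ) ^ (1 / 2 : ℂ) :=
    ⟨_, _, by simp only [mul_w, T, S, one_mul, mul_one]; rfl⟩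
  obtain ⟨u, v, huv⟩ := h1
  have h2 : S.w τ = (τ : ℂ) ^ (1 / 2 : ℂ) := rfl
  have h3 := congrArg Complex.im h
  rw [huv, h2, Complex.mul_im, Complex.neg_im] at h3
  have hu := sqrt_re_im_pos u
  have hv := sqrt_re_im_pos v
  have ht := sqrt_re_im_pos τ
  nlinarith [mul_pos hu.1 hv.2, mul_pos hu.2 hv.1]

end Mp

/-! ### The slash operators -/

section Slash

variable {V : Type*} [NormedAddCommGroup V] [NormedSpace ℂ V]

theorem det_entries (A : SL(2, ℤ)) :
    (A 0 0 : ℂ) * (A 1 1 : ℂ) - (A 0 1 : ℂ) * (A 1 0 : ℂ) = 1 := by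
  have h := A.2
  rw [Matrix.det_fin_two] at h
  exact_mod_cast h

theorem mul_entry (A B : SL(2, ℤ)) (i j : Fin 2) :
    ((A * B) i j : ℂ) = (A i 0 : ℂ) * (B 0 j : ℂ) + (A i 1 : ℂ) * (B 1 j : ℂ) := by
  simp [Matrix.SpecialLinearGroup.coe_mul, Matrix.mul_apply, Fin.sum_univ_two]

theorem slash_one (F : HalfIntegral n) (κ : ℤ) (φ : ℍ → (Fin n → ℂ) → V) :
    slash F κ φ 1 = φ := by
  funext τ z
  simp [slash, autFactor]

theorem slash_mul (F : HalfIntegral n) (κ : ℤ) (φ : ℍ → (Fin n → ℂ) → V) (α β : Mp) :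
    slash F κ φ (α * β) = slash F κ (slash F κ φ α) β := by
  funext τ z
  have h1 := autFactor_ne_zero β.mat τ
  have h2 := autFactor_ne_zero α.mat (β.mat • τ)
  have h3 := autFactor_mul α.mat β.mat τ
  have hz : (fun i => z i / autFactor (α * β).mat τ) =
      fun i => z i / autFactor β.mat τ / autFactor α.mat (β.mat • τ) := by
    funext i
    rw [Mp.mul_mat, h3, div_div, mul_comm (autFactor β.mat τ)]
  have hz2 : (fun i => z i / autFactor β.mat τ) = (autFactor β.mat τ)⁻¹ • z := by
    funext i; simp [div_eq_inv_mul]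
  have hform : (fun i => z i / autFactor β.mat τ) ⬝ᵥ
      (F.cmat *ᵥ fun i => z i / autFactor β.mat τ) =
      (autFactor β.mat τ)⁻¹ ^ 2 * (z ⬝ᵥ (F.cmat *ᵥ z)) := by
    rw [hz2]; exact F.cform_smul _ _
  simp only [slash, smul_smul]
  rw [hform, hz, Mp.mul_mat, mul_smul α.mat β.mat τ, Mp.mul_w, mul_zpow, h3]
  refine congrArg₂ (· • ·) ?_ rfl
  have hkey : (β.mat 1 0 : ℂ) * (autFactor α.mat (β.mat • τ) * autFactor β.mat τ) + (α.mat 1 0 : ℂ)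
      = ((α.mat * β.mat) 1 0 : ℂ) * autFactor β.mat τ := by
    rw [← h3]
    simp only [autFactor, mul_entry]
    linear_combination (-(α.mat 1 0 : ℂ)) * det_entries β.mat
  have he : -((α.mat * β.mat) 1 0 : ℂ) * (z ⬝ᵥ (F.cmat *ᵥ z)) /
        (autFactor α.mat (β.mat • τ) * autFactor β.mat τ) =
      -(β.mat 1 0 : ℂ) * (z ⬝ᵥ (F.cmat *ᵥ z)) / autFactor β.mat τ +
      -(α.mat 1 0 : ℂ) * ((autFactor β.mat τ)⁻¹ ^ 2 * (z ⬝ᵥ (F.cmat *ᵥ z))) /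
        autFactor α.mat (β.mat • τ) := by
    field_simp
    linear_combination (z ⬝ᵥ (F.cmat *ᵥ z)) * hkey
  rw [he, e_add]
  ring

/-- The number `2 lᵗFm` is an integer. -/
theorem two_mul_form_eq (F : HalfIntegral n) (l m : Fin n → ℤ) :
    2 * (toComplex l ⬝ᵥ (F.cmat *ᵥ toComplex m)) = ((l ⬝ᵥ (F.gram *ᵥ m) : ℤ) : ℂ) := by
  rw [← toComplex_dotProduct, dotProduct_comm (toComplex l) (toComplex (F.gram *ᵥ m)),
    F.toComplex_gram_dotProduct]

/-- The commutation rule of the slash operators of `Mp` and of the Heisenberg group. No central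
character appears, since the exponents of both sides differ by an integer. -/
theorem heisSlash_slash (F : HalfIntegral n) (κ : ℤ) (φ : ℍ → (Fin n → ℂ) → V) (α : Mp)
    (l m : Fin n → ℤ) :
    heisSlash F (slash F κ φ α) l m = slash F κ (heisSlash F φ
      (fun i => α.mat 1 1 * l i - α.mat 1 0 * m i)
      (fun i => α.mat 0 0 * m i - α.mat 0 1 * l i)) α := by
  funext τ z
  set a : ℂ := (α.mat 0 0 : ℂ) with ha
  set b : ℂ := (α.mat 0 1 : ℂ) with hb
  set c : ℂ := (α.mat 1 0 : ℂ) with hc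
  set d : ℂ := (α.mat 1 1 : ℂ) with hd
  have hdet : a * d - b * c = 1 := det_entries α.mat
  have hj0 := autFactor_ne_zero α.mat τ
  have hj : autFactor α.mat τ = c * τ + d := rfl
  rw [hj] at hj0
  have hτ : ((α.mat • τ : ℍ) : ℂ) = (a * τ + b) / (c * τ + d) := by
    rw [UpperHalfPlane.coe_specialLinearGroup_apply]; simp [ha, hb, hc, hd]
  set l' : Fin n → ℤ := fun i => α.mat 1 1 * l i - α.mat 1 0 * m i with hl'
  set m' : Fin n → ℤ := fun i => α.mat 0 0 * m i - α.mat 0 1 * l i with hm'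
  have hlC : toComplex l' = d • toComplex l + (-c) • toComplex m := by
    funext i; simp [toComplex, hl', hc, hd]; ring
  have harg : (fun i => (z i + (l i : ℂ) * τ + (m i : ℂ)) / autFactor α.mat τ) =
      fun i => z i / autFactor α.mat τ + (l' i : ℂ) * ((α.mat • τ : ℍ) : ℂ) + (m' i : ℂ) := by
    funext i
    rw [hj, hτ]
    simp only [hl', hm']
    push_cast
    rw [← ha, ← hb, ← hc, ← hd]
    rw [div_eq_iff hj0, add_mul, add_mul, div_mul_cancel₀ _ hj0, mul_assoc, div_mul_cancel₀ _ hj0]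
    linear_combination (-(l i : ℂ) * τ - (m i : ℂ)) * hdet
  have hz1 : (fun i => z i + (l i : ℂ) * τ + (m i : ℂ)) =
      z + ((τ : ℂ) • toComplex l + toComplex m) := by
    funext i; simp [toComplex]; ring
  have hz2 : (fun i => z i / (c * τ + d)) = (c * τ + d)⁻¹ • z := by
    funext i; simp [div_eq_inv_mul]
  simp only [heisSlash, slash, smul_smul]
  rw [harg]
  congr 1
  obtain ⟨k1, hk1⟩ := F.exists_int_form l
  obtain ⟨k2, hk2⟩ := F.exists_int_form m
  have hF1 : F.cform (toComplex l) = k1 := by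
    rw [F.cform_toComplex, HalfIntegral.form, hk1]; simp
  have hF2 : F.cform (toComplex m) = k2 := by
    rw [F.cform_toComplex, HalfIntegral.form, hk2]; simp
  set x : ℂ := z ⬝ᵥ (F.cmat *ᵥ toComplex l) with hx
  set y : ℂ := z ⬝ᵥ (F.cmat *ᵥ toComplex m) with hy
  set q : ℂ := toComplex l ⬝ᵥ (F.cmat *ᵥ toComplex m) with hq
  have hFz : F.cform (z + ((τ : ℂ) • toComplex l + toComplex m)) =
      F.cform z + 2 * (τ * x + y) + (τ ^ 2 * k1 + 2 * (τ * q) + k2) := by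
    rw [F.cform_add z, F.cform_add, F.cform_smul, hF1, hF2, Matrix.mulVec_add, dotProduct_add,
      Matrix.mulVec_smul, dotProduct_smul, smul_dotProduct]
    simp only [smul_eq_mul, ← hx, ← hy, ← hq]
  have hFl : F.cform (toComplex l') = d ^ 2 * k1 - 2 * (c * d * q) + c ^ 2 * k2 := by
    rw [hlC, F.cform_add, F.cform_smul, F.cform_smul, hF1, hF2, Matrix.mulVec_smul,
      dotProduct_smul, smul_dotProduct]
    simp only [smul_eq_mul, ← hq]
    ring
  have hzl : ((c * τ + d)⁻¹ • z) ⬝ᵥ (F.cmat *ᵥ toComplex l') = (c * τ + d)⁻¹ * (d * x - c * y) := by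
    rw [hlC, Matrix.mulVec_add, dotProduct_add, Matrix.mulVec_smul, Matrix.mulVec_smul,
      dotProduct_smul, dotProduct_smul, smul_dotProduct, smul_dotProduct]
    simp only [smul_eq_mul, ← hx, ← hy]
    ring
  have hq2 : 2 * q = ((l ⬝ᵥ (F.gram *ᵥ m) : ℤ) : ℂ) := two_mul_form_eq F l m
  change e (τ * F.cform (toComplex l) + 2 * x) *
      (α.w τ ^ (-κ) * e (-c * F.cform (fun i => z i + (l i : ℂ) * τ + (m i : ℂ)) / (c * τ + d))) =
    α.w τ ^ (-κ) * e (-c * F.cform z / (c * τ + d)) *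
      e (((α.mat • τ : ℍ) : ℂ) * F.cform (toComplex l') +
        2 * ((fun i => z i / (c * τ + d)) ⬝ᵥ (F.cmat *ᵥ toComplex l')))
  rw [hz1, hz2, hFz, hFl, hzl, hF1, hτ, mul_left_comm, mul_assoc, ← e_add, ← e_add]
  congr 1
  refine e_eq_of_sub_int (k := -(α.mat 0 1 * α.mat 1 1) * k1 +
    α.mat 0 1 * α.mat 1 0 * (l ⬝ᵥ (F.gram *ᵥ m)) - α.mat 0 0 * α.mat 1 0 * k2) ?_
  push_cast
  rw [← hq2, ← ha, ← hb, ← hc, ← hd]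
  have hJ : (c * (τ : ℂ) + d) * (c * (τ : ℂ) + d)⁻¹ = 1 := mul_inv_cancel₀ hj0
  refine mul_right_cancel₀ hj0 ?_
  simp only [div_eq_mul_inv]
  generalize (c * (τ : ℂ) + d)⁻¹ = J at hJ ⊢
  linear_combination (-c * (2 * (τ * x + y) + (τ ^ 2 * k1 + 2 * (τ * q) + k2)) -
    (a * τ + b) * (d ^ 2 * k1 - 2 * (c * d * q) + c ^ 2 * k2) - 2 * (d * x - c * y)) * hJ +
    (-τ * d * k1 + 2 * c * τ * q + c * k2) * hdet

end Slash

/-! ### The discriminant form -/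

namespace HalfIntegral

variable (F : HalfIntegral n)

theorem bil_add_left (r s t : Fin n → ℤ) : F.bil (r + s) t = F.bil r t + F.bil s t := by
  rw [bil, bil, bil, toReal_add, add_dotProduct]; ring

theorem B_symm (x y : F.D) : F.B x y = F.B y x := by
  rw [B, B, add_comm x y]; abel

theorem B_add_left (x y z : F.D) : F.B (x + y) z = F.B x z + F.B y z := by
  induction x using QuotientAddGroup.induction_on with
  | H r =>
  induction y using QuotientAddGroup.induction_on with
  | H s =>
  induction z using QuotientAddGroup.induction_on with
  | H t =>
  rw [← QuotientAddGroup.mk_add, B_mk, B_mk, B_mk, bil_add_left, AddCircle.coe_add]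

theorem B_add_right (x y z : F.D) : F.B x (y + z) = F.B x y + F.B x z := by
  rw [B_symm, B_add_left, B_symm, F.B_symm z]

theorem Q_zero : F.Q 0 = 0 := by
  have h : F.Q 0 = (F.qf 0 : UnitAddCircle) := F.Q_mk 0
  have h0 : F.qf 0 = 0 := by
    have : toReal (0 : Fin n → ℤ) = 0 := by funext i; simp [toReal]
    rw [qf, invForm, this]; simp
  rw [h, h0]; rfl

theorem B_zero_left (x : F.D) : F.B 0 x = 0 := by
  rw [B, zero_add, Q_zero]; abel

theorem B_neg_left (x y : F.D) : F.B (-x) y = -F.B x y := by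
  rw [eq_neg_iff_add_eq_zero, ← B_add_left, neg_add_cancel, B_zero_left]

/-- The bilinear form of `D_F` is nondegenerate. -/
theorem eq_zero_of_B {x : F.D} (h : ∀ y, eCircle (F.B x y) = 1) : x = 0 := by
  induction x using QuotientAddGroup.induction_on with
  | H r =>
  have h1 : ∀ i, ∃ k : ℤ, F.bil r (Pi.single i 1) = k := fun i => by
    rw [← e_eq_one_iff, ← eCircle_B_mk]; exact h _
  choose k hk using h1
  refine (QuotientAddGroup.eq_zero_iff r).mpr ⟨k, ?_⟩
  have h2 : F.mat⁻¹ *ᵥ toReal r = (2 : ℝ) • toReal k := by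
    funext i
    have h3 := hk i
    have h4 : toReal (Pi.single i 1 : Fin n → ℤ) = Pi.single i 1 := by
      funext j
      by_cases hj : j = i
      · subst hj; simp [toReal]
      · simp [toReal, hj]
    rw [bil_symm, bil, h4, single_dotProduct, one_mul] at h3
    simp only [Pi.smul_apply, toReal, smul_eq_mul] at h3 ⊢
    linarith
  have h5 := congrArg (fun v => F.mat *ᵥ v) h2
  simp only [Matrix.mulVec_mulVec] at h5
  rw [Matrix.mul_nonsing_inv _ F.isUnit_det, Matrix.one_mulVec, Matrix.mulVec_smul] at h5
  rw [h5, ← Nat.cast_smul_eq_nsmul ℝ, Matrix.smul_mulVec]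
  simp

/-- Classical decidability of equality on `D_F`, which matrices indexed by `D_F` require. -/
instance decidableEq_D : DecidableEq F.D := Classical.decEq _

/-- Orthogonality of the characters of `D_F`. -/
theorem sum_eCircle_B (x : F.D) :
    ∑ y, eCircle (F.B x y) = if x = 0 then (Fintype.card F.D : ℂ) else 0 := by
  split_ifs with h
  · simp [h, B_zero_left]
  · obtain ⟨y₀, hy₀⟩ : ∃ y, eCircle (F.B x y) ≠ 1 := by
      by_contra hc
      push Not at hc
      exact h (F.eq_zero_of_B hc)
    have h1 : ∑ y, eCircle (F.B x y) = eCircle (F.B x y₀) * ∑ y, eCircle (F.B x y) := by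
      rw [Finset.mul_sum]
      refine (Fintype.sum_equiv (Equiv.addLeft y₀) _ _ fun y => ?_).symm
      rw [Equiv.coe_addLeft, B_add_right, eCircle_add]
    have h2 : (eCircle (F.B x y₀) - 1) * ∑ y, eCircle (F.B x y) = 0 := by
      rw [sub_mul, one_mul, ← h1, sub_self]
    exact (mul_eq_zero.mp h2).resolve_left (sub_ne_zero.mpr hy₀)

theorem card_D_ne_zero : (Fintype.card F.D : ℂ) ≠ 0 := by
  exact_mod_cast Fintype.card_ne_zero

/-- The absolute value of the Gauss sum of `D_F`. -/
theorem gauss_sum_mul_conj :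
    (∑ x, eCircle (F.Q x)) * ∑ x, eCircle (-F.Q x) = Fintype.card F.D := by
  have h1 : (∑ x, eCircle (F.Q x)) * ∑ y, eCircle (-F.Q y) =
      ∑ x, eCircle (F.Q x) * ∑ y, eCircle (F.B x y) := by
    rw [Finset.sum_mul_sum, Finset.sum_comm]
    have h2 : ∀ y, ∑ x, eCircle (F.Q x) * eCircle (-F.Q y) =
        ∑ x, eCircle (F.Q x) * eCircle (F.B x y) := by
      intro y
      refine (Fintype.sum_equiv (Equiv.addRight y) _ _ fun x => ?_).symm
      rw [Equiv.coe_addRight, ← eCircle_add, ← eCircle_add, B]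
      congr 1; abel
    simp only [h2, Finset.mul_sum]
    exact Finset.sum_comm
  rw [h1]
  simp only [sum_eCircle_B]
  simp [Q_zero]

end HalfIntegral

/-! ### The matrices of the theta transformation -/

section ThetaMatrix

variable {V : Type*} [NormedAddCommGroup V] [NormedSpace ℂ V]

theorem slash_sum_smul (F : HalfIntegral n) (κ : ℤ) {ι : Type*} (s : Finset ι)
    (θ : ι → ℍ → (Fin n → ℂ) → ℂ) (v : ι → V) (α : Mp) (τ : ℍ) (z : Fin n → ℂ) :
    slash F κ (fun τ z => ∑ x ∈ s, θ x τ z • v x) α τ z =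
      ∑ x ∈ s, slash F κ (θ x) α τ z • v x := by
  simp only [slash, Finset.smul_sum, smul_smul, smul_eq_mul]

/-- `M` is the matrix through which `α` acts on the theta series: `θ_x|α = ∑_y M_{xy} θ_y`. -/
def IsThetaMatrix (F : HalfIntegral n) (α : Mp) (M : Matrix F.D F.D ℂ) : Prop :=
  ∀ x τ z, slash F (n : ℤ) (theta F x) α τ z = ∑ y, theta F y τ z • M x y

variable {F : HalfIntegral n} {α β : Mp} {M N : Matrix F.D F.D ℂ}

theorem IsThetaMatrix.unique (hM : IsThetaMatrix F α M) (hN : IsThetaMatrix F α N) : M = N := by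
  ext x y
  refine congrFun (theta_linearIndependent F UpperHalfPlane.I (a := M x) (b := N x) fun z => ?_) y
  rw [← hM, ← hN]

theorem IsThetaMatrix.one : IsThetaMatrix F 1 1 := by
  intro x τ z
  simp [slash_one, Matrix.one_apply]

theorem IsThetaMatrix.mul (hM : IsThetaMatrix F α M) (hN : IsThetaMatrix F β N) :
    IsThetaMatrix F (α * β) (M * N) := by
  intro x τ z
  have h1 : slash F (n : ℤ) (theta F x) α = fun τ z => ∑ y, theta F y τ z • M x y := by
    funext τ z; exact hM x τ z
  rw [slash_mul, h1, slash_sum_smul]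
  simp only [hN _ τ z, Matrix.mul_apply, Finset.smul_sum, Finset.sum_smul]
  rw [Finset.sum_comm]
  refine Finset.sum_congr rfl fun y _ => Finset.sum_congr rfl fun t _ => ?_
  simp only [smul_eq_mul]; ring

theorem IsThetaMatrix.inv (hM : IsThetaMatrix F α M) (hNM : N * M = 1) :
    IsThetaMatrix F α⁻¹ N := by
  intro x τ z
  have h1 : ∀ t, theta F t τ z = ∑ y, slash F (n : ℤ) (theta F y) α⁻¹ τ z • M t y := by
    intro t
    have h2 : slash F (n : ℤ) (theta F t) α = fun τ z => ∑ y, theta F y τ z • M t y := by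
      funext τ z; exact hM t τ z
    rw [← slash_sum_smul, ← h2, ← slash_mul, mul_inv_cancel, slash_one]
  simp only [h1, Finset.sum_smul]
  rw [Finset.sum_comm]
  have h3 : ∀ y, ∑ t, (slash F (n : ℤ) (theta F y) α⁻¹ τ z • M t y) • N x t =
      slash F (n : ℤ) (theta F y) α⁻¹ τ z * (N * M) x y := by
    intro y
    rw [Matrix.mul_apply, Finset.mul_sum]
    refine Finset.sum_congr rfl fun t _ => ?_
    simp only [smul_eq_mul]; ring
  simp only [h3, hNM, Matrix.one_apply, mul_ite, mul_one, mul_zero, Finset.sum_ite_eq,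
    Finset.mem_univ, if_true]

variable (F)

/-- The matrix of `(T, 1)` in the defining formulas of the Weil representation. -/
def matT : Matrix F.D F.D ℂ := Matrix.diagonal fun x => eCircle (F.Q x)

/-- The matrix of `(S, √τ)` in the defining formulas of the Weil representation. -/
def matS : Matrix F.D F.D ℂ := Matrix.of fun x y =>
  (gaussSigma F * ((Real.sqrt (Fintype.card F.D) : ℝ) : ℂ)⁻¹) * eCircle (-F.B y x)

theorem isThetaMatrix_T : IsThetaMatrix F Mp.T (matT F) := by
  intro x τ z
  rw [slash_T_theta]
  simp [matT, Matrix.diagonal_apply, mul_comm]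

theorem gaussSigma_mul : gaussSigma F * ((Real.sqrt (Fintype.card F.D) : ℝ) : ℂ)⁻¹ =
    (Fintype.card F.D : ℂ)⁻¹ * ∑ x, eCircle (-F.Q x) := by
  have h : ((Real.sqrt (Fintype.card F.D) : ℝ) : ℂ) * ((Real.sqrt (Fintype.card F.D) : ℝ) : ℂ) =
      (Fintype.card F.D : ℂ) := by
    rw [← Complex.ofReal_mul, Real.mul_self_sqrt (Nat.cast_nonneg _)]; simp
  rw [gaussSigma, ← h, mul_inv]; ring

/-- The inversion formula of the theta series. The value of its constant is forced by the relation
`TSTST = S`, which turns it into a Gauss sum. -/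
theorem isThetaMatrix_S : IsThetaMatrix F Mp.S (matS F) := by
  obtain ⟨C, hC, hS⟩ := exists_slash_S_theta F
  set N : Matrix F.D F.D ℂ := Matrix.of fun x y => C * eCircle (-F.B y x) with hN
  have hNS : IsThetaMatrix F Mp.S N := by
    intro x τ z
    rw [hS, Finset.mul_sum]
    refine Finset.sum_congr rfl fun y _ => ?_
    simp only [hN, Matrix.of_apply, smul_eq_mul]; ring
  have hT := isThetaMatrix_T F
  -- The entry at `(0, 0)` of this relation determines the constant `C`.
  have hrel : matT F * N * matT F * N * matT F = N := by
    have h := (((hT.mul hNS).mul hT).mul hNS).mul hT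
    rw [Mp.T_S_T_S_T] at h
    exact h.unique hNS
  have h1 : C * ∑ x, eCircle (F.Q x) = 1 := by
    have h2 := congrFun (congrFun hrel 0) 0
    simp only [matT] at h2
    rw [Matrix.mul_diagonal, Matrix.mul_apply] at h2
    simp only [Matrix.mul_diagonal, Matrix.diagonal_mul, hN, Matrix.of_apply, F.Q_zero,
      F.B_symm _ 0, F.B_zero_left, neg_zero, eCircle_zero, mul_one, one_mul] at h2
    rw [← Finset.sum_mul, ← Finset.mul_sum] at h2
    refine mul_left_cancel₀ hC ?_
    linear_combination h2
  have h3 : C = gaussSigma F * ((Real.sqrt (Fintype.card F.D) : ℝ) : ℂ)⁻¹ := by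
    have h4 := F.gauss_sum_mul_conj
    have h5 := F.card_D_ne_zero
    rw [gaussSigma_mul, eq_inv_mul_iff_mul_eq₀ h5]
    linear_combination (-C) * h4 + (∑ x, eCircle (-F.Q x)) * h1
  have h6 : matS F = N := by
    ext x y; simp only [matS, hN, Matrix.of_apply, h3]
  rwa [h6]

/-- The constant in the action of `S` has absolute value `|D_F|^{-1/2}`. -/
theorem star_mul_self_gauss : star (gaussSigma F * ((Real.sqrt (Fintype.card F.D) : ℝ) : ℂ)⁻¹) *
    (gaussSigma F * ((Real.sqrt (Fintype.card F.D) : ℝ) : ℂ)⁻¹) = (Fintype.card F.D : ℂ)⁻¹ := by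
  have h4 := F.gauss_sum_mul_conj
  have h5 := F.card_D_ne_zero
  rw [gaussSigma_mul, star_mul', star_sum]
  simp only [star_eCircle, neg_neg, star_inv₀, star_natCast]
  rw [mul_mul_mul_comm, h4]
  field_simp

theorem matT_mem : matT F ∈ Matrix.unitaryGroup F.D ℂ := by
  rw [Matrix.mem_unitaryGroup_iff, matT, Matrix.star_eq_conjTranspose,
    Matrix.diagonal_conjTranspose, Matrix.diagonal_mul_diagonal, ← Matrix.diagonal_one]
  congr 1
  funext x
  rw [Pi.star_apply, star_eCircle, ← eCircle_add, add_neg_cancel, eCircle_zero]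

theorem matS_mem : matS F ∈ Matrix.unitaryGroup F.D ℂ := by
  rw [Matrix.mem_unitaryGroup_iff]
  ext x y
  rw [Matrix.mul_apply, Matrix.one_apply]
  have h : ∀ t, matS F x t * (star (matS F)) t y =
      (Fintype.card F.D : ℂ)⁻¹ * eCircle (F.B (y - x) t) := by
    intro t
    rw [Matrix.star_apply, matS, Matrix.of_apply, Matrix.of_apply, star_mul', star_eCircle, neg_neg,
      ← star_mul_self_gauss, sub_eq_add_neg, F.B_add_left, F.B_neg_left, eCircle_add,
      F.B_symm t x, F.B_symm t y]
    ring
  simp only [h]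
  rw [← Finset.mul_sum, F.sum_eCircle_B]
  by_cases hxy : x = y
  · simp [hxy]
  · simp [hxy, sub_eq_zero, Ne.symm hxy]

theorem exists_isThetaMatrix (α : Mp) :
    ∃ M ∈ Matrix.unitaryGroup F.D ℂ, IsThetaMatrix F α M := by
  have hα : α ∈ Subgroup.closure ({Mp.T, Mp.S} : Set Mp) := Mp.closure_T_S ▸ Subgroup.mem_top _
  induction hα using Subgroup.closure_induction with
  | mem x hx =>
    rcases hx with rfl | rfl
    · exact ⟨_, matT_mem F, isThetaMatrix_T F⟩
    · exact ⟨_, matS_mem F, isThetaMatrix_S F⟩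
  | one => exact ⟨1, one_mem _, IsThetaMatrix.one⟩
  | mul x y _ _ hx hy =>
    obtain ⟨M, hM, hM'⟩ := hx
    obtain ⟨N, hN, hN'⟩ := hy
    exact ⟨M * N, mul_mem hM hN, hM'.mul hN'⟩
  | inv x _ hx =>
    obtain ⟨M, hM, hM'⟩ := hx
    exact ⟨star M, Unitary.star_mem hM, hM'.inv (Matrix.mem_unitaryGroup_iff'.mp hM)⟩

/-- The matrix representation of `Mp` on the theta series. For the column vector `θ` of the
theta series and `M_α` its matrix, `(θ|α)|β = M_α (θ|β) = M_α M_β θ`, so `α ↦ M_α` is a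
homomorphism. -/
def weilMatrix : Mp →* Matrix F.D F.D ℂ where
  toFun α := (exists_isThetaMatrix F α).choose
  map_one' := (exists_isThetaMatrix F 1).choose_spec.2.unique IsThetaMatrix.one
  map_mul' α β := (exists_isThetaMatrix F (α * β)).choose_spec.2.unique
    ((exists_isThetaMatrix F α).choose_spec.2.mul (exists_isThetaMatrix F β).choose_spec.2)

theorem isThetaMatrix_weilMatrix (α : Mp) : IsThetaMatrix F α (weilMatrix F α) :=
  (exists_isThetaMatrix F α).choose_spec.2

theorem weilMatrix_mem (α : Mp) : weilMatrix F α ∈ Matrix.unitaryGroup F.D ℂ :=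
  (exists_isThetaMatrix F α).choose_spec.1

end ThetaMatrix

/-! ### The Weil representation -/

section Weil

variable (F : HalfIntegral n)

/-- The representation of `Mp` with the matrices `weilMatrix F`. -/
def thetaRep : Representation ℂ Mp (F.D →₀ ℂ) :=
  (Matrix.toLinAlgEquiv (Finsupp.basisSingleOne (R := ℂ) (ι := F.D))).toAlgHom.toMonoidHom.comp
    (weilMatrix F)

theorem thetaRep_single (α : Mp) (y : F.D) :
    thetaRep F α (Finsupp.single y 1) = ∑ x, weilMatrix F α x y • Finsupp.single x 1 := by
  have h := Matrix.toLinAlgEquiv_self (Finsupp.basisSingleOne (R := ℂ) (ι := F.D))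
    (weilMatrix F α) y
  change (Matrix.toLinAlgEquiv (Finsupp.basisSingleOne (R := ℂ) (ι := F.D)) (weilMatrix F α))
    (Finsupp.single y 1) = _
  simpa using h

theorem isWeilAction_thetaRep : IsWeilAction F (thetaRep F) := by
  constructor
  · intro x
    rw [thetaRep_single, (isThetaMatrix_weilMatrix F Mp.T).unique (isThetaMatrix_T F)]
    simp [matT, Matrix.diagonal_apply]
  · intro x
    rw [thetaRep_single, (isThetaMatrix_weilMatrix F Mp.S).unique (isThetaMatrix_S F),
      Finset.smul_sum]
    refine Finset.sum_congr rfl fun y _ => ?_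
    rw [matS, Matrix.of_apply, mul_smul, F.B_symm]

theorem IsWeilAction.unique {W W' : Representation ℂ Mp (F.D →₀ ℂ)} (h : IsWeilAction F W)
    (h' : IsWeilAction F W') : W = W' := by
  refine MonoidHom.eq_of_eqOn_dense Mp.closure_T_S ?_
  rintro _ (rfl | rfl)
  · refine Finsupp.lhom_ext' fun x => LinearMap.ext_ring ?_
    exact (h.1 x).trans (h'.1 x).symm
  · refine Finsupp.lhom_ext' fun x => LinearMap.ext_ring ?_
    exact (h.2 x).trans (h'.2 x).symm

theorem isWeilAction_weilRep : IsWeilAction F (weilRep F) :=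
  Classical.epsilon_spec ⟨_, isWeilAction_thetaRep F⟩

theorem weilRep_single (α : Mp) (y : F.D) :
    weilRep F α (Finsupp.single y 1) = ∑ x, weilMatrix F α x y • Finsupp.single x 1 := by
  rw [IsWeilAction.unique F (isWeilAction_weilRep F) (isWeilAction_thetaRep F), thetaRep_single]

end Weil

/-! ### Theta decomposition -/

section GeneralizedFourier

variable {ι : Type*} {l : ι → ℝ} {c : ι → ℂ}

/-- On a half plane `Im τ ≥ δ`, the terms of a Fourier series with nonnegative frequencies are
largest at `iδ`. -/
theorem norm_e_mul_le (hl : ∀ i, c i ≠ 0 → 0 ≤ l i) {δ : ℝ} {τ : ℂ} (hδ : δ ≤ τ.im) (i : ι) :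
    ‖e (l i * τ) * c i‖ ≤ ‖e (l i * (δ * Complex.I)) * c i‖ := by
  by_cases hc : c i = 0
  · simp [hc]
  · rw [norm_mul, norm_mul, norm_e, norm_e]
    refine mul_le_mul_of_nonneg_right (Real.exp_le_exp.mpr ?_) (norm_nonneg _)
    have h1 : ((l i : ℂ) * τ).im = l i * τ.im := by simp
    have h2 : ((l i : ℂ) * (δ * Complex.I)).im = l i * δ := by simp
    rw [h1, h2, neg_le_neg_iff]
    exact mul_le_mul_of_nonneg_left (mul_le_mul_of_nonneg_left hδ (hl i hc)) (by positivity)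

theorem summable_norm_e_mul (hs : ∀ τ : ℍ, Summable fun i => e (l i * τ) * c i) {δ : ℝ}
    (hδ : 0 < δ) : Summable fun i => ‖e (l i * (δ * Complex.I)) * c i‖ :=
  (hs ⟨δ * Complex.I, by simpa using hδ⟩).norm

/-- A generalized Fourier series with nonnegative real frequencies is holomorphic on the upper half
plane. -/
theorem mdifferentiable_tsum_e (hl : ∀ i, c i ≠ 0 → 0 ≤ l i)
    (hs : ∀ τ : ℍ, Summable fun i => e (l i * τ) * c i) :
    MDiff (fun τ : ℍ => ∑' i, e (l i * τ) * c i) := by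
  rw [UpperHalfPlane.mdifferentiable_iff]
  intro τ hτ
  have hτ' : 0 < τ.im := hτ
  have ho : IsOpen {τ' : ℂ | τ.im / 2 < τ'.im} := isOpen_lt continuous_const Complex.continuous_im
  have hd : DifferentiableOn ℂ (fun τ' : ℂ => ∑' i, e (l i * τ') * c i)
      {τ' : ℂ | τ.im / 2 < τ'.im} := by
    refine Complex.differentiableOn_tsum_of_summable_norm (summable_norm_e_mul hs (half_pos hτ'))
      (fun i => ?_) ho (fun i τ' hτ' => norm_e_mul_le hl (le_of_lt hτ') i)
    unfold e
    fun_prop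
  refine (((hd.differentiableAt (ho.mem_nhds (half_lt_self hτ')))).congr_of_eventuallyEq
    ?_).differentiableWithinAt
  filter_upwards [isOpen_lt continuous_const Complex.continuous_im |>.mem_nhds hτ] with y hy
  simp [UpperHalfPlane.ofComplex_apply_of_im_pos hy]

theorem isBoundedAtImInfty_tsum_e (hl : ∀ i, c i ≠ 0 → 0 ≤ l i)
    (hs : ∀ τ : ℍ, Summable fun i => e (l i * τ) * c i) :
    UpperHalfPlane.IsBoundedAtImInfty (fun τ : ℍ => ∑' i, e (l i * τ) * c i) := by
  rw [UpperHalfPlane.isBoundedAtImInfty_iff]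
  refine ⟨∑' i, ‖e (l i * ((1 : ℝ) * Complex.I)) * c i‖, 1, fun τ hτ => ?_⟩
  exact tsum_of_norm_bounded (summable_norm_e_mul hs one_pos).hasSum
    fun i => norm_e_mul_le hl hτ i

end GeneralizedFourier

section ThetaDecomposition

variable {F : HalfIntegral n} {ψ : ℍ → (Fin n → ℂ) → ℂ}

/-- A function with a Fourier expansion is a series `∑ᵣ ϑᵣ(τ,z) aᵣ(τ)` with coefficients that
are holomorphic and bounded at the cusp. -/
theorem HasJacobiExpansion.exists_hasSum_thetaTerm (h : HasJacobiExpansion F ψ) :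
    ∃ a : (Fin n → ℤ) → ℍ → ℂ, (∀ r, MDiff (a r)) ∧
      (∀ r, UpperHalfPlane.IsBoundedAtImInfty (a r)) ∧
      ∀ (τ : ℍ) z, HasSum (fun r => thetaTerm F r τ z * a r τ) (ψ τ z) := by
  obtain ⟨c, hc, hs⟩ := h
  -- The condition on the support of `c` makes the frequencies `l - ¼F⁻¹[r]` of `aᵣ` nonnegative.
  have hl : ∀ r (l : ℚ), c l r ≠ 0 → 0 ≤ (l : ℝ) - F.qf r := fun r l hne => by
    have := hc l r hne
    rw [HalfIntegral.qf]; linarith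
  have hsum : ∀ r (τ : ℍ), Summable fun l : ℚ => e ((((l : ℝ) - F.qf r : ℝ) : ℂ) * τ) * c l r := by
    intro r τ
    have h1 : Summable fun l : ℚ => (e ((l : ℂ) * (τ : ℂ)) * e ((0 : Fin n → ℂ) ⬝ᵥ
        fun i => (r i : ℂ))) • c l r :=
      (hs τ 0).summable.comp_injective (i := fun l : ℚ => (l, r)) fun x y hxy =>
        congrArg Prod.fst hxy
    refine (h1.mul_left (e (-(F.qf r : ℂ) * τ))).congr fun l => ?_
    rw [zero_dotProduct, e_zero, mul_one, smul_eq_mul, ← mul_assoc, ← e_add]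
    congr 2
    push_cast
    ring
  refine ⟨fun r τ => ∑' l : ℚ, e ((((l : ℝ) - F.qf r : ℝ) : ℂ) * τ) * c l r,
    fun r => mdifferentiable_tsum_e (l := fun l : ℚ => (l : ℝ) - F.qf r) (c := fun l => c l r)
      (hl r) (hsum r),
    fun r => isBoundedAtImInfty_tsum_e (l := fun l : ℚ => (l : ℝ) - F.qf r)
      (c := fun l => c l r) (hl r) (hsum r), fun τ z => ?_⟩
  have h2 : HasSum (fun p : (Fin n → ℤ) × ℚ => thetaTerm F p.1 τ z *
      (e ((((p.2 : ℝ) - F.qf p.1 : ℝ) : ℂ) * τ) * c p.2 p.1)) (ψ τ z) := by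
    refine hasSum_of_eq ((Equiv.prodComm (Fin n → ℤ) ℚ).hasSum_iff.mpr (hs τ z)) fun p => ?_
    simp only [Function.comp_apply, Equiv.prodComm_apply, Prod.fst_swap, Prod.snd_swap,
      smul_eq_mul]
    rw [thetaTerm, ← mul_assoc, ← e_add, ← e_add, dotProduct_comm]
    refine congrArg (fun t => e t * c p.2 p.1) ?_
    change τ * (F.qf p.1 : ℂ) + z ⬝ᵥ toComplex p.1 + _ = _ + z ⬝ᵥ toComplex p.1
    push_cast
    ring
  have h3 : ∀ r, HasSum (fun l : ℚ => thetaTerm F r τ z *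
      (e ((((l : ℝ) - F.qf r : ℝ) : ℂ) * τ) * c l r))
      (thetaTerm F r τ z * ∑' l : ℚ, e ((((l : ℝ) - F.qf r : ℝ) : ℂ) * τ) * c l r) :=
    fun r => HasSum.mul_left _ (hsum r τ).hasSum
  exact HasSum.prod_fiberwise h2 h3

/-- A function with a Fourier expansion that is invariant under the Heisenberg group is a
combination of the theta series with coefficients that depend on `τ` only. -/
theorem HasJacobiExpansion.exists_theta_decomposition (h : HasJacobiExpansion F ψ)
    (hH : ∀ l : Fin n → ℤ, heisSlash F ψ l 0 = ψ) :
    ∃ a : F.D → ℍ → ℂ, (∀ x, MDiff (a x)) ∧ (∀ x, UpperHalfPlane.IsBoundedAtImInfty (a x)) ∧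
      ∀ τ z, ψ τ z = ∑ x, theta F x τ z • a x τ := by
  obtain ⟨a, ha1, ha2, hs⟩ := h.exists_hasSum_thetaTerm
  -- Comparing the Fourier coefficients of `ψ` and `ψ|[l,0]`, for fixed `τ`, shows that `aᵣ` depends
  -- only on the class of `r` in `D_F`.
  have key : ∀ (l r : Fin n → ℤ) (τ : ℍ), a (r + F.gram *ᵥ l) τ = a r τ := by
    intro l r τ
    have h1 : ∀ z, HasSum (fun r => thetaTerm F (r + F.gram *ᵥ l) τ z * a r τ) (ψ τ z) := by
      intro z
      have h2 := congrFun (congrFun (hH l) τ) z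
      rw [← h2]
      refine hasSum_of_eq ((hs τ _).mul_left _) fun r => ?_
      rw [← mul_assoc]
      congr 1
      exact (thetaTerm_heis F r l 0 τ z).symm
    have h3 : ∀ z, HasSum (fun r => thetaTerm F (r + F.gram *ᵥ l) τ z *
        (a (r + F.gram *ᵥ l) τ - a r τ)) 0 := by
      intro z
      have h4 := ((Equiv.addRight (F.gram *ᵥ l)).hasSum_iff.mpr (hs τ z)).sub (h1 z)
      rw [sub_self] at h4
      exact hasSum_of_eq h4 fun r => by simp [mul_sub]
    have h5 : ∀ z, HasSum (fun r => thetaTerm F r τ z * (a r τ - a (r - F.gram *ᵥ l) τ)) 0 := by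
      intro z
      have h4 := (Equiv.subRight (F.gram *ᵥ l)).hasSum_iff.mpr (h3 z)
      exact hasSum_of_eq h4 fun r => by simp
    have h6 : ∀ r z, thetaTerm F r τ z = thetaTerm F r τ 0 * e (toComplex r ⬝ᵥ z) := by
      intro r z
      rw [thetaTerm, thetaTerm, dotProduct_zero, add_zero, e_add]
    have h7 := fourier_coeff_eq_zero (h5 0).summable (fun x =>
      hasSum_of_eq (h5 (realToComplex x)) fun r => by rw [h6 r (realToComplex x)]; ring)
      (r + F.gram *ᵥ l)
    rw [add_sub_cancel_right] at h7
    rcases mul_eq_zero.mp h7 with h8 | h8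
    · exact absurd h8 (e_ne_zero _)
    · exact sub_eq_zero.mp h8
  refine ⟨fun x => a x.out, fun x => ha1 _, fun x => ha2 _, fun τ z => ?_⟩
  refine HasSum.unique (hs τ z) (hasSum_of_eq (hasSum_theta_smul F (fun x => a x.out τ) τ z) ?_)
  intro r
  rw [smul_eq_mul]
  congr 1
  have h1 : -(QuotientAddGroup.mk r : F.D).out + r ∈ F.lattice := by
    exact QuotientAddGroup.eq.mp (QuotientAddGroup.out_eq' (QuotientAddGroup.mk r : F.D))
  obtain ⟨m, hm⟩ := F.mem_lattice_iff.mp h1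
  have h2 := key m (QuotientAddGroup.mk r : F.D).out τ
  rw [← hm, add_neg_cancel_left] at h2
  exact h2

end ThetaDecomposition

/-! ### Constancy of the theta coefficients -/

/-- A finite family of holomorphic functions on the upper half plane that is periodic, bounded at
the cusp and has an `SL(2, ℤ)`-invariant Hermitian norm is constant: every value of the norm is
attained on `Im τ ≥ 1/2`, which the parameter `exp(2πiτ/N)` maps into a compact part of the unit
disc, so that the maximum principle applies. -/
theorem eq_const_of_norm_invariant {ι : Type*} [Fintype ι] {H : ι → ℍ → ℂ}
    (hd : ∀ i, MDiff (H i)) (hb : ∀ i, UpperHalfPlane.IsBoundedAtImInfty (H i)) {N : ℕ}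
    (hN : 0 < N) (hper : ∀ i (τ : ℍ), H i ((N : ℝ) +ᵥ τ) = H i τ)
    (hinv : ∀ (A : SL(2, ℤ)) (τ : ℍ), ∑ i, ‖H i (A • τ)‖ ^ 2 = ∑ i, ‖H i τ‖ ^ 2) :
    ∃ v : ι → ℂ, ∀ i τ, H i τ = v i := by
  have hN' : (0 : ℝ) < N := Nat.cast_pos.mpr hN
  have hper' : ∀ i, Function.Periodic (H i ∘ UpperHalfPlane.ofComplex) ((N : ℝ) : ℂ) := by
    intro i w
    by_cases hw : 0 < w.im
    · have hw' : 0 < (w + ((N : ℝ) : ℂ)).im := by simpa using hw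
      rw [Function.comp_apply, Function.comp_apply,
        UpperHalfPlane.ofComplex_apply_of_im_pos hw,
        UpperHalfPlane.ofComplex_apply_of_im_pos hw', ← hper i ⟨w, hw⟩]
      congr 1
      ext1
      simp [add_comm]
    · have hw' : ¬ 0 < (w + ((N : ℝ) : ℂ)).im := by simpa using hw
      rw [Function.comp_apply, Function.comp_apply,
        UpperHalfPlane.ofComplex_apply_of_im_nonpos (not_lt.mp hw),
        UpperHalfPlane.ofComplex_apply_of_im_nonpos (not_lt.mp hw')]
  set G : ℂ → EuclideanSpace ℂ ι := fun q =>
    WithLp.toLp 2 fun i => UpperHalfPlane.cuspFunction (N : ℝ) (H i) q with hG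
  have hGd : DifferentiableOn ℂ G (Metric.ball 0 1) := by
    rw [differentiableOn_euclidean]
    exact fun i => UpperHalfPlane.differentiableOn_cuspFunction_ball hN' (hper' i) (hd i) (hb i)
  have hGτ : ∀ (τ : ℍ) i, G (Function.Periodic.qParam N τ) i = H i τ := fun τ i =>
    UpperHalfPlane.eq_cuspFunction τ hN'.ne' (hper' i)
  have hnorm : ∀ τ : ℍ, ‖G (Function.Periodic.qParam N τ)‖ = √(∑ i, ‖H i τ‖ ^ 2) := by
    intro τ
    rw [EuclideanSpace.norm_eq]
    simp only [hGτ]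
  have hq : ∀ τ : ℍ, ‖Function.Periodic.qParam N τ‖ = Real.exp (-2 * Real.pi * τ.im / N) :=
    fun τ => Function.Periodic.norm_qParam _ _
  have hr : Real.exp (-Real.pi / N) < 1 := by
    rw [Real.exp_lt_one_iff]
    exact div_neg_of_neg_of_pos (neg_neg_of_pos Real.pi_pos) hN'
  have hconst := Complex.eq_const_of_exists_le hGd (Real.exp_pos (-Real.pi / N)).le hr (by
    intro q hqb
    rw [mem_ball_zero_iff] at hqb
    by_cases hq0 : q = 0
    · exact ⟨0, by simp [(Real.exp_pos _).le], by rw [hq0]⟩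
    · set τ : ℍ := ⟨_, Function.Periodic.im_invQParam_pos_of_norm_lt_one hN' hqb hq0⟩ with hτ
      have hqτ : Function.Periodic.qParam N τ = q := Function.Periodic.qParam_right_inv hN'.ne' hq0
      obtain ⟨A, hA⟩ := ModularGroup.exists_one_half_le_im_smul τ
      refine ⟨Function.Periodic.qParam N (A • τ : ℍ), ?_, ?_⟩
      · rw [mem_closedBall_zero_iff, hq, Real.exp_le_exp]
        gcongr
        nlinarith [Real.pi_pos]
      · rw [← hqτ, hnorm, hnorm, hinv])
  refine ⟨fun i => G 0 i, fun i τ => ?_⟩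
  have hmem : Function.Periodic.qParam N τ ∈ Metric.ball (0 : ℂ) 1 := by
    rw [mem_ball_zero_iff, hq, Real.exp_lt_one_iff]
    refine div_neg_of_neg_of_pos ?_ hN'
    nlinarith [Real.pi_pos, τ.im_pos, mul_pos Real.pi_pos τ.im_pos]
  rw [← hGτ, hconst hmem]
  rfl

/-- Unitary matrices preserve the norm of row vectors. -/
theorem sum_norm_sq_vecMul {ι : Type*} [Fintype ι] [DecidableEq ι] {M : Matrix ι ι ℂ}
    (hM : M ∈ Matrix.unitaryGroup ι ℂ) (a : ι → ℂ) :
    ∑ y, ‖∑ x, M x y * a x‖ ^ 2 = ∑ x, ‖a x‖ ^ 2 := by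
  have h : ∀ b : ι → ℂ, ((∑ x, ‖b x‖ ^ 2 : ℝ) : ℂ) = b ⬝ᵥ star b := by
    intro b
    simp [dotProduct, Complex.mul_conj']
  have h1 : (fun y => ∑ x, M x y * a x) = a ᵥ* M := by
    funext y
    simp [Matrix.vecMul, dotProduct, mul_comm]
  apply Complex.ofReal_injective
  rw [h, h a, h1, Matrix.star_vecMul, Matrix.dotProduct_mulVec, Matrix.vecMul_vecMul,
    ← Matrix.star_eq_conjTranspose, Matrix.mem_unitaryGroup_iff.mp hM, Matrix.vecMul_one]

theorem Mp.exists_mat_eq (A : SL(2, ℤ)) : ∃ α : Mp, α.mat = A := by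
  have h : Mp.matHom.range = ⊤ := by
    rw [eq_top_iff, ← SpecialLinearGroup.SL2Z_generators, Subgroup.closure_le]
    rintro _ (rfl | rfl)
    · exact ⟨Mp.S, rfl⟩
    · exact ⟨Mp.T, rfl⟩
  exact MonoidHom.range_eq_top.mp h A

/-- Some power of `T` acts trivially on the theta series, because the values of `Q` have a common
denominator. -/
theorem exists_weilMatrix_T_pow (F : HalfIntegral n) :
    ∃ N : ℕ, 0 < N ∧ weilMatrix F (Mp.T ^ N) = 1 := by
  obtain ⟨N, hN, h⟩ := F.exists_denominator
  refine ⟨N, hN, ?_⟩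
  rw [map_pow, (isThetaMatrix_weilMatrix F Mp.T).unique (isThetaMatrix_T F), matT,
    Matrix.diagonal_pow, ← Matrix.diagonal_one]
  congr 1
  funext x
  induction x using QuotientAddGroup.induction_on with
  | H r =>
    obtain ⟨k, hk⟩ := h r
    rw [Pi.pow_apply, F.eCircle_Q_mk, ← (e_eq_one_iff (x := N * F.qf r)).mpr ⟨k, hk⟩, e, e,
      ← Complex.exp_nat_mul]
    congr 1
    push_cast
    ring

section Constancy

variable {F : HalfIntegral n} {φ : ℍ → (Fin n → ℂ) → ℂ}

/-- The theta coefficients of all functions `φ|g` are constant, provided that `φ` is invariant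
under a normal subgroup of finite index. The coefficients of the finitely many functions `φ|g`
form a vector on which `Mp` acts through a unitary representation. -/
theorem exists_slash_eq_sum_theta (Γ' : Subgroup Mp) [Γ'.Normal] [Γ'.FiniteIndex]
    (hinv : ∀ γ ∈ Γ', slash F n φ γ = φ) (hexp : ∀ g, HasJacobiExpansion F (slash F n φ g))
    (hH : ∀ l m, heisSlash F φ l m = φ) (g : Mp) :
    ∃ v : F.D → ℂ, ∀ τ z, slash F n φ g τ z = ∑ x, theta F x τ z • v x := by
  choose h hd hb hs using fun g => (hexp g).exists_theta_decomposition
    fun l => by rw [heisSlash_slash, hH]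
  -- The coefficients of `φ|gα` and of `φ|g`: the weight and the exponential factor are carried by
  -- the theta series.
  have htrans : ∀ g α y τ, h (g * α) y τ =
      ∑ x, weilMatrix F α x y * h g x (α.mat • τ) := by
    intro g α y τ
    refine congrFun (theta_linearIndependent F τ (a := fun y => h (g * α) y τ)
      (b := fun y => ∑ x, weilMatrix F α x y * h g x (α.mat • τ)) fun z => ?_) y
    have h1 : slash F n φ g = fun τ z => ∑ x, theta F x τ z • h g x τ := by
      funext τ z; exact hs g τ z
    rw [← hs, slash_mul, h1]
    refine (slash_sum_smul F n Finset.univ (theta F) (fun x => h g x (α.mat • τ)) α τ z).trans ?_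
    simp only [isThetaMatrix_weilMatrix F α _ τ z, smul_eq_mul, Finset.sum_mul, Finset.mul_sum,
      mul_assoc]
    exact Finset.sum_comm
  -- The coefficients depend only on the coset of `g`; here the normality of `Γ'` enters.
  have hcoset : ∀ g g' : Mp, (g : Mp ⧸ Γ') = g' → h g = h g' := by
    intro g g' hgg
    have h1 : g * (g⁻¹ * g') * g⁻¹ ∈ Γ' :=
      Subgroup.Normal.conj_mem inferInstance _ (QuotientGroup.eq.mp hgg) g
    have h2 : slash F n φ g' = slash F n φ g := by
      have h3 : g' = g * (g⁻¹ * g') * g⁻¹ * g := by group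
      rw [h3, slash_mul, hinv _ h1]
    funext x τ
    refine congrFun (theta_linearIndependent F τ (a := fun x => h g x τ)
      (b := fun x => h g' x τ) fun z => ?_) x
    rw [← hs, ← hs, h2]
  have : Finite (Mp ⧸ Γ') := Subgroup.finite_quotient_of_finiteIndex
  have : Fintype (Mp ⧸ Γ') := Fintype.ofFinite _
  obtain ⟨N, hN, hTN⟩ := exists_weilMatrix_T_pow F
  have hperiod : ∀ g x (τ : ℍ), h g x (((N * Γ'.index : ℕ) : ℝ) +ᵥ τ) = h g x τ := by
    intro g x τ
    have h1 : h (g * Mp.T ^ (N * Γ'.index)) = h g := by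
      refine hcoset _ _ (QuotientGroup.eq.mpr ?_)
      rw [mul_inv_rev, inv_mul_cancel_right, pow_mul, inv_mem_iff]
      exact Γ'.pow_index_mem _
    have h2 := htrans g (Mp.T ^ (N * Γ'.index)) x τ
    have h3 : (Mp.T ^ (N * Γ'.index)).mat • τ = ((N * Γ'.index : ℕ) : ℝ) +ᵥ τ := by
      have h4 := map_pow Mp.matHom Mp.T (N * Γ'.index)
      have h5 := UpperHalfPlane.modular_T_zpow_smul τ ((N * Γ'.index : ℕ) : ℤ)
      rw [zpow_natCast, Int.cast_natCast] at h5
      rw [← h5]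
      exact congrArg (· • τ) h4
    rw [h1, h3, pow_mul, map_pow, hTN, one_pow] at h2
    rw [h2]
    simp [Matrix.one_apply]
  obtain ⟨v, hv⟩ := eq_const_of_norm_invariant
    (H := fun (p : (Mp ⧸ Γ') × F.D) τ => h p.1.out p.2 τ) (N := N * Γ'.index)
    (fun p => hd _ _) (fun p => hb _ _)
    (Nat.mul_pos hN (Nat.pos_of_ne_zero Subgroup.FiniteIndex.index_ne_zero))
    (fun p τ => hperiod _ _ τ) (by
      intro A τ
      obtain ⟨α, rfl⟩ := Mp.exists_mat_eq A
      rw [Fintype.sum_prod_type, Fintype.sum_prod_type,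
        ← Equiv.sum_comp (Equiv.mulRight (α : Mp ⧸ Γ')) fun q => ∑ x, ‖h q.out x τ‖ ^ 2]
      refine Finset.sum_congr rfl fun q _ => ?_
      have h1 : h (q * (α : Mp ⧸ Γ')).out = h (q.out * α) := by
        refine hcoset _ _ ?_
        rw [QuotientGroup.out_eq', QuotientGroup.mk_mul, QuotientGroup.out_eq']
      rw [Equiv.coe_mulRight, h1]
      simp only [htrans]
      exact (sum_norm_sq_vecMul (weilMatrix_mem F α) _).symm)
  refine ⟨fun x => v ((g : Mp ⧸ Γ'), x), fun τ z => ?_⟩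
  rw [hs, hcoset g (g : Mp ⧸ Γ').out (QuotientGroup.out_eq' _).symm]
  exact Finset.sum_congr rfl fun x _ => congrArg _ (hv ((g : Mp ⧸ Γ'), x) τ)

end Constancy

/-! ### Jacobi forms of critical weight as combinations of theta series -/

section Critical

variable {V : Type*} [NormedAddCommGroup V] [NormedSpace ℂ V]
variable {Γ : Subgroup Mp} {F : HalfIntegral n} {κ : ℤ} {ρ : Representation ℂ Γ V}
  {φ : ℍ → (Fin n → ℂ) → V}

theorem heisSlash_zero (F : HalfIntegral n) (φ : ℍ → (Fin n → ℂ) → V) :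
    heisSlash F φ 0 0 = φ := by
  funext τ z
  have h : (fun i => (((0 : Fin n → ℤ) i : ℤ) : ℂ)) = 0 := by funext i; simp
  simp only [heisSlash, h]
  simp [e_zero]

theorem IsJacobiForm.slash_eq (h : IsJacobiForm F κ ρ φ) (γ : Γ) (τ : ℍ) (z : Fin n → ℂ) :
    slash F κ φ γ τ z = ρ γ (φ τ z) := by
  rw [← h.transform γ 0 0, heisSlash_zero]

theorem IsJacobiForm.heisSlash_eq (h : IsJacobiForm F κ ρ φ) (l m : Fin n → ℤ) :
    heisSlash F φ l m = φ := by
  funext τ z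
  have h1 := h.transform 1 l m τ z
  rwa [OneMemClass.coe_one, slash_one, map_one] at h1

theorem HasJacobiExpansion.map {V' : Type*} [NormedAddCommGroup V'] [NormedSpace ℂ V']
    (h : HasJacobiExpansion F φ) (f : V →L[ℂ] V') :
    HasJacobiExpansion F fun τ z => f (φ τ z) := by
  obtain ⟨c, hc, hs⟩ := h
  refine ⟨fun l r => f (c l r), fun l r hne => hc l r fun h0 => hne (by simp [h0]), fun τ z => ?_⟩
  simpa [Function.comp_def] using f.hasSum (hs τ z)

/-- A representation of a subgroup of finite index with finite image is trivial on a normal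
subgroup of finite index of the whole group. -/
theorem exists_normal_le_ker [Γ.FiniteIndex] (hρ : (Set.range ρ).Finite) :
    ∃ Γ' : Subgroup Mp, Γ'.Normal ∧ Γ'.FiniteIndex ∧ ∀ γ ∈ Γ', ∃ h : γ ∈ Γ, ρ ⟨γ, h⟩ = 1 := by
  have h1 : ρ.ker.FiniteIndex := by
    have h2 : Finite (MonoidHom.toHomUnits ρ).range := by
      refine Set.Finite.of_finite_image (f := Units.val) (hρ.subset ?_) Units.val_injective.injOn
      rintro _ ⟨_, ⟨g, rfl⟩, rfl⟩
      exact ⟨g, rfl⟩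
    rw [← MonoidHom.ker_toHomUnits]
    exact Subgroup.finiteIndex_ker _
  have h3 : (ρ.ker.map Γ.subtype).FiniteIndex := ⟨by
    rw [Subgroup.index_map_subtype]
    exact mul_ne_zero h1.index_ne_zero Subgroup.FiniteIndex.index_ne_zero⟩
  refine ⟨(ρ.ker.map Γ.subtype).normalCore, inferInstance, inferInstance, fun γ hγ => ?_⟩
  obtain ⟨δ, hδ, rfl⟩ := Subgroup.normalCore_le _ hγ
  exact ⟨δ.2, hδ⟩

/-- A Jacobi form of critical weight is a combination of the theta series with constant
coefficients. -/
theorem IsJacobiForm.exists_eq_sum_theta [Γ.FiniteIndex] [FiniteDimensional ℂ V]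
    (h : IsJacobiForm F n ρ φ) (hρ : (Set.range ρ).Finite) :
    ∃ v : F.D → V, ∀ τ z, φ τ z = ∑ x, theta F x τ z • v x := by
  obtain ⟨Γ', hnorm, hfin, hΓ'⟩ := exists_normal_le_ker hρ
  -- The coordinates of `φ` are scalar functions invariant under `Γ'`.
  let b := Module.finBasis ℂ V
  have h1 : ∀ i, ∃ v : F.D → ℂ, ∀ τ z, b.coord i (φ τ z) = ∑ x, theta F x τ z • v x := by
    intro i
    have h2 := exists_slash_eq_sum_theta (F := F) (φ := fun τ z => b.coord i (φ τ z)) Γ' ?_ ?_ ?_ 1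
    · simpa only [slash_one] using h2
    · intro γ hγ
      obtain ⟨hγΓ, hγ1⟩ := hΓ' γ hγ
      rw [slash_map]
      funext τ z
      rw [h.slash_eq ⟨γ, hγΓ⟩, hγ1]
      rfl
    · intro g
      rw [slash_map]
      exact (h.expansion g).map (LinearMap.toContinuousLinearMap (b.coord i))
    · intro l m
      rw [heisSlash_map, h.heisSlash_eq]
  choose v hv using h1
  refine ⟨fun x => ∑ i, v i x • b i, fun τ z => ?_⟩
  simp only [Finset.smul_sum]
  rw [Finset.sum_comm, ← b.sum_repr (φ τ z)]
  refine Finset.sum_congr rfl fun i _ => ?_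
  have h2 := hv i τ z
  rw [Module.Basis.coord_apply] at h2
  rw [h2, Finset.sum_smul]
  exact Finset.sum_congr rfl fun x _ => by rw [smul_assoc]

/-- The theta series has a Fourier expansion with exponents `l = ¼F⁻¹[r]`, at which the condition
`4l - F⁻¹[r] ≥ 0` is an equality. -/
theorem hasJacobiExpansion_theta (F : HalfIntegral n) (x : F.D) :
    HasJacobiExpansion F (theta F x) := by
  classical
  obtain ⟨N, hN, hk⟩ := F.exists_denominator
  choose k hk using hk
  have hN' : (N : ℝ) ≠ 0 := Nat.cast_ne_zero.mpr hN.ne'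
  have hq : ∀ r, (((k r : ℚ) / N : ℚ) : ℝ) = F.qf r := by
    intro r
    push_cast
    rw [← hk, mul_div_cancel_left₀ _ hN']
  refine ⟨fun l r => if l = (k r : ℚ) / N ∧ (QuotientAddGroup.mk r : F.D) = x then 1 else 0,
    fun l r hne => ?_, fun τ z => ?_⟩
  · have h1 : l = (k r : ℚ) / N := by
      by_contra h0
      exact hne (if_neg fun h2 => h0 h2.1)
    rw [h1, hq, HalfIntegral.qf]
    linarith
  · have hinj : Function.Injective fun r : Fin n → ℤ => (((k r : ℚ) / N, r) : ℚ × (Fin n → ℤ)) :=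
      fun r s hrs => congrArg Prod.snd hrs
    rw [← hinj.hasSum_iff]
    · refine hasSum_of_eq (hasSum_theta F x τ z) fun r => ?_
      simp only [Function.comp_apply, true_and]
      split_ifs
      · rw [smul_eq_mul, mul_one, ← e_add, thetaTerm]
        have h1 : (((k r : ℚ) / N : ℚ) : ℂ) = (F.qf r : ℂ) := by
          rw [← hq]; norm_cast
        rw [h1, mul_comm (τ : ℂ), dotProduct_comm z]
        rfl
      · rw [smul_zero]
    · rintro ⟨l, r⟩ hlr
      dsimp only
      rw [if_neg, smul_zero]
      rintro ⟨rfl, -⟩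
      exact hlr ⟨r, rfl⟩

theorem IsHolomorphic.sum_smul {θ : F.D → ℍ → (Fin n → ℂ) → ℂ} (h : ∀ x, IsHolomorphic (θ x))
    (v : F.D → V) : IsHolomorphic fun τ z => ∑ x, θ x τ z • v x := by
  unfold IsHolomorphic
  exact DifferentiableOn.fun_sum fun x _ => DifferentiableOn.smul_const (h x) (v x)

theorem HasJacobiExpansion.sum_smul {θ : F.D → ℍ → (Fin n → ℂ) → ℂ}
    (h : ∀ x, HasJacobiExpansion F (θ x)) (v : F.D → V) :
    HasJacobiExpansion F fun τ z => ∑ x, θ x τ z • v x := by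
  choose c hc hs using h
  refine ⟨fun l r => ∑ x, c x l r • v x, fun l r hne => ?_, fun τ z => ?_⟩
  · obtain ⟨x, -, hx⟩ := Finset.exists_ne_zero_of_sum_ne_zero hne
    exact hc x l r fun h0 => hx (by rw [h0, zero_smul])
  · refine hasSum_of_eq (hasSum_sum fun x (_ : x ∈ Finset.univ) => (hs x τ z).smul_const (v x)) ?_
    intro p
    simp only [Finset.smul_sum, smul_assoc]

/-- The action of `Mp` on the theta series, expressed through the Weil representation. -/
theorem slash_sum_theta {E : Type*} [NormedAddCommGroup E] [NormedSpace ℂ E]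
    (f : (F.D →₀ ℂ) →ₗ[ℂ] E) (α : Mp) (τ : ℍ) (z : Fin n → ℂ) :
    slash F n (fun τ z => ∑ x, theta F x τ z • f (Finsupp.single x 1)) α τ z =
      ∑ x, theta F x τ z • f (weilRep F α (Finsupp.single x 1)) := by
  rw [slash_sum_smul]
  simp only [isThetaMatrix_weilMatrix F α _ τ z, weilRep_single, map_sum, map_smul,
    Finset.smul_sum, Finset.sum_smul, smul_assoc]
  rw [Finset.sum_comm]

/-- Every `Γ`-homomorphism `f : W(F) → V` gives a Jacobi form of critical weight. -/
theorem isJacobiForm_sum_theta (f : (F.D →₀ ℂ) →ₗ[ℂ] V)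
    (hf : ∀ (γ : Γ) w, f (weilRep F γ w) = ρ γ (f w)) :
    IsJacobiForm F n ρ fun τ z => ∑ x, theta F x τ z • f (Finsupp.single x 1) where
  holo := IsHolomorphic.sum_smul (fun x => isHolomorphic_theta F x) _
  transform γ l m τ z := by
    rw [show slash F n (fun τ z => ∑ x, theta F x τ z • f (Finsupp.single x 1)) (γ : Mp) =
      fun τ z => ∑ x, theta F x τ z • ρ γ (f (Finsupp.single x 1)) from by
        funext τ z; rw [slash_sum_theta]; simp only [hf]]
    simp only [map_sum, map_smul]
    rw [heisSlash, Finset.smul_sum]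
    refine Finset.sum_congr rfl fun x _ => ?_
    rw [← smul_assoc]
    congr 1
    exact congrFun (congrFun (heisSlash_theta F x l m) τ) z
  expansion α := by
    rw [show slash F n (fun τ z => ∑ x, theta F x τ z • f (Finsupp.single x 1)) α =
      fun τ z => ∑ x, theta F x τ z • f (weilRep F α (Finsupp.single x 1)) from by
        funext τ z; rw [slash_sum_theta]]
    exact HasJacobiExpansion.sum_smul (fun x => hasJacobiExpansion_theta F x) _

/-- Every Jacobi form of critical weight comes from a `Γ`-homomorphism `f : W(F) → V`. -/
theorem IsJacobiForm.exists_hom [Γ.FiniteIndex] [FiniteDimensional ℂ V]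
    (h : IsJacobiForm F n ρ φ) (hρ : (Set.range ρ).Finite) :
    ∃ f : (F.D →₀ ℂ) →ₗ[ℂ] V, (∀ (γ : Γ) w, f (weilRep F γ w) = ρ γ (f w)) ∧
      ∀ τ z, φ τ z = ∑ x, theta F x τ z • f (Finsupp.single x 1) := by
  obtain ⟨v, hv⟩ := h.exists_eq_sum_theta hρ
  have hφ : φ = fun τ z => ∑ x, theta F x τ z •
      Finsupp.linearCombination ℂ v (Finsupp.single x 1) := by
    funext τ z
    simp [hv]
  refine ⟨Finsupp.linearCombination ℂ v, fun γ w => ?_, fun τ z => congrFun (congrFun hφ τ) z⟩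
  have h1 : Finsupp.linearCombination ℂ v ∘ₗ weilRep F γ =
      ρ γ ∘ₗ Finsupp.linearCombination ℂ v := by
    refine Finsupp.lhom_ext' fun x => LinearMap.ext_ring ?_
    refine congrFun (theta_linearIndependent F UpperHalfPlane.I
      (a := fun x => Finsupp.linearCombination ℂ v (weilRep F γ (Finsupp.single x 1)))
      (b := fun x => ρ γ (Finsupp.linearCombination ℂ v (Finsupp.single x 1))) fun z => ?_) x
    rw [← slash_sum_theta, ← hφ, h.slash_eq, hφ, map_sum]
    simp only [map_smul]
  exact LinearMap.congr_fun h1 w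

end Critical

/-! ### Frobenius reciprocity -/

section Frobenius

variable {V : Type*} [NormedAddCommGroup V] [NormedSpace ℂ V]
variable {Γ : Subgroup Mp} (ρ : Representation ℂ Γ V)
variable {W : Type*} [AddCommGroup W] [Module ℂ W]

open Classical in
/-- The value at the trivial coset: the linear map `Ind V → V` that sends `g ⊗ v` to `g v` for
`g ∈ Γ`, and to `0` for `g ∉ Γ`. -/
def indEval : Representation.IndV Γ.subtype ρ →ₗ[ℂ] V :=
  Representation.Coinvariants.lift _
    (TensorProduct.lift <| (Finsupp.lift _ _ _ fun h : Mp =>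
        if hh : h⁻¹ ∈ Γ then ρ ⟨h⁻¹, hh⟩ else 0) ∘ₗ
      (MonoidAlgebra.coeffLinearEquiv ℂ).toLinearMap)
    fun γ => by
      ext h v
      by_cases hh : h ∈ Γ
      · have h1 : (γ : Mp) * h ∈ Γ := Γ.mul_mem γ.2 hh
        have h2 : (⟨h⁻¹, Γ.inv_mem hh⟩ : Γ) =
            ⟨h⁻¹ * (γ : Mp)⁻¹, Γ.mul_mem (Γ.inv_mem hh) (Γ.inv_mem γ.2)⟩ * γ := by
          ext1; simp
        simp [hh, h1, h2]
      · have h1 : (γ : Mp) * h ∉ Γ := by rwa [Γ.mul_mem_cancel_left γ.2]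
        simp [hh, h1]

variable {ρ}

theorem indEval_indTmul_of_mem {g : Mp} (hg : g ∈ Γ) (v : V) :
    indEval ρ (indTmul ρ g v) = ρ ⟨g, hg⟩ v := by
  simp [indEval, indTmul, hg]

theorem indEval_indTmul_of_notMem {g : Mp} (hg : g ∉ Γ) (v : V) :
    indEval ρ (indTmul ρ g v) = 0 := by
  simp [indEval, indTmul, hg]

theorem indEval_Ind (γ : Γ) (u : Representation.IndV Γ.subtype ρ) :
    indEval ρ (Ind ρ γ u) = ρ γ (indEval ρ u) := by
  suffices h : indEval ρ ∘ₗ Ind ρ γ = ρ γ ∘ₗ indEval ρ from LinearMap.congr_fun h u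
  refine Representation.IndV.hom_ext _ _ fun h => LinearMap.ext fun v => ?_
  obtain ⟨g, rfl⟩ : ∃ g, h = g⁻¹ := ⟨h⁻¹, (inv_inv h).symm⟩
  change indEval ρ (Ind ρ γ (indTmul ρ g v)) = ρ γ (indEval ρ (indTmul ρ g v))
  rw [Ind_indTmul]
  by_cases hg : g ∈ Γ
  · rw [indEval_indTmul_of_mem hg, indEval_indTmul_of_mem (Γ.mul_mem γ.2 hg),
      ← Module.End.mul_apply, ← map_mul]
    rfl
  · rw [indEval_indTmul_of_notMem hg, map_zero, indEval_indTmul_of_notMem]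
    rwa [Γ.mul_mem_cancel_left γ.2]

variable [Γ.FiniteIndex]

/-- The finite set of cosets `gΓ`. -/
instance fintypeQuotient : Fintype (Mp ⧸ Γ) :=
  haveI : Finite (Mp ⧸ Γ) := Subgroup.finite_quotient_of_finiteIndex
  Fintype.ofFinite _

/-- Every `u ∈ Ind V` is the sum of its components `g ⊗ (g⁻¹u)(1)` along the cosets `gΓ`. -/
theorem sum_indTmul_indEval (u : Representation.IndV Γ.subtype ρ) :
    ∑ q : Mp ⧸ Γ, indTmul ρ q.out (indEval ρ (Ind ρ q.out⁻¹ u)) = u := by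
  suffices h : ∑ q : Mp ⧸ Γ, Representation.IndV.mk Γ.subtype ρ q.out⁻¹ ∘ₗ
      indEval ρ ∘ₗ Ind ρ q.out⁻¹ = LinearMap.id by
    have h1 := LinearMap.congr_fun h u
    rwa [LinearMap.sum_apply] at h1
  refine Representation.IndV.hom_ext _ _ fun h => LinearMap.ext fun v => ?_
  obtain ⟨g, rfl⟩ : ∃ g, h = g⁻¹ := ⟨h⁻¹, (inv_inv h).symm⟩
  rw [LinearMap.comp_apply, LinearMap.sum_apply]
  change ∑ q : Mp ⧸ Γ, indTmul ρ q.out (indEval ρ (Ind ρ q.out⁻¹ (indTmul ρ g v))) =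
    indTmul ρ g v
  have hmem : (g : Mp ⧸ Γ).out⁻¹ * g ∈ Γ :=
    QuotientGroup.eq.mp (QuotientGroup.out_eq' (g : Mp ⧸ Γ))
  rw [Finset.sum_eq_single (g : Mp ⧸ Γ)]
  · rw [Ind_indTmul, indEval_indTmul_of_mem hmem, ← indTmul_mul]
    simp
  · intro q _ hq
    rw [Ind_indTmul, indEval_indTmul_of_notMem]
    · exact map_zero (Representation.IndV.mk Γ.subtype ρ q.out⁻¹)
    intro h
    exact hq ((QuotientGroup.out_eq' q).symm.trans (QuotientGroup.eq.mpr h))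
  · intro h; exact absurd (Finset.mem_univ _) h

/-- Frobenius reciprocity: a `Γ`-homomorphism `f : W → V` is the value at the trivial coset of an
`Mp`-homomorphism `W → Ind V`, namely of `w ↦ ∑_{gΓ} g ⊗ f(g⁻¹w)`. -/
theorem exists_intertwiningMap (σ : Representation ℂ Mp W) (f : W →ₗ[ℂ] V)
    (hf : ∀ (γ : Γ) w, f (σ γ w) = ρ γ (f w)) :
    ∃ A : Representation.IntertwiningMap σ (Ind ρ), ∀ w, indEval ρ (A w) = f w := by
  have hcoset : ∀ (g g' : Mp) w, (g : Mp ⧸ Γ) = g' →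
      indTmul ρ g (f (σ g⁻¹ w)) = indTmul ρ g' (f (σ g'⁻¹ w)) := by
    intro g g' w hgg
    obtain ⟨γ, rfl⟩ : ∃ γ : Γ, g' = g * γ :=
      ⟨⟨_, QuotientGroup.eq.mp hgg⟩, by simp⟩
    rw [indTmul_mul, ← hf, ← Module.End.mul_apply, ← map_mul]
    simp
  refine ⟨LinearMap.intertwiningMap_of_isIntertwiningMap (ρ := σ) (σ := Ind ρ)
    (f := ∑ q : Mp ⧸ Γ, Representation.IndV.mk Γ.subtype ρ q.out⁻¹ ∘ₗ f ∘ₗ σ q.out⁻¹) ?_, ?_⟩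
  · intro g w
    rw [LinearMap.sum_apply, LinearMap.sum_apply, map_sum]
    change ∑ q : Mp ⧸ Γ, indTmul ρ q.out (f (σ q.out⁻¹ (σ g w))) =
      ∑ q : Mp ⧸ Γ, Ind ρ g (indTmul ρ q.out (f (σ q.out⁻¹ w)))
    rw [← Equiv.sum_comp (MulAction.toPerm g) fun q : Mp ⧸ Γ =>
      indTmul ρ q.out (f (σ q.out⁻¹ (σ g w)))]
    refine Finset.sum_congr rfl fun q _ => ?_
    rw [Ind_indTmul, hcoset _ (g * q.out)]
    · rw [← Module.End.mul_apply, ← map_mul, mul_inv_rev, inv_mul_cancel_right]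
    · rw [QuotientGroup.out_eq', MulAction.toPerm_apply]
      conv_lhs => rw [← QuotientGroup.out_eq' q]
      rfl
  · intro w
    change indEval ρ ((∑ q : Mp ⧸ Γ, Representation.IndV.mk Γ.subtype ρ q.out⁻¹ ∘ₗ f ∘ₗ
      σ q.out⁻¹) w) = f w
    rw [LinearMap.sum_apply, map_sum, Finset.sum_eq_single ((1 : Mp) : Mp ⧸ Γ)]
    · change indEval ρ (indTmul ρ (((1 : Mp) : Mp ⧸ Γ)).out _) = f w
      have hmem : ((1 : Mp) : Mp ⧸ Γ).out ∈ Γ := by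
        have h := QuotientGroup.eq.mp (QuotientGroup.out_eq' ((1 : Mp) : Mp ⧸ Γ))
        simpa using h
      rw [indEval_indTmul_of_mem hmem, LinearMap.comp_apply, ← hf, ← Module.End.mul_apply,
        ← map_mul]
      simp
    · intro q _ hq
      refine indEval_indTmul_of_notMem (fun h => hq ?_) _
      rw [← QuotientGroup.out_eq' q]
      exact QuotientGroup.eq.mpr (by simpa using h)
    · intro h; exact absurd (Finset.mem_univ _) h

end Frobenius

/-! ### The isomorphism -/

section Isomorphism

variable {V : Type*} [NormedAddCommGroup V] [NormedSpace ℂ V]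
variable {Γ : Subgroup Mp} (F : HalfIntegral n) (ρ : Representation ℂ Γ V)

theorem intertwiningMap_ext {A B : Representation.IntertwiningMap (weilRep F) (Ind ρ)}
    (h : ∀ x, A (Finsupp.single x 1) = B (Finsupp.single x 1)) : A = B :=
  Representation.IntertwiningMap.toLinearMap_injective _ _
    (Finsupp.lhom_ext' fun x => LinearMap.ext_ring (h x))

theorem inducedForm_eq_sum [Γ.FiniteIndex] (φ : ℍ → (Fin n → ℂ) → V) (κ : ℤ) (τ : ℍ) (z : Fin n → ℂ) :
    inducedForm F κ ρ φ τ z =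
      ∑ q : Mp ⧸ Γ, indTmul ρ q.out (slash F κ φ q.out⁻¹ τ z) :=
  finsum_eq_sum_of_fintype _

variable [FiniteDimensional ℂ V]

/-- The Jacobi form `∑ₓ ϑ_{F,x} · (A 𝐞ₓ)(1)` of an `Mp`-homomorphism `A : W(F) → Ind V`, where
`u(1)` denotes the value of `u ∈ Ind V` at the trivial coset. -/
def thetaLift : Representation.IntertwiningMap (weilRep F) (Ind ρ) →ₗ[ℂ] J F (n : ℤ) ρ where
  toFun A := ⟨fun τ z => ∑ x, theta F x τ z •
      (indEval ρ ∘ₗ A.toLinearMap) (Finsupp.single x 1),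
    isJacobiForm_sum_theta _ fun γ w => by
      have h := LinearMap.congr_fun (A.isIntertwining' γ) w
      rw [LinearMap.comp_apply, LinearMap.comp_apply, ← indEval_Ind]
      exact congrArg _ h⟩
  map_add' A B := by
    ext τ z
    simp [smul_add, Finset.sum_add_distrib]
  map_smul' a A := by
    ext τ z
    simp [Finset.smul_sum, smul_comm a]

variable [Γ.FiniteIndex]

theorem inducedForm_thetaLift (A : Representation.IntertwiningMap (weilRep F) (Ind ρ)) (τ : ℍ)
    (z : Fin n → ℂ) : inducedForm F n ρ (thetaLift F ρ A).1 τ z =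
      ∑ x, theta F x τ z • A (Finsupp.single x 1) := by
  rw [inducedForm_eq_sum]
  have h : ∀ (g : Mp) w, A (weilRep F g w) = Ind ρ g (A w) := fun g w =>
    LinearMap.congr_fun (A.isIntertwining' g) w
  have h1 : ∀ q : Mp ⧸ Γ, indTmul ρ q.out (slash F n (thetaLift F ρ A).1 q.out⁻¹ τ z) =
      ∑ x, theta F x τ z •
        indTmul ρ q.out (indEval ρ (Ind ρ q.out⁻¹ (A (Finsupp.single x 1)))) := by
    intro q
    have h2 := slash_sum_theta (F := F) (indEval ρ ∘ₗ A.toLinearMap) q.out⁻¹ τ z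
    rw [show slash F n (thetaLift F ρ A).1 q.out⁻¹ τ z = _ from h2]
    refine (map_sum (Representation.IndV.mk Γ.subtype ρ q.out⁻¹) _ _).trans
      (Finset.sum_congr rfl fun x _ => ?_)
    rw [map_smul, ← h]
    rfl
  simp only [h1]
  rw [Finset.sum_comm]
  simp only [← Finset.smul_sum, sum_indTmul_indEval]

theorem thetaLift_bijective (hρ : (Set.range ρ).Finite) : Function.Bijective (thetaLift F ρ) := by
  constructor
  · intro A B hAB
    refine intertwiningMap_ext F ρ (congrFun (theta_linearIndependent F UpperHalfPlane.I
      fun z => ?_))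
    rw [← inducedForm_thetaLift, ← inducedForm_thetaLift, hAB]
  · intro φ
    obtain ⟨f, hf, hφ⟩ := IsJacobiForm.exists_hom φ.2 hρ
    obtain ⟨A, hA⟩ := exists_intertwiningMap (weilRep F) f hf
    refine ⟨A, ?_⟩
    ext τ z
    rw [hφ]
    exact Finset.sum_congr rfl fun x _ => congrArg _ (hA _)

/-- The isomorphism `Φ_V`, defined as the inverse of `thetaLift`. -/
def jacobiEquiv (hρ : (Set.range ρ).Finite) :
    J F (n : ℤ) ρ ≃ₗ[ℂ] Representation.IntertwiningMap (weilRep F) (Ind ρ) :=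
  (LinearEquiv.ofBijective (thetaLift F ρ) (thetaLift_bijective F ρ hρ)).symm

theorem inducedForm_eq_jacobiEquiv (hρ : (Set.range ρ).Finite) (φ : J F (n : ℤ) ρ) (τ : ℍ)
    (z : Fin n → ℂ) : inducedForm F n ρ φ.1 τ z =
      ∑ x, theta F x τ z • jacobiEquiv F ρ hρ φ (Finsupp.single x 1) := by
  rw [← inducedForm_thetaLift]
  congr 2
  exact ((LinearEquiv.ofBijective (thetaLift F ρ)
    (thetaLift_bijective F ρ hρ)).apply_symm_apply φ).symm

variable {F ρ} {V' : Type*} [NormedAddCommGroup V'] [NormedSpace ℂ V'] [FiniteDimensional ℂ V']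
  {ρ' : Representation ℂ Γ V'}

theorem inducedForm_map (f : Representation.IntertwiningMap ρ ρ') (κ : ℤ) (φ : J F κ ρ) (τ : ℍ)
    (z : Fin n → ℂ) :
    inducedForm F κ ρ' (J.map F κ f φ).1 τ z = indMap f (inducedForm F κ ρ φ.1 τ z) := by
  rw [inducedForm_eq_sum, inducedForm_eq_sum, map_sum]
  refine Finset.sum_congr rfl fun q _ => ?_
  rw [indMap_indTmul]
  congr 1
  exact congrFun (congrFun (slash_map F κ f.toLinearMap φ.1 q.out⁻¹) τ) z

theorem jacobiEquiv_map (hρ : (Set.range ρ).Finite) (hρ' : (Set.range ρ').Finite)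
    (f : Representation.IntertwiningMap ρ ρ') (φ : J F (n : ℤ) ρ) (v : F.D →₀ ℂ) :
    jacobiEquiv F ρ' hρ' (J.map F n f φ) v = indMap f (jacobiEquiv F ρ hρ φ v) := by
  suffices h : (jacobiEquiv F ρ' hρ' (J.map F n f φ)).toLinearMap =
      indMap f ∘ₗ (jacobiEquiv F ρ hρ φ).toLinearMap from LinearMap.congr_fun h v
  refine Finsupp.lhom_ext' fun x => LinearMap.ext_ring ?_
  refine congrFun (theta_linearIndependent F UpperHalfPlane.I
    (a := fun x => jacobiEquiv F ρ' hρ' (J.map F n f φ) (Finsupp.single x 1))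
    (b := fun x => indMap f (jacobiEquiv F ρ hρ φ (Finsupp.single x 1))) fun z => ?_) x
  rw [← inducedForm_eq_jacobiEquiv, inducedForm_map, inducedForm_eq_jacobiEquiv F ρ hρ, map_sum]
  simp only [map_smul]

end Isomorphism

end CriticalJacobi

end


theorem mainTheorem7 {n : ℕ} (F : HalfIntegral n) (Γ : Subgroup Mp) [Γ.FiniteIndex] :
    (IsWeilAction F (weilRep F) ∧
      ∀ W : Representation ℂ Mp (F.D →₀ ℂ), IsWeilAction F W → W = weilRep F) ∧
    ∃ Φ : ∀ (V : Type u) [NormedAddCommGroup V] [NormedSpace ℂ V] [FiniteDimensional ℂ V]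
        (ρ : Representation ℂ Γ V), (Set.range ρ).Finite →
          (J F (n : ℤ) ρ ≃ₗ[ℂ] Representation.IntertwiningMap (weilRep F) (Ind ρ)),
      (∀ (V : Type u) [NormedAddCommGroup V] [NormedSpace ℂ V] [FiniteDimensional ℂ V]
          (ρ : Representation ℂ Γ V) (hρ : (Set.range ρ).Finite) (φ : J F (n : ℤ) ρ)
          (τ : UpperHalfPlane) (z : Fin n → ℂ),
        inducedForm F (n : ℤ) ρ φ.1 τ z =
          ∑ x : F.D, theta F x τ z • Φ V ρ hρ φ (Finsupp.single x 1)) ∧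
      (∀ (V V' : Type u) [NormedAddCommGroup V] [NormedSpace ℂ V] [FiniteDimensional ℂ V]
          [NormedAddCommGroup V'] [NormedSpace ℂ V'] [FiniteDimensional ℂ V']
          (ρ : Representation ℂ Γ V) (ρ' : Representation ℂ Γ V')
          (hρ : (Set.range ρ).Finite) (hρ' : (Set.range ρ').Finite)
          (f : Representation.IntertwiningMap ρ ρ') (φ : J F (n : ℤ) ρ) (v : F.D →₀ ℂ),
        Φ V' ρ' hρ' (J.map F (n : ℤ) f φ) v = indMap f (Φ V ρ hρ φ v)) := by
  refine ⟨⟨isWeilAction_weilRep F, fun W hW => hW.unique F (isWeilAction_weilRep F)⟩,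
    fun V _ _ _ ρ hρ => jacobiEquiv F ρ hρ, ?_, ?_⟩
  · intro V _ _ _ ρ hρ φ τ z
    exact inducedForm_eq_jacobiEquiv F ρ hρ φ τ z
  · intro V V' _ _ _ _ _ _ ρ ρ' hρ hρ' f φ v
    exact jacobiEquiv_map hρ hρ' f φ v
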